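/- \textbf{Setting.} $K$ agents are linked by a graph with a symmetric doubly stochastic combination matrix $A=(a_{\ell k})$; any two agents are joined by a path of positive weights and at least one $a_{kk}$ is positive. Agent $k$ has training samples $x_{k,1},\dots,x_{k,N_k}$, a loss $Q_k(w;x)$ on $\mathbb R^M$ and the risk $J_k(w)=\frac1{N_k}\sum_i Q_k(w;x_{k,i})$; put $J=\frac1K\sum_k J_k$. The functions $Q_k(\cdot;x_{k,i})$ are $C^2$ with $L$-Lipschitz gradients. Let $w^\star$ be a local minimizer of $J$, $H_k^\star=\nabla^2J_k(w^\star)$, and let $\bar H=\frac1K\sum_kH_k^\star$ be positive definite with $\bar H\succeq\sigma I$, $\sigma>0$. For a step size $\mu>0$ and a batch size $B=B(\mu)\ge1$, each agent $k$ draws at each instant $n\ge0$ samples $\boldsymbol x_{k,n}^1,\dots,\boldsymbol x_{k,n}^B$ uniformly with replacement from its training samples, all draws being independent. With $\boldsymbol g_{k,n}(w)=\frac1B\sum_{b}\nabla Q_k(w;\boldsymbol x_{k,n}^b)$, consensus and diffusion are $$\text{(con)}\quad \boldsymbol w_{k,n}=\sum_\ell a_{\ell k}\boldsymbol w_{\ell,n-1}-\mu\,\boldsymbol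 g_{k,n}(\boldsymbol w_{k,n-1}),\qquad \text{(dif)}\quad \boldsymbol w_{k,n}=\sum_\ell a_{\ell k}\bigl(\boldsymbol w_{\ell,n-1}-\mu\,\boldsymbol g_{\ell,n}(\boldsymbol w_{\ell,n-1})\bigr),$$ each started at random points $\boldsymbol w_{k,-1}$ (not necessarily the same for the two methods) that are independent of the draws, have a finite fourth moment and satisfy $\mathbb E\|\boldsymbol w_{k,-1}-w^\star\|^4=o(\mu^2/B^2)$ as $\mu\to0^+$. Assume $\frac1B\le c\,\mu^\eta$ for all small $\mu$, with constants $c$ and $\eta\ge0$. The excess risk (escaping efficiency) of a method is $\mathrm{ER}_n=\frac1K\sum_k\mathbb E J(\boldsymbol w_{k,n})-J(w^\star)$. \textbf{Statement (smaller $\mathrm{ER}_n$ for diffusion).} There is $\varepsilon_0>0$, depending only on $A$ and $\sigma$, such that, if $\|H_k^\star-\bar H\|\le\varepsilon_0$ for all $k$ (small Hessian disagreement), then the expectations $\mathbb E J(\boldsymbol w_{k,n})$ exist for both methods and, for every $T>0$: (a) up to the orders $o(\mu^2)$ and $o(\mu^{1+\eta})$, $\mathrm{ER}_{n,dif}\le\mathrm{ER}_{n,con}$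 uniformly in $0\le n\le T/\mu$; that is, for every $\delta>0$ and all sufficiently small $\mu>0$, $\mathrm{ER}_{n,dif}\le\mathrm{ER}_{n,con}+\delta(\mu^2+\mu^{1+\eta})$ for all $0\le n\le T/\mu$; (b) if $\eta\ge1$ (large batches) and the network is heterogeneous at $w^\star$, i.e. $\nabla J_k(w^\star)\ne0$ for some $k$, then for all sufficiently small $\mu>0$ the inequality $\mathrm{ER}_{n,dif}\le\mathrm{ER}_{n,con}$ holds exactly, for all $0\le n\le T/\mu$. -/

import Mathlib

open MeasureTheory ProbabilityTheory Filter Topology Asymptotics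
open scoped NNReal

universe u v

/-- Model space `ℝ^M` with the Euclidean norm. -/
abbrev Vec (M : ℕ) : Type := EuclideanSpace ℝ (Fin M)

/-- `A` is a symmetric doubly stochastic combination matrix of a strongly connected graph:
any two agents are linked by a path of positive weights, and some agent has a self-loop. -/
structure IsCombinationMatrix {K : ℕ} (A : Matrix (Fin K) (Fin K) ℝ) : Prop where
  symm : A.IsSymm
  stochastic : A ∈ doublyStochastic ℝ (Fin K)
  connected : ∀ k l, Relation.ReflTransGen (fun i j => 0 < A i j) k l
  selfLoop : ∃ k, 0 < A k k

/-- The data of a distributed empirical risk minimization problem with `K` agents: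
agent `k` has `N k` training samples `x k i` and the loss function `Q k`. -/
structure Problem (K M : ℕ) (X : Type u) where
  N : Fin K → ℕ
  x : ∀ k, Fin (N k) → X
  Q : Fin K → Vec M → X → ℝ

namespace Problem

variable {K M : ℕ} {X : Type u} (p : Problem K M X)

/-- Individual risk `J_k(w) = (1/N_k) ∑_i Q_k(w; x_{k,i})`. -/
noncomputable def Jk (k : Fin K) (w : Vec M) : ℝ :=
  (p.N k : ℝ)⁻¹ * ∑ i, p.Q k w (p.x k i)

/-- Aggregate risk `J(w) = (1/K) ∑_k J_k(w)`. -/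
noncomputable def J (w : Vec M) : ℝ := (K : ℝ)⁻¹ * ∑ k, p.Jk k w

/-- Gradient of the loss of agent `k` at its `i`-th training sample. -/
noncomputable def gradQ (k : Fin K) (i : Fin (p.N k)) (w : Vec M) : Vec M :=
  gradient (fun v => p.Q k v (p.x k i)) w

/-- Hessian of the individual risk `J_k`, as a linear operator. -/
noncomputable def hess (k : Fin K) (w : Vec M) : Vec M →L[ℝ] Vec M :=
  fderiv ℝ (gradient (p.Jk k)) w

/-- Average Hessian `(1/K) ∑_k ∇²J_k(w)`. -/
noncomputable def avgHess (w : Vec M) : Vec M →L[ℝ] Vec M :=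
  (K : ℝ)⁻¹ • ∑ k, p.hess k w

/-- The losses at the training samples are twice continuously differentiable, with
`L`-Lipschitz gradients. -/
structure IsSmooth (L : ℝ≥0) : Prop where
  contDiff : ∀ k i, ContDiff ℝ 2 (fun w => p.Q k w (p.x k i))
  lipschitz : ∀ k i, LipschitzWith L (p.gradQ k i)

variable {Ω : Type v} [MeasurableSpace Ω]

/-- `I k n b` is the index of the `b`-th training sample that agent `k` draws at instant `n`.
All draws are mutually independent, and each is uniform on the training set of its agent. -/
structure IsUniformSampling (P : Measure Ω)
    (I : ∀ k : Fin K, ℕ → ℕ → Ω → Fin (p.N k)) : Prop where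
  measurable : ∀ k n b, Measurable (I k n b)
  uniform : ∀ k n b i, P.real {ω | I k n b ω = i} = (p.N k : ℝ)⁻¹
  indep : iIndepFun (fun (t : Σ _ : Fin K, ℕ × ℕ) => I t.1 t.2.1 t.2.2) P

/-- Starting points `w₀ μ k` of the agents, one family for each step size `μ > 0`: random
vectors, independent of all draws, with `E ‖w₀ μ k - w⋆‖⁴ = o(μ² / B²)` as `μ → 0⁺`, where
`B μ` is the batch size used with the step size `μ`. -/
structure IsCloseStart (P : Measure Ω) (I : ∀ k : Fin K, ℕ → ℕ → Ω → Fin (p.N k))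
    (B : ℝ → ℕ) (wstar : Vec M) (w₀ : ℝ → Fin K → Ω → Vec M) : Prop where
  measurable : ∀ μ, 0 < μ → ∀ k, Measurable (w₀ μ k)
  memLp : ∀ μ, 0 < μ → ∀ k, MemLp (w₀ μ k) 4 P
  indep : ∀ μ, 0 < μ → IndepFun (fun ω k => w₀ μ k ω) (fun ω k n b => I k n b ω) P
  close : ∀ k, (fun μ => ∫ ω, ‖w₀ μ k ω - wstar‖ ^ 4 ∂P)
    =o[𝓝[>] 0] (fun μ => μ ^ 2 / (B μ : ℝ) ^ 2)

/-- Mini-batch gradient `(1/B) ∑_b ∇Q_k(w; x_{k,n}^b)` of agent `k` at instant `n`. -/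
noncomputable def batchGrad (I : ∀ k : Fin K, ℕ → ℕ → Ω → Fin (p.N k)) (B : ℕ)
    (n : ℕ) (k : Fin K) (w : Vec M) (ω : Ω) : Vec M :=
  (B : ℝ)⁻¹ • ∑ b ∈ Finset.range B, p.gradQ k (I k n b ω) w

/-- Consensus iterates, shifted by one: index `0` is the starting point `w_{k,-1}`, and index
`n + 1` is `w_{k,n} = ∑_l a_{lk} w_{l,n-1} - (μ/B) ∑_b ∇Q_k(w_{k,n-1}; x_{k,n}^b)`. -/
noncomputable def consensus (A : Matrix (Fin K) (Fin K) ℝ)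
    (I : ∀ k : Fin K, ℕ → ℕ → Ω → Fin (p.N k)) (B : ℕ) (μ : ℝ) (w₀ : Fin K → Ω → Vec M) :
    ℕ → Fin K → Ω → Vec M
  | 0 => w₀
  | n + 1 => fun k ω =>
      (∑ l, A l k • consensus A I B μ w₀ n l ω)
        - μ • p.batchGrad I B n k (consensus A I B μ w₀ n k ω) ω

/-- Diffusion iterates, shifted by one: index `0` is the starting point `w_{k,-1}`, and index
`n + 1` is `w_{k,n} = ∑_l a_{lk} (w_{l,n-1} - (μ/B) ∑_b ∇Q_l(w_{l,n-1}; x_{l,n}^b))`. -/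
noncomputable def diffusion (A : Matrix (Fin K) (Fin K) ℝ)
    (I : ∀ k : Fin K, ℕ → ℕ → Ω → Fin (p.N k)) (B : ℕ) (μ : ℝ) (w₀ : Fin K → Ω → Vec M) :
    ℕ → Fin K → Ω → Vec M
  | 0 => w₀
  | n + 1 => fun k ω =>
      ∑ l, A l k • (diffusion A I B μ w₀ n l ω
        - μ • p.batchGrad I B n l (diffusion A I B μ w₀ n l ω) ω)

/-- Excess risk (escaping efficiency) `ER_n = (1/K) ∑_k E J(w_{k,n}) - J(w⋆)` of a shifted
sequence of iterates (`w (n + 1) k` is `w_{k,n}`). -/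
noncomputable def excessRisk (P : Measure Ω) (wstar : Vec M) (w : ℕ → Fin K → Ω → Vec M)
    (n : ℕ) : ℝ :=
  (K : ℝ)⁻¹ * (∑ k, ∫ ω, p.J (w (n + 1) k ω) ∂P) - p.J wstar

end Problem

set_option linter.unusedSectionVars false

/-! Stack the errors of the agents relative to w⋆ into one network state. With D = 1 for consensus
and D = A for diffusion, both methods obey w' = A w - μ D (b + Z + H w + R + Φ). Here b collects the
gradients ∇J_k(w⋆), which average to zero, Z is the mini-batch noise at w⋆, H the block diagonal
Hessian, R the nonlinear part of the mean gradients, and Φ the change of the noise away from w⋆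
(`exists_isIteration`).

Put θ = μ² + μ/B. For nμ ≤ T the state is a noise centroid, plus a deterministic bias, plus errors
that are o(θ) in mean square (`eq_add_errors`, `errors_le`). The noise centroid is driven by the
average of Z; averaging erases A and D, so it is the same process for both methods. The bias
consists of a deviation d' = A d - μ D b and of a centroid that d drives through the Hessians. By a
second order expansion of J, the expected risk is half of noise energy plus bias energy, up to o(θ)
(`abs_integral_risk_sub_le`). Cross terms vanish because the noise has mean zero and the average
Hessian commutes with averaging over agents.

So only the bias energies matter (`bias_diffusion_le`). The deviation of diffusion is A applied to
that of consensus (`biasDev_self`), and A contracts states of zero mean by a factor r < 1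
(`exists_contraction_factor`); hence diffusion gains a fixed multiple of μ²‖b‖². The energy of the
centroid bias is quadratic in the Hessian disagreement, so a small ε₀ makes it cost at most half of
this guaranteed gain. Part (a) follows as θ = O(μ² + μ^(1+η)); in part (b) θ = O(μ²), and the
surplus of order μ²‖b‖² absorbs the error.

The Hessians are merely continuous, so R is small relative to the state only inside a ball of radius
ρ; outside, only the Lipschitz bound is left. The outside part is controlled by the fourth moment of
the noise centroid, which is O(μθ) (`fourth_moment_le`), and by second moments of the errors
(`tail_sq_le`). No fourth moment of the iterates themselves is needed; the rest is second moment
estimates with a discrete Gronwall inequality. -/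

/-! ### Contraction of the combination matrix on vectors of zero mean -/

/-- Dispersion identity of a doubly stochastic matrix. -/
lemma sum_sq_sub_sum_sq_mulVec {K : ℕ} {A : Matrix (Fin K) (Fin K) ℝ}
    (hA : A ∈ doublyStochastic ℝ (Fin K)) (x : Fin K → ℝ) :
    ∑ l, x l ^ 2 - ∑ k, (A.mulVec x k) ^ 2 = ∑ k, ∑ l, A k l * (x l - A.mulVec x k) ^ 2 := by
  have h1 : ∀ k, ∑ l, A k l * (x l - A.mulVec x k) ^ 2
      = ∑ l, A k l * x l ^ 2 - (A.mulVec x k) ^ 2 := by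
    intro k
    have hr := sum_row_of_mem_doublyStochastic hA k
    have hm : ∑ l, A k l * x l = A.mulVec x k := rfl
    calc ∑ l, A k l * (x l - A.mulVec x k) ^ 2
        = ∑ l, (A k l * x l ^ 2 - 2 * A.mulVec x k * (A k l * x l)
            + (A.mulVec x k) ^ 2 * A k l) := by
          refine Finset.sum_congr rfl fun l _ => by ring
      _ = _ := by
          rw [Finset.sum_add_distrib, Finset.sum_sub_distrib, ← Finset.mul_sum, ← Finset.mul_sum,
            hr, hm]
          ring
  simp_rw [h1]
  rw [Finset.sum_sub_distrib, Finset.sum_comm]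
  congr 1
  refine Finset.sum_congr rfl fun l _ => ?_
  rw [← Finset.sum_mul, sum_col_of_mem_doublyStochastic hA l, one_mul]

lemma sum_sq_mulVec_le {K : ℕ} {A : Matrix (Fin K) (Fin K) ℝ}
    (hA : A ∈ doublyStochastic ℝ (Fin K)) (x : Fin K → ℝ) :
    ∑ k, (A.mulVec x k) ^ 2 ≤ ∑ l, x l ^ 2 := by
  have h := sum_sq_sub_sum_sq_mulVec hA x
  have : 0 ≤ ∑ k, ∑ l, A k l * (x l - A.mulVec x k) ^ 2 :=
    Finset.sum_nonneg fun k _ => Finset.sum_nonneg fun l _ =>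
      mul_nonneg (nonneg_of_mem_doublyStochastic hA) (sq_nonneg _)
  linarith

/-- Without loss of energy, every term of the dispersion identity vanishes, so `x` at one end of an
edge equals `A.mulVec x` at the other end. Connectedness then makes `x` constant, hence zero because
its sum is zero. -/
lemma sum_sq_mulVec_lt {K : ℕ} {A : Matrix (Fin K) (Fin K) ℝ} (hA : IsCombinationMatrix A)
    {x : Fin K → ℝ} (hx : ∑ k, x k = 0) (hx1 : x ≠ 0) :
    ∑ k, (A.mulVec x k) ^ 2 < ∑ l, x l ^ 2 := by
  have h := sum_sq_sub_sum_sq_mulVec hA.stochastic x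
  have hnn : ∀ k l, 0 ≤ A k l * (x l - A.mulVec x k) ^ 2 := fun k l =>
    mul_nonneg (nonneg_of_mem_doublyStochastic hA.stochastic) (sq_nonneg _)
  by_contra! hcon
  have h0 : ∑ k, ∑ l, A k l * (x l - A.mulVec x k) ^ 2 = 0 :=
    le_antisymm (by linarith) (Finset.sum_nonneg fun k _ => Finset.sum_nonneg fun l _ => hnn k l)
  have hz : ∀ k l, 0 < A k l → x l = A.mulVec x k := by
    intro k l hkl
    have h1 := (Finset.sum_eq_zero_iff_of_nonneg
      (fun k _ => Finset.sum_nonneg fun l _ => hnn k l)).1 h0 k (Finset.mem_univ _)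
    have h2 := (Finset.sum_eq_zero_iff_of_nonneg (fun l _ => hnn k l)).1 h1 l (Finset.mem_univ _)
    have h3 := (mul_eq_zero.1 h2).resolve_left hkl.ne'
    have := pow_eq_zero_iff (two_ne_zero) |>.1 h3
    linarith
  obtain ⟨k0, hk0⟩ := hA.selfLoop
  -- Both equalities travel together along a path, and each step exchanges their roles. The
  -- self-loop starts the induction; it excludes the bipartite case, where -1 is an eigenvalue of
  -- `A`.
  have hall : ∀ i, x i = x k0 ∧ A.mulVec x i = x k0 := by
    intro i
    induction hA.connected k0 i with
    | refl => exact ⟨rfl, (hz _ _ hk0).symm⟩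
    | @tail b c _ hbc ih =>
      have hcb : 0 < A c b := by rw [← hA.symm.apply c b]; exact hbc
      exact ⟨(hz _ _ hbc).trans ih.2, (hz _ _ hcb).symm.trans ih.1⟩
  have hK : (K : ℝ) * x k0 = 0 := by
    rw [← hx, Finset.sum_congr rfl fun i _ => (hall i).1]; simp
  have hK0 : (K : ℝ) ≠ 0 := by
    have := k0.pos; positivity
  have hk : x k0 = 0 := (mul_eq_zero.1 hK).resolve_left hK0
  exact hx1 (funext fun i => (hall i).1.trans hk)

/-- The strict inequality holds at each point of the compact unit sphere of the zero-sum hyperplane;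
the maximum over the sphere gives a uniform factor, and homogeneity extends it. -/
lemma exists_contraction_factor {K : ℕ} {A : Matrix (Fin K) (Fin K) ℝ}
    (hA : IsCombinationMatrix A) :
    ∃ r : ℝ, 0 ≤ r ∧ r < 1 ∧ ∀ x : Fin K → ℝ, ∑ k, x k = 0 →
      ∑ k, (A.mulVec x k) ^ 2 ≤ r ^ 2 * ∑ l, x l ^ 2 := by
  set S : Set (Fin K → ℝ) := {x | ∑ k, x k = 0 ∧ ∑ k, x k ^ 2 = 1} with hS
  have hcl : IsClosed S := by
    apply IsClosed.inter
    · exact isClosed_eq (by fun_prop) (by fun_prop)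
    · exact isClosed_eq (by fun_prop) (by fun_prop)
  have hcpt : IsCompact S := by
    refine Metric.isCompact_of_isClosed_isBounded hcl ?_
    refine (Metric.isBounded_closedBall (x := (0 : Fin K → ℝ)) (r := 1)).subset fun x hx => ?_
    rw [mem_closedBall_zero_iff, pi_norm_le_iff_of_nonneg zero_le_one]
    intro i
    have h1 : x i ^ 2 ≤ ∑ k, x k ^ 2 :=
      Finset.single_le_sum (f := fun k => x k ^ 2) (fun k _ => sq_nonneg _) (Finset.mem_univ i)
    rw [hx.2] at h1
    rw [Real.norm_eq_abs]
    exact (sq_le_one_iff_abs_le_one _).1 h1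
  have hcont : Continuous fun x : Fin K → ℝ => ∑ k, (A.mulVec x k) ^ 2 := by
    have : ∀ k, Continuous fun x : Fin K → ℝ => A.mulVec x k := fun k => by
      unfold Matrix.mulVec dotProduct; fun_prop
    fun_prop
  have hscale : ∀ r : ℝ, 0 ≤ r → (∀ y ∈ S, ∑ k, (A.mulVec y k) ^ 2 ≤ r) →
      ∀ x : Fin K → ℝ, ∑ k, x k = 0 → ∑ k, (A.mulVec x k) ^ 2 ≤ r * ∑ l, x l ^ 2 := by
    intro r hr hy x hx
    by_cases hx0 : x = 0
    · simp [hx0]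
    set s := ∑ l, x l ^ 2 with hs
    have hspos : 0 < s := by
      obtain ⟨i, hi⟩ := Function.ne_iff.1 hx0
      exact Finset.sum_pos' (fun k _ => sq_nonneg _)
        ⟨i, Finset.mem_univ _, by have : x i ≠ 0 := hi; positivity⟩
    have hsq : (Real.sqrt s)⁻¹ ^ 2 = s⁻¹ := by rw [inv_pow, Real.sq_sqrt hspos.le]
    have := hy ((Real.sqrt s)⁻¹ • x) ⟨by simp [← Finset.mul_sum, hx], by
      simp only [Pi.smul_apply, smul_eq_mul, mul_pow, ← Finset.mul_sum, hsq, ← hs]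
      exact inv_mul_cancel₀ hspos.ne'⟩
    simp only [Matrix.mulVec_smul, Pi.smul_apply, smul_eq_mul, mul_pow, ← Finset.mul_sum,
      hsq] at this
    rwa [inv_mul_le_iff₀ hspos, mul_comm] at this
  -- The sphere is empty for a single agent, where zero sum forces `x = 0`.
  rcases S.eq_empty_or_nonempty with hE | hne
  · refine ⟨0, le_rfl, one_pos, fun x hx => ?_⟩
    have := hscale 0 le_rfl (by simp [hE]) x hx
    simpa using this
  · obtain ⟨y, hyS, hmax⟩ := hcpt.exists_isMaxOn hne hcont.continuousOn
    have hlt : ∑ k, (A.mulVec y k) ^ 2 < 1 := by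
      have := sum_sq_mulVec_lt hA hyS.1 (by
        rintro rfl
        simpa using hyS.2)
      rwa [hyS.2] at this
    have h0 : 0 ≤ ∑ k, (A.mulVec y k) ^ 2 := Finset.sum_nonneg fun k _ => sq_nonneg _
    refine ⟨Real.sqrt (∑ k, (A.mulVec y k) ^ 2), Real.sqrt_nonneg _, ?_, fun x hx => ?_⟩
    · rwa [Real.sqrt_lt' one_pos, one_pow]
    · rw [Real.sq_sqrt h0]
      exact hscale _ h0 (fun z hz => hmax hz) x hx

/-! ### Network states -/

/-- The stacked models of all agents. -/
abbrev NetState (K M : ℕ) : Type := PiLp 2 (fun _ : Fin K => Vec M)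

section Operators

variable {K M : ℕ}

/-- The combination step `w ↦ (∑_l a_{lk} w_l)_k`. -/
noncomputable def mix (A : Matrix (Fin K) (Fin K) ℝ) : NetState K M →L[ℝ] NetState K M where
  toFun w := WithLp.toLp 2 fun k => ∑ l, A l k • w l
  map_add' x y := by
    ext k : 1
    change ∑ l, A l k • (x l + y l) = ∑ l, A l k • x l + ∑ l, A l k • y l
    simp only [smul_add, Finset.sum_add_distrib]
  map_smul' c x := by
    ext k : 1
    change ∑ l, A l k • (c • x l) = c • ∑ l, A l k • x l
    simp only [Finset.smul_sum, smul_comm c]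
  cont := (PiLp.continuous_toLp 2 _).comp <| continuous_pi fun k =>
    continuous_finsetSum _ fun l _ =>
      Continuous.const_smul (g := fun w : NetState K M => w l) (PiLp.continuous_apply 2 _ l) (A l k)

@[simp] lemma mix_apply (A : Matrix (Fin K) (Fin K) ℝ) (w : NetState K M) (k : Fin K) :
    mix A w k = ∑ l, A l k • w l := rfl

/-- The operator that applies `H k` to the model of agent `k`. -/
noncomputable def blockDiag (H : Fin K → Vec M →L[ℝ] Vec M) :
    NetState K M →L[ℝ] NetState K M where
  toFun w := WithLp.toLp 2 fun k => H k (w k)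
  map_add' x y := by ext k : 1; exact map_add (H k) (x k) (y k)
  map_smul' c x := by ext k : 1; exact map_smul (H k) c (x k)
  cont := (PiLp.continuous_toLp 2 _).comp <| continuous_pi fun k =>
    (H k).continuous.comp (PiLp.continuous_apply 2 _ k)

@[simp] lemma blockDiag_apply (H : Fin K → Vec M →L[ℝ] Vec M) (w : NetState K M) (k : Fin K) :
    blockDiag H w k = H k (w k) := rfl

/-- The averaging operator: every agent gets the centroid. -/
noncomputable def avgOp : NetState K M →L[ℝ] NetState K M :=
  mix (Matrix.of fun _ _ => (K : ℝ)⁻¹)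

lemma avgOp_apply (w : NetState K M) (k : Fin K) : avgOp w k = (K : ℝ)⁻¹ • ∑ l, w l := by
  simp [avgOp, Finset.smul_sum]

lemma mix_mix (A B : Matrix (Fin K) (Fin K) ℝ) (w : NetState K M) :
    mix A (mix B w) = mix (B * A) w := by
  ext k : 1
  simp only [mix_apply, Matrix.mul_apply, Finset.smul_sum, smul_smul, Finset.sum_smul]
  rw [Finset.sum_comm]
  refine Finset.sum_congr rfl fun l _ => Finset.sum_congr rfl fun j _ => by rw [mul_comm]

lemma mix_one (w : NetState K M) : mix 1 w = w := by
  ext k : 1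
  simp [Matrix.one_apply]

lemma inner_mix_left {A : Matrix (Fin K) (Fin K) ℝ} (hA : A.IsSymm) (x y : NetState K M) :
    inner ℝ (mix A x) y = inner ℝ x (mix A y) := by
  simp only [PiLp.inner_apply, mix_apply, sum_inner, inner_sum, inner_smul_left, inner_smul_right]
  rw [Finset.sum_comm]
  refine Finset.sum_congr rfl fun l _ => Finset.sum_congr rfl fun j _ => ?_
  rw [← hA.apply l j]; simp

lemma mix_blockDiag_const (A : Matrix (Fin K) (Fin K) ℝ) (H : Vec M →L[ℝ] Vec M)
    (w : NetState K M) : mix A (blockDiag (fun _ => H) w) = blockDiag (fun _ => H) (mix A w) := by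
  ext k : 1
  simp

lemma avgOp_mix {A : Matrix (Fin K) (Fin K) ℝ} (hA : A ∈ doublyStochastic ℝ (Fin K))
    (w : NetState K M) : avgOp (mix A w) = avgOp w := by
  unfold avgOp
  rw [mix_mix]
  congr 2
  ext i j
  simp [Matrix.mul_apply, ← Finset.sum_mul, sum_row_of_mem_doublyStochastic hA i]

lemma mix_avgOp {A : Matrix (Fin K) (Fin K) ℝ} (hA : A ∈ doublyStochastic ℝ (Fin K))
    (w : NetState K M) : mix A (avgOp w) = avgOp w := by
  unfold avgOp
  rw [mix_mix]
  congr 2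
  ext i j
  simp [Matrix.mul_apply, ← Finset.mul_sum, sum_col_of_mem_doublyStochastic hA j]

lemma avgMatrix_mem : (Matrix.of fun _ _ => (K : ℝ)⁻¹ : Matrix (Fin K) (Fin K) ℝ)
    ∈ doublyStochastic ℝ (Fin K) := by
  rw [mem_doublyStochastic_iff_sum]
  refine ⟨fun _ _ => by simp, fun i => ?_, fun i => ?_⟩ <;>
  · have : (K : ℝ) ≠ 0 := by have := i.pos; positivity
    simp [this]

lemma avgOp_avgOp (w : NetState K M) : avgOp (avgOp w) = avgOp w := avgOp_mix avgMatrix_mem w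

lemma inner_avgOp_left (x y : NetState K M) : inner ℝ (avgOp x) y = inner ℝ x (avgOp y) :=
  inner_mix_left (Matrix.ext fun _ _ => rfl) x y

open scoped MatrixOrder Matrix.Norms.L2Operator in
lemma exists_eq_conjTranspose_mul_self {N : Matrix (Fin K) (Fin K) ℝ} (hN : N.PosSemidef) :
    ∃ C : Matrix (Fin K) (Fin K) ℝ, N = C.conjTranspose * C :=
  CStarAlgebra.nonneg_iff_eq_star_mul_self.mp hN.nonneg

/-- A positive semidefinite matrix acting on the agents preserves nonnegativity of a quadratic
form acting on the models. -/
lemma inner_blockDiag_mix_nonneg {N : Matrix (Fin K) (Fin K) ℝ} (hN : N.PosSemidef)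
    {H : Vec M →L[ℝ] Vec M} (hH : ∀ v, 0 ≤ inner ℝ (H v) v) (w : NetState K M) :
    0 ≤ inner ℝ (blockDiag (fun _ => H) (mix N w)) w := by
  obtain ⟨C, rfl⟩ := exists_eq_conjTranspose_mul_self hN
  have hsymm : inner ℝ (blockDiag (fun _ => H) (mix (C.conjTranspose * C) w)) w
      = ∑ j, inner ℝ (H (∑ l, C j l • w l)) (∑ l, C j l • w l) := by
    rw [PiLp.inner_apply]
    simp only [blockDiag_apply, mix_apply, map_sum, map_smul, sum_inner,
      inner_sum, inner_smul_left, inner_smul_right, Matrix.mul_apply, Matrix.conjTranspose_apply,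
      star_trivial, conj_trivial, Finset.sum_mul, Finset.mul_sum]
    conv_rhs => rw [Finset.sum_comm]; enter [2, i]; rw [Finset.sum_comm]
    refine Finset.sum_congr rfl fun i _ => Finset.sum_congr rfl fun j _ =>
      Finset.sum_congr rfl fun l _ => by ring
  rw [hsymm]
  exact Finset.sum_nonneg fun j _ => hH _

/-- The scalar contraction says that 1 - A² is positive semidefinite. As `A` acts on agents and `H`
on models, the two commute, and every nonnegative form `H` inherits the contraction. -/
lemma inner_blockDiag_mix_mix_le {A : Matrix (Fin K) (Fin K) ℝ}
    (hA : A ∈ doublyStochastic ℝ (Fin K)) (hs : A.IsSymm)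
    {H : Vec M →L[ℝ] Vec M} (hH : ∀ v, 0 ≤ inner ℝ (H v) v) (w : NetState K M) :
    inner ℝ (blockDiag (fun _ => H) (mix A w)) (mix A w)
      ≤ inner ℝ (blockDiag (fun _ => H) w) w := by
  have hN : (1 - A * A : Matrix (Fin K) (Fin K) ℝ).PosSemidef := by
    refine Matrix.PosSemidef.of_dotProduct_mulVec_nonneg ?_ fun x => ?_
    · rw [Matrix.IsHermitian, Matrix.conjTranspose_eq_transpose_of_trivial]
      simp [Matrix.transpose_mul, hs.eq]
    · have := sum_sq_mulVec_le hA x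
      have h2 : dotProduct x ((A * A).mulVec x) = ∑ k, A.mulVec x k ^ 2 := by
        rw [← Matrix.mulVec_mulVec, Matrix.dotProduct_mulVec, ← Matrix.mulVec_transpose, hs.eq]
        simp [dotProduct, sq]
      rw [star_trivial, Matrix.sub_mulVec, Matrix.one_mulVec, dotProduct_sub, h2]
      simp only [dotProduct, ← sq]
      linarith
  have h := inner_blockDiag_mix_nonneg hN hH w
  have h2 : mix (1 - A * A) w = w - mix A (mix A w) := by
    rw [mix_mix]
    ext k : 1
    simp [sub_smul, Matrix.one_apply]
  rw [h2, map_sub, inner_sub_left, ← mix_blockDiag_const, inner_mix_left hs] at h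
  linarith

/-- This measures the contraction in the energy of `H` rather than in the Euclidean norm, so the
factor r² does not deteriorate with the condition number of the Hessian. -/
lemma inner_blockDiag_mix_mix_le_of_avgOp_eq_zero {A : Matrix (Fin K) (Fin K) ℝ}
    (hA : A ∈ doublyStochastic ℝ (Fin K)) (hs : A.IsSymm) {r : ℝ}
    (hr : ∀ x : Fin K → ℝ, ∑ k, x k = 0 →
      ∑ k, (A.mulVec x k) ^ 2 ≤ r ^ 2 * ∑ l, x l ^ 2)
    {H : Vec M →L[ℝ] Vec M} (hH : ∀ v, 0 ≤ inner ℝ (H v) v) {w : NetState K M}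
    (hw : avgOp w = 0) :
    inner ℝ (blockDiag (fun _ => H) (mix A w)) (mix A w)
      ≤ r ^ 2 * inner ℝ (blockDiag (fun _ => H) w) w := by
  set E : Matrix (Fin K) (Fin K) ℝ := Matrix.of fun _ _ => (K : ℝ)⁻¹ with hE
  -- The terms in `E` make the matrix vanish on constant vectors, so it is positive semidefinite
  -- everywhere; they drop out when applied to `w`, whose average is zero.
  have hN : (r ^ 2 • (1 - E) - A * A + E : Matrix (Fin K) (Fin K) ℝ).PosSemidef := by
    refine Matrix.PosSemidef.of_dotProduct_mulVec_nonneg ?_ fun x => ?_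
    · rw [Matrix.IsHermitian, Matrix.conjTranspose_eq_transpose_of_trivial]
      have hEt : E.transpose = E := rfl
      simp [Matrix.transpose_mul, hs.eq, hEt]
    · rcases Nat.eq_zero_or_pos K with rfl | hK
      · simp [dotProduct]
      have hK0 : (K : ℝ) ≠ 0 := by positivity
      have hEx : E.mulVec x = fun _ => (K : ℝ)⁻¹ * ∑ k, x k := by
        ext k; simp [Matrix.mulVec, dotProduct, hE, Finset.mul_sum]
      have h2 : dotProduct x ((A * A).mulVec x) = ∑ k, A.mulVec x k ^ 2 := by
        rw [← Matrix.mulVec_mulVec, Matrix.dotProduct_mulVec, ← Matrix.mulVec_transpose, hs.eq]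
        simp [dotProduct, sq]
      set s := ∑ k, x k with hs'
      have hy := hr (fun k => x k - (K : ℝ)⁻¹ * s) (by
        rw [Finset.sum_sub_distrib, ← hs']; simp [hK0])
      have hAy : A.mulVec (fun k => x k - (K : ℝ)⁻¹ * s)
          = fun k => A.mulVec x k - (K : ℝ)⁻¹ * s := by
        ext k
        simp only [Matrix.mulVec, dotProduct, mul_sub, Finset.sum_sub_distrib, ← Finset.sum_mul,
          sum_row_of_mem_doublyStochastic hA k, one_mul]
      have hsA : ∑ k, A.mulVec x k = s := by
        simp only [Matrix.mulVec, dotProduct]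
        rw [Finset.sum_comm]
        simp [← Finset.sum_mul, sum_col_of_mem_doublyStochastic hA, hs']
      have hexp : ∀ y : Fin K → ℝ, ∑ k, y k = s →
          ∑ k, (y k - (K : ℝ)⁻¹ * s) ^ 2 = ∑ k, y k ^ 2 - (K : ℝ)⁻¹ * s ^ 2 := by
        intro y hy
        calc _ = ∑ k, (y k ^ 2 - 2 * ((K : ℝ)⁻¹ * s) * y k + ((K : ℝ)⁻¹ * s) ^ 2) :=
              Finset.sum_congr rfl fun k _ => by ring
          _ = _ := by
              rw [Finset.sum_add_distrib, Finset.sum_sub_distrib, ← Finset.mul_sum, hy]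
              simp
              field_simp
              ring
      rw [hAy, hexp _ hsA, hexp x rfl] at hy
      have hxE : dotProduct x (E.mulVec x) = (K : ℝ)⁻¹ * s ^ 2 := by
        rw [hEx]; simp only [dotProduct, ← Finset.sum_mul, ← hs']; ring
      rw [star_trivial, Matrix.add_mulVec, Matrix.sub_mulVec, Matrix.smul_mulVec,
        Matrix.sub_mulVec, Matrix.one_mulVec, dotProduct_add, dotProduct_sub, h2, dotProduct_smul,
        dotProduct_sub, hxE]
      simp only [dotProduct, ← sq, smul_eq_mul]
      linarith
  have h := inner_blockDiag_mix_nonneg hN hH w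
  have hEw : mix E w = 0 := hw
  have h2 : mix (r ^ 2 • (1 - E) - A * A + E) w = r ^ 2 • w - mix A (mix A w) := by
    have h3 : mix (r ^ 2 • (1 - E) - A * A + E) w
        = r ^ 2 • (w - mix E w) - mix A (mix A w) + mix E w := by
      rw [mix_mix]
      ext k : 1
      simp only [PiLp.add_apply, PiLp.sub_apply, PiLp.smul_apply, mix_apply, Matrix.add_apply,
        Matrix.sub_apply, Matrix.smul_apply, add_smul, sub_smul, Finset.sum_add_distrib,
        Finset.sum_sub_distrib, Matrix.one_apply, smul_sub, Finset.smul_sum, smul_eq_mul,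
        smul_smul]
      simp
    rw [h3, hEw]; simp
  rw [h2, map_sub, inner_sub_left, ← mix_blockDiag_const, inner_mix_left hs, map_smul,
    inner_smul_left] at h
  simp only [conj_trivial] at h
  linarith

lemma blockDiag_id (w : NetState K M) :
    blockDiag (fun _ => ContinuousLinearMap.id ℝ (Vec M)) w = w := by
  ext k : 1; rfl

lemma norm_mix_le {A : Matrix (Fin K) (Fin K) ℝ}
    (hA : A ∈ doublyStochastic ℝ (Fin K)) (hs : A.IsSymm) (w : NetState K M) :
    ‖mix A w‖ ≤ ‖w‖ := by
  have h := inner_blockDiag_mix_mix_le hA hs (H := ContinuousLinearMap.id ℝ (Vec M))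
    (fun v => real_inner_self_nonneg) w
  rw [blockDiag_id, blockDiag_id, real_inner_self_eq_norm_sq, real_inner_self_eq_norm_sq] at h
  exact le_of_sq_le_sq h (norm_nonneg _)

lemma norm_mix_le_of_avgOp_eq_zero {A : Matrix (Fin K) (Fin K) ℝ}
    (hA : A ∈ doublyStochastic ℝ (Fin K)) (hs : A.IsSymm) {r : ℝ} (hr0 : 0 ≤ r)
    (hr : ∀ x : Fin K → ℝ, ∑ k, x k = 0 →
      ∑ k, (A.mulVec x k) ^ 2 ≤ r ^ 2 * ∑ l, x l ^ 2) {w : NetState K M}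
    (hw : avgOp w = 0) : ‖mix A w‖ ≤ r * ‖w‖ := by
  have h := inner_blockDiag_mix_mix_le_of_avgOp_eq_zero hA hs hr
    (H := ContinuousLinearMap.id ℝ (Vec M)) (fun v => real_inner_self_nonneg) hw
  rw [blockDiag_id, blockDiag_id, real_inner_self_eq_norm_sq, real_inner_self_eq_norm_sq,
    ← mul_pow] at h
  exact le_of_sq_le_sq h (by positivity)

lemma norm_avgOp_le (w : NetState K M) : ‖avgOp w‖ ≤ ‖w‖ :=
  norm_mix_le avgMatrix_mem (Matrix.ext fun _ _ => rfl) w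

lemma norm_blockDiag_le {H : Fin K → Vec M →L[ℝ] Vec M} {c : ℝ} (hc : 0 ≤ c)
    (hH : ∀ k, ‖H k‖ ≤ c) (w : NetState K M) : ‖blockDiag H w‖ ≤ c * ‖w‖ := by
  refine le_of_sq_le_sq ?_ (by positivity)
  rw [mul_pow, PiLp.norm_sq_eq_of_L2, PiLp.norm_sq_eq_of_L2, Finset.mul_sum]
  refine Finset.sum_le_sum fun k _ => ?_
  rw [← mul_pow]
  exact pow_le_pow_left₀ (norm_nonneg _)
    ((H k).le_of_opNorm_le (hH k) (w k)) 2

end Operators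

/-! ### The deterministic bias of the network -/

section Bias

variable {K M : ℕ}

/-- Deviation of the agents from their centroid that the gradients `b` at the minimizer cause. -/
noncomputable def biasDev (A D : Matrix (Fin K) (Fin K) ℝ) (μ : ℝ) (b : NetState K M) :
    ℕ → NetState K M
  | 0 => 0
  | n + 1 => mix A (biasDev A D μ b n) - μ • mix D b

/-- Bias of the centroid that the deviation of the agents causes. -/
noncomputable def biasCentroid (A D : Matrix (Fin K) (Fin K) ℝ) (H : Fin K → Vec M →L[ℝ] Vec M)
    (μ : ℝ) (b : NetState K M) : ℕ → NetState K M
  | 0 => 0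
  | n + 1 => biasCentroid A D H μ b n
      - μ • avgOp (blockDiag H (biasCentroid A D H μ b n + biasDev A D μ b n))

variable {A D : Matrix (Fin K) (Fin K) ℝ} {H : Fin K → Vec M →L[ℝ] Vec M} {Hb : Vec M →L[ℝ] Vec M}
  {μ : ℝ} {b : NetState K M}

lemma avgOp_biasDev (hA : A ∈ doublyStochastic ℝ (Fin K)) (hD : D ∈ doublyStochastic ℝ (Fin K))
    (hb : avgOp b = 0) (n : ℕ) : avgOp (biasDev A D μ b n) = 0 := by
  induction n with
  | zero => simp [biasDev]
  | succ n ih => simp [biasDev, avgOp_mix hA, avgOp_mix hD, ih, hb]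

lemma avgOp_biasCentroid (n : ℕ) :
    avgOp (biasCentroid A D H μ b n) = biasCentroid A D H μ b n := by
  induction n with
  | zero => simp [biasCentroid]
  | succ n ih => rw [biasCentroid, map_sub, map_smul, avgOp_avgOp, ih]

/-- In both recursions the operators are powers of `A`, which commute. This one extra application of
`A` is the whole advantage of diffusion. -/
lemma biasDev_self (n : ℕ) : biasDev A A μ b n = mix A (biasDev A 1 μ b n) := by
  induction n with
  | zero => simp [biasDev]
  | succ n ih => simp [biasDev, ih, mix_one]

/-- Deviations have zero mean, so each step contracts by r before adding at most μ‖b‖; the geometric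
series gives a bound uniform in time. -/
lemma norm_biasDev_le (hA : A ∈ doublyStochastic ℝ (Fin K)) (hs : A.IsSymm)
    (hD : D ∈ doublyStochastic ℝ (Fin K)) (hDs : D.IsSymm)
    {r : ℝ} (hr0 : 0 ≤ r) (hr1 : r < 1)
    (hr : ∀ x : Fin K → ℝ, ∑ k, x k = 0 →
      ∑ k, (A.mulVec x k) ^ 2 ≤ r ^ 2 * ∑ l, x l ^ 2) (hb : avgOp b = 0) (hμ : 0 ≤ μ) (n : ℕ) :
    ‖biasDev A D μ b n‖ ≤ μ * ‖b‖ / (1 - r) := by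
  have h1r : 0 < 1 - r := by linarith
  induction n with
  | zero => simp only [biasDev, norm_zero]; positivity
  | succ n ih =>
    calc ‖biasDev A D μ b (n + 1)‖ ≤ ‖mix A (biasDev A D μ b n)‖ + ‖μ • mix D b‖ :=
          norm_sub_le _ _
      _ ≤ r * ‖biasDev A D μ b n‖ + μ * ‖b‖ := by
          rw [norm_smul, Real.norm_of_nonneg hμ]
          gcongr
          · exact norm_mix_le_of_avgOp_eq_zero hA hs hr0 hr (avgOp_biasDev hA hD hb n)
          · exact norm_mix_le hD hDs b
      _ ≤ r * (μ * ‖b‖ / (1 - r)) + μ * ‖b‖ := by gcongr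
      _ = μ * ‖b‖ / (1 - r) := by field_simp; ring

/-- Here d_n = -μ ∑_{j<n} A^j b, so telescoping gives (1 - A) d_n = -μ (b - A^n b). The operator 1 -
A has norm at most 2, and ‖A^n b‖ ≤ r‖b‖ once n ≥ 1; at n = 0 the deviation is zero. -/
lemma le_norm_biasDev_one (hA : A ∈ doublyStochastic ℝ (Fin K)) (hs : A.IsSymm)
    {r : ℝ} (hr0 : 0 ≤ r) (hr1 : r < 1)
    (hr : ∀ x : Fin K → ℝ, ∑ k, x k = 0 →
      ∑ k, (A.mulVec x k) ^ 2 ≤ r ^ 2 * ∑ l, x l ^ 2) (hb : avgOp b = 0) (hμ : 0 ≤ μ) (n : ℕ) :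
    μ * ((1 - r) * ‖b‖) ≤ 2 * ‖biasDev A 1 μ b (n + 1)‖ := by
  -- The witness `y` is A^n b.
  have key : ∀ n, ∃ y : NetState K M, avgOp y = 0 ∧ ‖y‖ ≤ r ^ n * ‖b‖ ∧
      biasDev A 1 μ b n - mix A (biasDev A 1 μ b n) = -(μ • (b - y)) := by
    intro n
    induction n with
    | zero => exact ⟨b, hb, by simp, by simp [biasDev]⟩
    | succ n ih =>
      obtain ⟨y, hy0, hy, hd⟩ := ih
      refine ⟨mix A y, by rw [avgOp_mix hA, hy0], ?_, ?_⟩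
      · calc _ ≤ r * ‖y‖ := norm_mix_le_of_avgOp_eq_zero hA hs hr0 hr hy0
          _ ≤ r * (r ^ n * ‖b‖) := by gcongr
          _ = _ := by ring
      · simp only [biasDev, mix_one, map_sub, map_smul]
        have h2 : mix A (biasDev A 1 μ b n) - mix A (mix A (biasDev A 1 μ b n))
            = -(μ • (mix A b - mix A y)) := by
          rw [← map_sub, hd, map_neg, map_smul, map_sub]
        calc _ = (mix A (biasDev A 1 μ b n) - mix A (mix A (biasDev A 1 μ b n)))
              - μ • b + μ • mix A b := by abel
          _ = _ := by rw [h2, smul_sub, smul_sub]; abel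
  obtain ⟨y, -, hy, hd⟩ := key (n + 1)
  set d := biasDev A 1 μ b (n + 1)
  have h1 : ‖d - mix A d‖ ≤ 2 * ‖d‖ := by
    have := norm_sub_le d (mix A d)
    have := norm_mix_le hA hs d
    linarith
  rw [hd, norm_neg, norm_smul, Real.norm_of_nonneg hμ] at h1
  have h2 : (1 - r) * ‖b‖ ≤ ‖b - y‖ := by
    have h3 := norm_sub_norm_le b y
    have h4 : r ^ (n + 1) ≤ r := pow_le_of_le_one hr0 hr1.le (by omega)
    have h5 : r ^ (n + 1) * ‖b‖ ≤ r * ‖b‖ := by gcongr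
    linarith
  exact (mul_le_mul_of_nonneg_left h2 hμ).trans h1

lemma avgOp_blockDiag_avgOp (hHb : Hb = (K : ℝ)⁻¹ • ∑ k, H k) (w : NetState K M) :
    avgOp (blockDiag H (avgOp w)) = blockDiag (fun _ => Hb) (avgOp w) := by
  ext k : 1
  rw [avgOp_apply, blockDiag_apply, hHb]
  simp only [blockDiag_apply, avgOp_apply]
  simp only [map_smul, map_sum, FunLike.coe_smul, Pi.smul_apply, FunLike.coe_sum, Finset.sum_apply,
    ← Finset.smul_sum]
  rw [Finset.sum_comm]

/-- The common part `Hb` commutes with averaging and annihilates a deviation of zero mean. Only the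
Hessian disagreement transfers deviation into the centroid. -/
lemma norm_avgOp_blockDiag_le {ε : ℝ} (hε : 0 ≤ ε)
    (hH : ∀ k, ‖H k - Hb‖ ≤ ε) {w : NetState K M} (hw : avgOp w = 0) :
    ‖avgOp (blockDiag H w)‖ ≤ ε * ‖w‖ := by
  have h : avgOp (blockDiag H w) = avgOp (blockDiag (fun k => H k - Hb) w) := by
    have h1 : blockDiag (fun k => H k - Hb) w = blockDiag H w - blockDiag (fun _ => Hb) w := by
      ext k : 1; rfl
    have h2 : avgOp (blockDiag (fun _ => Hb) w) = 0 := by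
      unfold avgOp at hw ⊢
      rw [mix_blockDiag_const, hw, map_zero]
    rw [h1, map_sub, h2, sub_zero]
  rw [h]
  exact (norm_avgOp_le _).trans (norm_blockDiag_le hε hH w)

/-- Energy estimate for gradient descent on a quadratic function with a bounded perturbation. -/
lemma inner_gradient_step_le {E : Type*} [NormedAddCommGroup E] [InnerProductSpace ℝ E]
    {T : E →L[ℝ] E} (hsymm : ∀ x y, inner ℝ (T x) y = inner ℝ x (T y)) {σ h μ S : ℝ} (hσ : 0 < σ)
    (hpos : ∀ x, σ * ‖x‖ ^ 2 ≤ inner ℝ (T x) x) (hT : ∀ x, ‖T x‖ ≤ h * ‖x‖)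
    (hμ : 0 ≤ μ) (hμh : μ * h ≤ 1) (hμσ : μ * σ ≤ 1) {m s : E} (hs : ‖s‖ ≤ S)
    (hm : inner ℝ (T m) m ≤ S ^ 2 / σ) :
    inner ℝ (T (m - μ • (T m + s))) (m - μ • (T m + s)) ≤ S ^ 2 / σ := by
  set g := T m + s with hg
  have h1 : inner ℝ (T (m - μ • g)) (m - μ • g)
      = inner ℝ (T m) m - 2 * μ * inner ℝ (T m) g + μ ^ 2 * inner ℝ (T g) g := by
    rw [map_sub, map_smul, inner_sub_left, inner_sub_right, inner_sub_right, inner_smul_left,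
      inner_smul_left, inner_smul_right, inner_smul_right, hsymm g m, real_inner_comm g (T m)]
    simp only [conj_trivial]
    rw [real_inner_comm (T m) g]
    ring
  have h2 : μ ^ 2 * inner ℝ (T g) g ≤ μ * ‖g‖ ^ 2 := by
    have : inner ℝ (T g) g ≤ h * ‖g‖ ^ 2 := by
      calc _ ≤ ‖T g‖ * ‖g‖ := real_inner_le_norm _ _
        _ ≤ (h * ‖g‖) * ‖g‖ := by gcongr; exact hT g
        _ = _ := by ring
    calc _ ≤ μ ^ 2 * (h * ‖g‖ ^ 2) := by gcongr
      _ = μ * (μ * h) * ‖g‖ ^ 2 := by ring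
      _ ≤ μ * 1 * ‖g‖ ^ 2 := by gcongr
      _ = _ := by ring
  -- Polarization with g - T m = s. Together with `h2` the new energy is at most the old one plus μ
  -- (‖s‖² - ‖T m‖²).
  have h3 : ‖g‖ ^ 2 - 2 * inner ℝ (T m) g = ‖s‖ ^ 2 - ‖T m‖ ^ 2 := by
    have := norm_sub_sq_real g (T m)
    have hgs : g - T m = s := by rw [hg]; abel
    rw [hgs, real_inner_comm] at this
    linarith
  -- This turns the decrease into (1 - μσ) times the old energy plus μ S², a map whose fixed point
  -- is S²/σ.
  have h4 : σ * inner ℝ (T m) m ≤ ‖T m‖ ^ 2 := by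
    have hcs := real_inner_le_norm (T m) m
    have hp := hpos m
    rcases eq_or_lt_of_le (norm_nonneg m) with h0 | h0
    · have : m = 0 := norm_eq_zero.1 h0.symm
      simp [this]
    · have h5 : σ * ‖m‖ ≤ ‖T m‖ := by
        have : σ * ‖m‖ * ‖m‖ ≤ ‖T m‖ * ‖m‖ := by nlinarith
        exact le_of_mul_le_mul_right this h0
      calc σ * inner ℝ (T m) m ≤ σ * (‖T m‖ * ‖m‖) := by gcongr
        _ = ‖T m‖ * (σ * ‖m‖) := by ring
        _ ≤ ‖T m‖ * ‖T m‖ := by gcongr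
        _ = _ := by ring
  have h5 : ‖s‖ ^ 2 ≤ S ^ 2 := pow_le_pow_left₀ (norm_nonneg _) hs 2
  have h6 : μ * (‖g‖ ^ 2 - 2 * inner ℝ (T m) g) ≤ μ * (S ^ 2 - σ * inner ℝ (T m) m) := by
    rw [h3]; gcongr
  have h7 : (1 - μ * σ) * inner ℝ (T m) m ≤ (1 - μ * σ) * (S ^ 2 / σ) :=
    mul_le_mul_of_nonneg_left hm (by linarith)
  have h8 : (1 - μ * σ) * (S ^ 2 / σ) = S ^ 2 / σ - μ * S ^ 2 := by field_simp
  rw [h1]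
  nlinarith

/-- The block diagonal operator with equal blocks inherits symmetry. -/
lemma inner_blockDiag_const_comm (hsymm : ∀ x y, inner ℝ (Hb x) y = inner ℝ x (Hb y))
    (x y : NetState K M) :
    inner ℝ (blockDiag (fun _ => Hb) x) y = inner ℝ x (blockDiag (fun _ => Hb) y) := by
  rw [PiLp.inner_apply, PiLp.inner_apply]
  exact Finset.sum_congr rfl fun k _ => hsymm _ _

lemma le_inner_blockDiag_const {σ : ℝ} (hpos : ∀ x, σ * ‖x‖ ^ 2 ≤ inner ℝ (Hb x) x)
    (x : NetState K M) : σ * ‖x‖ ^ 2 ≤ inner ℝ (blockDiag (fun _ => Hb) x) x := by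
  rw [PiLp.inner_apply, PiLp.norm_sq_eq_of_L2, Finset.mul_sum]
  exact Finset.sum_le_sum fun k _ => hpos _

/-- On states where all agents agree, the averaged Hessians act as `Hb`. The centroid therefore
performs gradient descent on the quadratic form of `Hb`, perturbed by the averaged effect of the
deviation, and the sublevel S²/σ is invariant. -/
lemma inner_biasCentroid_le (hHb : Hb = (K : ℝ)⁻¹ • ∑ k, H k)
    (hsymm : ∀ x y, inner ℝ (Hb x) y = inner ℝ x (Hb y)) {σ h S : ℝ} (hσ : 0 < σ)
    (hpos : ∀ x, σ * ‖x‖ ^ 2 ≤ inner ℝ (Hb x) x) (hh : ‖Hb‖ ≤ h)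
    (hμ : 0 ≤ μ) (hμh : μ * h ≤ 1) (hμσ : μ * σ ≤ 1)
    (hS : ∀ n, ‖avgOp (blockDiag H (biasDev A D μ b n))‖ ≤ S) (n : ℕ) :
    inner ℝ (blockDiag (fun _ => Hb) (biasCentroid A D H μ b n)) (biasCentroid A D H μ b n)
      ≤ S ^ 2 / σ := by
  induction n with
  | zero => simp only [biasCentroid, map_zero, inner_zero_left]; positivity
  | succ n ih =>
    have h1 : biasCentroid A D H μ b (n + 1) = biasCentroid A D H μ b n
        - μ • (blockDiag (fun _ => Hb) (biasCentroid A D H μ b n)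
          + avgOp (blockDiag H (biasDev A D μ b n))) := by
      rw [biasCentroid, map_add, map_add]
      congr 3
      conv_lhs => rw [← avgOp_biasCentroid n]
      rw [avgOp_blockDiag_avgOp hHb, avgOp_biasCentroid]
    rw [h1]
    exact inner_gradient_step_le (inner_blockDiag_const_comm hsymm) hσ
      (le_inner_blockDiag_const hpos)
      (norm_blockDiag_le ((norm_nonneg _).trans hh) fun _ => hh) hμ hμh hμσ (hS n) ih

/-- The bias of diffusion is smaller than that of consensus when the Hessians nearly agree. -/
lemma bias_diffusion_le (hA : A ∈ doublyStochastic ℝ (Fin K)) (hs : A.IsSymm)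
    {r : ℝ} (hr0 : 0 ≤ r) (hr1 : r < 1)
    (hr : ∀ x : Fin K → ℝ, ∑ k, x k = 0 →
      ∑ k, (A.mulVec x k) ^ 2 ≤ r ^ 2 * ∑ l, x l ^ 2) (hb : avgOp b = 0)
    (hHb : Hb = (K : ℝ)⁻¹ • ∑ k, H k)
    (hsymm : ∀ x y, inner ℝ (Hb x) y = inner ℝ x (Hb y)) {σ h ε : ℝ} (hσ : 0 < σ)
    (hpos : ∀ x, σ * ‖x‖ ^ 2 ≤ inner ℝ (Hb x) x) (hh : ‖Hb‖ ≤ h)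
    (hε : 0 ≤ ε) (hεb : ε ^ 2 ≤ (1 - r ^ 2) * (1 - r) ^ 4 * σ ^ 2 / 8)
    (hH : ∀ k, ‖H k - Hb‖ ≤ ε)
    (hμ : 0 ≤ μ) (hμh : μ * h ≤ 1) (hμσ : μ * σ ≤ 1) (n : ℕ) :
    inner ℝ (blockDiag (fun _ => Hb) (biasCentroid A A H μ b (n + 1)))
        (biasCentroid A A H μ b (n + 1))
      + inner ℝ (blockDiag (fun _ => Hb) (biasDev A A μ b (n + 1))) (biasDev A A μ b (n + 1))
      + (1 - r ^ 2) * (1 - r) ^ 2 * σ / 8 * (μ ^ 2 * ‖b‖ ^ 2)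
    ≤ inner ℝ (blockDiag (fun _ => Hb) (biasCentroid A 1 H μ b (n + 1)))
        (biasCentroid A 1 H μ b (n + 1))
      + inner ℝ (blockDiag (fun _ => Hb) (biasDev A 1 μ b (n + 1))) (biasDev A 1 μ b (n + 1)) := by
  have h1r : 0 < 1 - r := by linarith
  have h1r2 : 0 ≤ 1 - r ^ 2 := by nlinarith
  have hpos' : ∀ v, 0 ≤ inner ℝ (Hb v) v := fun v => le_trans (by positivity) (hpos v)
  have h1 : inner ℝ (blockDiag (fun _ => Hb) (biasCentroid A A H μ b (n + 1)))
        (biasCentroid A A H μ b (n + 1)) ≤ (ε * (μ * ‖b‖ / (1 - r))) ^ 2 / σ := by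
    refine inner_biasCentroid_le hHb hsymm hσ hpos hh hμ hμh hμσ (fun j => ?_) _
    refine (norm_avgOp_blockDiag_le hε hH (avgOp_biasDev hA hA hb j)).trans ?_
    gcongr
    exact norm_biasDev_le hA hs hA hs hr0 hr1 hr hb hμ j
  -- The bound on ε² is chosen so that the centroid energy of diffusion costs at most 1/8 of (1 -
  -- r²)(1 - r)²σ μ²‖b‖².
  have h2 : (ε * (μ * ‖b‖ / (1 - r))) ^ 2 / σ
      ≤ (1 - r ^ 2) * (1 - r) ^ 2 * σ / 8 * (μ ^ 2 * ‖b‖ ^ 2) := by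
    rw [div_le_iff₀ hσ, mul_pow, div_pow, mul_pow]
    calc ε ^ 2 * (μ ^ 2 * ‖b‖ ^ 2 / (1 - r) ^ 2)
        ≤ ((1 - r ^ 2) * (1 - r) ^ 4 * σ ^ 2 / 8) * (μ ^ 2 * ‖b‖ ^ 2 / (1 - r) ^ 2) := by gcongr
      _ = _ := by field_simp
  have h3 : inner ℝ (blockDiag (fun _ => Hb) (biasDev A A μ b (n + 1))) (biasDev A A μ b (n + 1))
      ≤ r ^ 2 * inner ℝ (blockDiag (fun _ => Hb) (biasDev A 1 μ b (n + 1)))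
        (biasDev A 1 μ b (n + 1)) := by
    rw [biasDev_self]
    exact inner_blockDiag_mix_mix_le_of_avgOp_eq_zero hA hs hr hpos'
      (avgOp_biasDev hA (one_mem _) hb _)
  have h4 := le_inner_blockDiag_const hpos (biasDev A 1 μ b (n + 1))
  have h5 := le_norm_biasDev_one hA hs hr0 hr1 hr hb hμ n
  have h6 : μ ^ 2 * ((1 - r) ^ 2 * ‖b‖ ^ 2) ≤ 4 * ‖biasDev A 1 μ b (n + 1)‖ ^ 2 := by
    have := pow_le_pow_left₀ (by positivity) h5 2
    calc _ = (μ * ((1 - r) * ‖b‖)) ^ 2 := by ring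
      _ ≤ _ := this
      _ = _ := by ring
  have h7 : 0 ≤ inner ℝ (blockDiag (fun _ => Hb) (biasCentroid A 1 H μ b (n + 1)))
        (biasCentroid A 1 H μ b (n + 1)) :=
    le_trans (by positivity) (le_inner_blockDiag_const hpos _)
  have h8 : (1 - r ^ 2) * (σ * (μ ^ 2 * ((1 - r) ^ 2 * ‖b‖ ^ 2)))
      ≤ (1 - r ^ 2) * (4 * inner ℝ (blockDiag (fun _ => Hb) (biasDev A 1 μ b (n + 1)))
        (biasDev A 1 μ b (n + 1))) := by
    refine mul_le_mul_of_nonneg_left ?_ h1r2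
    calc _ ≤ σ * (4 * ‖biasDev A 1 μ b (n + 1)‖ ^ 2) := by gcongr
      _ ≤ _ := by linarith
  -- The contraction gains at least 1/4 of this quantity by `h8`; 1/8 pays for the diffusion
  -- centroid and 1/8 remains as surplus. The centroid energy of consensus is dropped, being
  -- nonnegative.
  nlinarith

end Bias

/-! ### Square integrable random vectors -/

section SquareIntegrable

variable {Ω : Type*} [MeasurableSpace Ω]

/-- Square integrable functions, as a semi-inner product space of honest functions. -/
def SqInt (P : Measure Ω) (F : Type*) [NormedAddCommGroup F] [NormedSpace ℝ F] :
    Submodule ℝ (Ω → F) where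
  carrier := {f | MemLp f 2 P}
  add_mem' hf hg := hf.add hg
  zero_mem' := MemLp.zero
  smul_mem' c _ hf := hf.const_smul c

variable {P : Measure Ω} {F : Type*} [NormedAddCommGroup F] [InnerProductSpace ℝ F]

lemma integrable_inner_of_memLp {f g : Ω → F} (hf : MemLp f 2 P) (hg : MemLp g 2 P) :
    Integrable (fun ω => inner ℝ (f ω) (g ω)) P := by
  refine Integrable.mono' ((hf.integrable_norm_pow (by norm_num)).add
    (hg.integrable_norm_pow (by norm_num))) (hf.1.inner hg.1) (ae_of_all _ fun ω => ?_)
  have h1 := norm_inner_le_norm (𝕜 := ℝ) (f ω) (g ω)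
  simp only [Pi.add_apply]
  have h2 := two_mul_le_add_sq ‖f ω‖ ‖g ω‖
  have h3 := mul_nonneg (norm_nonneg (f ω)) (norm_nonneg (g ω))
  linarith

namespace SqInt

lemma memLp (f : SqInt P F) : MemLp (f : Ω → F) 2 P := f.2

lemma integrable_inner (f g : SqInt P F) : Integrable (fun ω => inner ℝ (f.1 ω) (g.1 ω)) P :=
  integrable_inner_of_memLp (memLp f) (memLp g)

/-- Only a semi-inner product: functions that vanish almost everywhere have norm zero. Working
without the quotient keeps pointwise bounds and measurability with respect to smaller σ-algebras
meaningful. -/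
noncomputable instance core : PreInnerProductSpace.Core ℝ (SqInt P F) where
  inner f g := ∫ ω, inner ℝ (f.1 ω) (g.1 ω) ∂P
  conj_inner_symm f g := by
    simp only [conj_trivial]
    exact integral_congr_ae (ae_of_all _ fun ω => real_inner_comm _ _)
  re_inner_nonneg f := integral_nonneg fun ω => real_inner_self_nonneg
  add_left f g h := by
    rw [← integral_add (integrable_inner f h) (integrable_inner g h)]
    exact integral_congr_ae (ae_of_all _ fun ω => inner_add_left _ _ _)
  smul_left f g c := by
    rw [conj_trivial, ← integral_const_mul]
    exact integral_congr_ae (ae_of_all _ fun ω => real_inner_smul_left _ _ _)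

noncomputable instance : SeminormedAddCommGroup (SqInt P F) :=
  InnerProductSpace.Core.toSeminormedAddCommGroup (𝕜 := ℝ)

noncomputable instance : InnerProductSpace ℝ (SqInt P F) := InnerProductSpace.ofCore core

lemma inner_def (f g : SqInt P F) : inner ℝ f g = ∫ ω, inner ℝ (f.1 ω) (g.1 ω) ∂P := rfl

lemma norm_sq (f : SqInt P F) : ‖f‖ ^ 2 = ∫ ω, ‖f.1 ω‖ ^ 2 ∂P := by
  rw [← real_inner_self_eq_norm_sq, inner_def]
  exact integral_congr_ae (ae_of_all _ fun ω => real_inner_self_eq_norm_sq _)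

lemma integrable_norm_sq (f : SqInt P F) : Integrable (fun ω => ‖f.1 ω‖ ^ 2) P :=
  (memLp f).integrable_norm_pow (by norm_num)

@[simp] lemma add_apply (f g : SqInt P F) (ω : Ω) : (f + g).1 ω = f.1 ω + g.1 ω := rfl
@[simp] lemma sub_apply (f g : SqInt P F) (ω : Ω) : (f - g).1 ω = f.1 ω - g.1 ω := rfl
@[simp] lemma smul_apply (c : ℝ) (f : SqInt P F) (ω : Ω) : (c • f).1 ω = c • f.1 ω := rfl
@[simp] lemma zero_apply (ω : Ω) : (0 : SqInt P F).1 ω = 0 := rfl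

@[ext] lemma ext {f g : SqInt P F} (h : ∀ ω, f.1 ω = g.1 ω) : f = g :=
  Subtype.ext (funext h)

lemma norm_le_mul_norm {F' : Type*} [NormedAddCommGroup F'] [InnerProductSpace ℝ F']
    {f : SqInt P F} {g : SqInt P F'} {c : ℝ} (hc : 0 ≤ c)
    (h : ∀ ω, ‖f.1 ω‖ ≤ c * ‖g.1 ω‖) : ‖f‖ ≤ c * ‖g‖ := by
  refine le_of_sq_le_sq ?_ (by positivity)
  rw [mul_pow, norm_sq, norm_sq, ← integral_const_mul]
  refine integral_mono (integrable_norm_sq f) ((integrable_norm_sq g).const_mul _) fun ω => ?_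
  rw [← mul_pow]
  exact pow_le_pow_left₀ (norm_nonneg _) (h ω) 2

/-- A continuous linear map acts on square integrable functions. -/
noncomputable def map (T : F →L[ℝ] F) : SqInt P F →ₗ[ℝ] SqInt P F where
  toFun f := ⟨fun ω => T (f.1 ω), (memLp f).continuousLinearMap_comp T⟩
  map_add' f g := by ext ω; exact map_add T _ _
  map_smul' c f := by ext ω; exact map_smul T c _

@[simp] lemma map_apply (T : F →L[ℝ] F) (f : SqInt P F) (ω : Ω) : (map T f).1 ω = T (f.1 ω) := rfl

lemma norm_map_le {T : F →L[ℝ] F} {c : ℝ} (hc : 0 ≤ c) (hT : ∀ x, ‖T x‖ ≤ c * ‖x‖)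
    (f : SqInt P F) : ‖map T f‖ ≤ c * ‖f‖ := norm_le_mul_norm hc fun _ => hT _

lemma inner_map_left {T T' : F →L[ℝ] F} (h : ∀ x y, inner ℝ (T x) y = inner ℝ x (T' y))
    (f g : SqInt P F) : inner ℝ (map T f) g = inner ℝ f (map T' g) :=
  integral_congr_ae (ae_of_all _ fun _ => h _ _)

variable [IsProbabilityMeasure P]

/-- Constant functions. -/
noncomputable def const (P : Measure Ω) [IsProbabilityMeasure P] :
    F →ₗ[ℝ] SqInt P F where
  toFun c := ⟨fun _ => c, memLp_const c⟩
  map_add' _ _ := rfl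
  map_smul' _ _ := rfl

@[simp] lemma const_apply (c : F) (ω : Ω) : (const P c).1 ω = c := rfl

lemma inner_const (c c' : F) : inner ℝ (const P c) (const P c') = inner ℝ c c' := by
  rw [inner_def]; simp

lemma norm_const (c : F) : ‖const P c‖ = ‖c‖ := by
  have h : ‖const P c‖ ^ 2 = ‖c‖ ^ 2 := by rw [norm_sq]; simp
  exact (sq_eq_sq₀ (norm_nonneg _) (norm_nonneg _)).1 h

lemma map_const (T : F →L[ℝ] F) (c : F) : map T (const P c) = const P (T c) := rfl

end SqInt

end SquareIntegrable

/-- A discrete Gronwall inequality. -/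
lemma le_exp_mul_of_step_le {x : ℕ → ℝ} {a β μ : ℝ} {N : ℕ} (hβ : 0 ≤ β) (hμ : 0 ≤ μ)
    (ha : 0 ≤ a) (hx0 : 0 ≤ x 0) (h : ∀ n < N, x (n + 1) ≤ (1 + μ * a) * x n + μ * β) :
    ∀ n ≤ N, x n ≤ Real.exp (a * (n * μ)) * (x 0 + n * μ * β) := by
  intro n hn
  induction n with
  | zero => simp
  | succ n ih =>
    have ih := ih (by omega)
    have h1 : 1 + μ * a ≤ Real.exp (a * μ) := by
      have := Real.add_one_le_exp (a * μ); linarith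
    have h2 : Real.exp (a * ((n + 1 : ℕ) * μ)) = Real.exp (a * μ) * Real.exp (a * (n * μ)) := by
      rw [← Real.exp_add]; congr 1; push_cast; ring
    have h3 : (1 : ℝ) ≤ Real.exp (a * ((n + 1 : ℕ) * μ)) := Real.one_le_exp (by positivity)
    have h4 : μ * β ≤ Real.exp (a * ((n + 1 : ℕ) * μ)) * (μ * β) :=
      le_mul_of_one_le_left (by positivity) h3
    calc x (n + 1) ≤ (1 + μ * a) * x n + μ * β := h n (by omega)
      _ ≤ (1 + μ * a) * (Real.exp (a * (n * μ)) * (x 0 + n * μ * β)) + μ * β := by gcongr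
      _ ≤ Real.exp (a * μ) * (Real.exp (a * (n * μ)) * (x 0 + n * μ * β))
          + Real.exp (a * ((n + 1 : ℕ) * μ)) * (μ * β) := by gcongr
      _ = _ := by rw [h2]; push_cast; ring

/-! ### Second order expansions of the risks -/

section Calculus

variable {E : Type*} [NormedAddCommGroup E] [InnerProductSpace ℝ E] [CompleteSpace E]
  {f : E → ℝ}

lemma contDiff_gradient (hf : ContDiff ℝ 2 f) : ContDiff ℝ 1 (gradient f) := by
  have h : gradient f = fun w => (InnerProductSpace.toDual ℝ E).symm (fderiv ℝ f w) := rfl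
  rw [h]
  exact (LinearIsometryEquiv.contDiff _).comp (hf.fderiv_right (by norm_num))

lemma hasFDerivAt_gradient (hf : ContDiff ℝ 2 f) (w : E) :
    HasFDerivAt (gradient f) (fderiv ℝ (gradient f) w) w :=
  ((contDiff_gradient hf).differentiable (by norm_num) w).hasFDerivAt

/-- Pairing the derivative of the gradient with a fixed vector gives the second Fréchet derivative,
which is symmetric for C² functions. -/
lemma inner_fderiv_gradient_comm (hf : ContDiff ℝ 2 f) (w x y : E) :
    inner ℝ (fderiv ℝ (gradient f) w x) y = inner ℝ x (fderiv ℝ (gradient f) w y) := by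
  have h1 : ∀ x y, inner ℝ (fderiv ℝ (gradient f) w x) y = fderiv ℝ (fderiv ℝ f) w x y := by
    intro x y
    have h2 : HasFDerivAt (fun v => inner ℝ (gradient f v) y)
        ((innerSL ℝ y).comp (fderiv ℝ (gradient f) w)) w := by
      have := ((innerSL ℝ y).hasFDerivAt (x := gradient f w)).comp w (hasFDerivAt_gradient hf w)
      refine this.congr_of_eventuallyEq (Eventually.of_forall fun v => ?_)
      simp
    have h3 : HasFDerivAt (fun v => inner ℝ (gradient f v) y)
        ((ContinuousLinearMap.apply ℝ ℝ y).comp (fderiv ℝ (fderiv ℝ f) w)) w := by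
      have hd : DifferentiableAt ℝ (fderiv ℝ f) w :=
        (hf.fderiv_right (m := 1) (by norm_num)).differentiable (by norm_num) w
      have := ((ContinuousLinearMap.apply ℝ ℝ y).hasFDerivAt (x := fderiv ℝ f w)).comp w
        hd.hasFDerivAt
      refine this.congr_of_eventuallyEq (Eventually.of_forall fun v => ?_)
      simp [inner_gradient_left]
    have h4 := congrArg (fun T => T x) (h2.unique h3)
    simpa [real_inner_comm] using h4
  have hsymm : IsSymmSndFDerivAt ℝ f w := hf.contDiffAt.isSymmSndFDerivAt (by simp)
  rw [h1, real_inner_comm, h1]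
  exact hsymm x y

lemma exists_radius_gradient_remainder_le (hf : ContDiff ℝ 2 f) (w : E) {δ : ℝ} (hδ : 0 < δ) :
    ∃ r : ℝ, 0 < r ∧ ∀ v : E, ‖v‖ ≤ r →
      ‖gradient f (w + v) - gradient f w - fderiv ℝ (gradient f) w v‖ ≤ δ * ‖v‖ := by
  have h := (hasFDerivAt_iff_isLittleO_nhds_zero.1 (hasFDerivAt_gradient hf w)).def hδ
  obtain ⟨r, hr, h⟩ := Metric.eventually_nhds_iff.1 h
  refine ⟨r / 2, by positivity, fun v hv => h ?_⟩
  rw [dist_zero_right]; linarith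

lemma norm_fderiv_gradient_le {L : ℝ≥0} (hL : LipschitzWith L (gradient f)) (w : E) :
    ‖fderiv ℝ (gradient f) w‖ ≤ L := norm_fderiv_le_of_lipschitz ℝ hL

/-- The crude global bound, for use where the state leaves the ball in which the linearization is
accurate. -/
lemma norm_gradient_remainder_le {L : ℝ≥0} (hL : LipschitzWith L (gradient f)) (w v : E) :
    ‖gradient f (w + v) - gradient f w - fderiv ℝ (gradient f) w v‖ ≤ 2 * L * ‖v‖ := by
  have h1 : ‖gradient f (w + v) - gradient f w‖ ≤ L * ‖v‖ := by
    simpa using hL.norm_sub_le (w + v) w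
  have h2 : ‖fderiv ℝ (gradient f) w v‖ ≤ L * ‖v‖ :=
    ContinuousLinearMap.le_of_opNorm_le _ (norm_fderiv_gradient_le hL w) v
  calc _ ≤ _ := norm_sub_le _ _
    _ ≤ _ := by linarith

/-- Second order expansion at a critical point from a bound on the first order remainder of the
gradient. -/
lemma abs_sub_quadratic_le (hf : ContDiff ℝ 2 f) {w : E} (T : E →L[ℝ] E) {c : ℝ} {v : E}
    (h : ∀ u : E, ‖u‖ ≤ ‖v‖ → ‖gradient f (w + u) - T u‖ ≤ c * ‖u‖) :
    |f (w + v) - f w - inner ℝ (T v) v / 2| ≤ c * ‖v‖ ^ 2 := by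
  have hc : 0 ≤ c * ‖v‖ := (norm_nonneg _).trans (h v le_rfl)
  -- The mean value inequality is applied to the risk minus its quadratic model along the segment
  -- from `w` to `w + v`.
  set φ : ℝ → ℝ := fun t => f (w + t • v) - t ^ 2 * (inner ℝ (T v) v / 2) with hφ
  have hd : ∀ t, HasDerivAt φ (inner ℝ (gradient f (w + t • v) - T (t • v)) v) t := by
    intro t
    have h1 : HasDerivAt (fun t : ℝ => w + t • v) v t := by
      simpa using ((hasDerivAt_id t).smul_const v).const_add w
    have h2 : HasFDerivAt f (fderiv ℝ f (w + t • v)) (w + t • v) :=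
      (hf.differentiable (by norm_num) _).hasFDerivAt
    have h3 := h2.comp_hasDerivAt t h1
    have h4 := h3.sub (((hasDerivAt_id t).pow 2).mul_const (inner ℝ (T v) v / 2))
    refine h4.congr_deriv ?_
    rw [inner_sub_left, inner_gradient_left, map_smul, real_inner_smul_left]
    simp
    ring
  have hb : ∀ t ∈ Set.Ico (0 : ℝ) 1,
      ‖inner ℝ (gradient f (w + t • v) - T (t • v)) v‖ ≤ c * ‖v‖ ^ 2 := by
    intro t ht
    have hn : ‖t • v‖ ≤ ‖v‖ := by
      rw [norm_smul, Real.norm_of_nonneg ht.1]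
      exact mul_le_of_le_one_left (norm_nonneg _) ht.2.le
    calc _ ≤ ‖gradient f (w + t • v) - T (t • v)‖ * ‖v‖ := norm_inner_le_norm _ _
      _ ≤ (c * ‖t • v‖) * ‖v‖ := by gcongr; exact h _ hn
      _ = t * ((c * ‖v‖) * ‖v‖) := by rw [norm_smul, Real.norm_of_nonneg ht.1]; ring
      _ ≤ 1 * ((c * ‖v‖) * ‖v‖) := by
          have := ht.2.le
          gcongr
      _ = _ := by ring
  have := norm_image_sub_le_of_norm_deriv_le_segment_01' (f := φ)
    (fun t _ => (hd t).hasDerivWithinAt) hb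
  rw [Real.norm_eq_abs] at this
  convert this using 2
  simp [hφ]
  ring

end Calculus

namespace Problem

variable {K M : ℕ} {X : Type u} {p : Problem K M X} {L : ℝ≥0}

lemma IsSmooth.contDiff_Jk (hp : p.IsSmooth L) (k : Fin K) : ContDiff ℝ 2 (p.Jk k) :=
  contDiff_const.mul (ContDiff.sum fun i _ => hp.contDiff k i)

lemma IsSmooth.contDiff_J (hp : p.IsSmooth L) : ContDiff ℝ 2 p.J :=
  contDiff_const.mul (ContDiff.sum fun k _ => hp.contDiff_Jk k)

lemma IsSmooth.hasGradientAt_Q (hp : p.IsSmooth L) (k : Fin K) (i : Fin (p.N k)) (w : Vec M) :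
    HasFDerivAt (fun v => p.Q k v (p.x k i)) (innerSL ℝ (p.gradQ k i w)) w := by
  have h := ((hp.contDiff k i).differentiable (by norm_num) w).hasGradientAt.hasFDerivAt
  exact h

lemma IsSmooth.gradient_Jk (hp : p.IsSmooth L) (k : Fin K) (w : Vec M) :
    gradient (p.Jk k) w = (p.N k : ℝ)⁻¹ • ∑ i, p.gradQ k i w := by
  refine HasGradientAt.gradient ?_
  rw [hasGradientAt_iff_hasFDerivAt]
  have h := (HasFDerivAt.fun_sum fun i (_ : i ∈ Finset.univ) =>
    hp.hasGradientAt_Q k i w).const_mul (p.N k : ℝ)⁻¹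
  refine h.congr_fderiv ?_
  ext v
  simp

lemma IsSmooth.gradient_J (hp : p.IsSmooth L) (w : Vec M) :
    gradient p.J w = (K : ℝ)⁻¹ • ∑ k, gradient (p.Jk k) w := by
  refine HasGradientAt.gradient ?_
  rw [hasGradientAt_iff_hasFDerivAt]
  have h := (HasFDerivAt.fun_sum fun k (_ : k ∈ Finset.univ) =>
    ((hp.contDiff_Jk k).differentiable (by norm_num) w).hasGradientAt.hasFDerivAt).const_mul
      (K : ℝ)⁻¹
  refine h.congr_fderiv ?_
  ext v
  simp

lemma lipschitzWith_inv_smul_sum {E F : Type*} [NormedAddCommGroup E] [NormedAddCommGroup F]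
    [NormedSpace ℝ F] {n : ℕ} {f : Fin n → E → F} (hf : ∀ i, LipschitzWith L (f i)) :
    LipschitzWith L fun w => (n : ℝ)⁻¹ • ∑ i, f i w := by
  refine LipschitzWith.of_dist_le_mul fun x y => ?_
  rw [dist_eq_norm, dist_eq_norm, ← smul_sub, ← Finset.sum_sub_distrib, norm_smul, norm_inv,
    RCLike.norm_natCast]
  rcases Nat.eq_zero_or_pos n with rfl | hn
  · simp; positivity
  · rw [inv_mul_le_iff₀ (by positivity)]
    calc _ ≤ ∑ i, ‖f i x - f i y‖ := norm_sum_le _ _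
      _ ≤ ∑ _i : Fin n, L * ‖x - y‖ := Finset.sum_le_sum fun i _ => (hf i).norm_sub_le x y
      _ = _ := by simp

lemma IsSmooth.lipschitz_Jk (hp : p.IsSmooth L) (k : Fin K) :
    LipschitzWith L (gradient (p.Jk k)) := by
  rw [funext (hp.gradient_Jk k)]
  exact lipschitzWith_inv_smul_sum (hp.lipschitz k)

lemma IsSmooth.lipschitz_J (hp : p.IsSmooth L) : LipschitzWith L (gradient p.J) := by
  rw [funext hp.gradient_J]
  exact lipschitzWith_inv_smul_sum hp.lipschitz_Jk

lemma IsSmooth.fderiv_gradient_J (hp : p.IsSmooth L) (w : Vec M) :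
    fderiv ℝ (gradient p.J) w = p.avgHess w := by
  rw [funext hp.gradient_J]
  exact ((HasFDerivAt.fun_sum fun k (_ : k ∈ Finset.univ) =>
    hasFDerivAt_gradient (hp.contDiff_Jk k) w).const_smul (K : ℝ)⁻¹).fderiv

end Problem

/-! ### Independence of the draws and noise averages -/

section Draws

variable {Ω : Type*}

variable {K : ℕ} {N : Fin K → ℕ} {β : Type*} [MeasurableSpace β]

/-- The information carried by the starting point and all draws but the one with index `t`. -/
abbrev exceptDraw (w₀ : Ω → β) (I : ∀ k : Fin K, ℕ → ℕ → Ω → Fin (N k)) (t : Σ _ : Fin K, ℕ × ℕ) :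
    MeasurableSpace Ω :=
  MeasurableSpace.comap w₀ inferInstance ⊔
    ⨆ s ∈ {s : Σ _ : Fin K, ℕ × ℕ | s ≠ t}, MeasurableSpace.comap (I s.1 s.2.1 s.2.2) inferInstance

/-- `f` is determined by the starting point and the draws before instant `n`. -/
def IsPast (w₀ : Ω → β) (I : ∀ k : Fin K, ℕ → ℕ → Ω → Fin (N k)) (n : ℕ)
    {F : Type*} [MeasurableSpace F] (f : Ω → F) : Prop :=
  ∀ t : Σ _ : Fin K, ℕ × ℕ, n ≤ t.2.1 → Measurable[exceptDraw w₀ I t] f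

variable {w₀ : Ω → β} {I : ∀ k : Fin K, ℕ → ℕ → Ω → Fin (N k)}

lemma measurable_draw_exceptDraw {s t : Σ _ : Fin K, ℕ × ℕ} (h : s ≠ t) :
    Measurable[exceptDraw w₀ I t] (I s.1 s.2.1 s.2.2) := by
  rw [measurable_iff_comap_le]
  exact le_sup_of_le_right (le_iSup₂_of_le s h le_rfl)

lemma measurable_start_exceptDraw (t : Σ _ : Fin K, ℕ × ℕ) :
    Measurable[exceptDraw w₀ I t] w₀ := by
  rw [measurable_iff_comap_le]
  exact le_sup_left

lemma IsPast.mono {n n' : ℕ} {F : Type*} [MeasurableSpace F] {f : Ω → F} (hf : IsPast w₀ I n f)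
    (h : n ≤ n') : IsPast w₀ I n' f := fun t ht => hf t (h.trans ht)

lemma IsPast.comp {n : ℕ} {F G : Type*} [MeasurableSpace F] [MeasurableSpace G] {f : Ω → F}
    (hf : IsPast w₀ I n f) {φ : F → G} (hφ : Measurable φ) : IsPast w₀ I n fun ω => φ (f ω) :=
  fun t ht => hφ.comp (hf t ht)

lemma measurable_comp_finite {n : ℕ} {F : Type*} [MeasurableSpace F] {m : MeasurableSpace Ω}
    {J : Ω → Fin n} (hJ : Measurable[m] J) {g : Fin n → Ω → F} (hg : ∀ i, Measurable[m] (g i)) :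
    Measurable[m] fun ω => g (J ω) ω := by
  have h : Measurable fun q : Fin n × Ω => g q.1 q.2 := measurable_from_prod_countable_right hg
  exact h.comp (hJ.prodMk measurable_id)

variable [mΩ : MeasurableSpace Ω] {P : Measure Ω} [IsProbabilityMeasure P]

/-- A family of independent σ-algebras stays independent when one that is independent of all of
them is adjoined. -/
lemma iIndep_option {ι : Type*} {m₀ : MeasurableSpace Ω} {m : ι → MeasurableSpace Ω}
    (hind : iIndep m P) (h0 : Indep m₀ (⨆ i, m i) P) :
    iIndep (fun o : Option ι => o.elim m₀ m) P := by
  classical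
  rw [iIndep_iff]
  intro s f hf
  have key : ∀ F : Finset ι, (∀ i ∈ F, MeasurableSet[m i] (f (some i))) →
      MeasurableSet[⨆ i, m i] (⋂ i ∈ F, f (some i)) := fun F hF =>
    MeasurableSet.biInter F.countable_toSet fun i hi => le_iSup m i _ (hF i hi)
  have hsome : ∀ i ∈ s.eraseNone, MeasurableSet[m i] (f (some i)) := fun i hi =>
    hf (some i) (Finset.mem_eraseNone.1 hi)
  have hprod := (iIndep_iff _ _).1 hind s.eraseNone (f := fun i => f (some i)) hsome
  by_cases hn : none ∈ s
  · have hs : s = insert none (s.eraseNone.map Function.Embedding.some) := by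
      rw [Finset.map_some_eraseNone, Finset.insert_erase hn]
    have h1 : (⋂ o ∈ s, f o) = f none ∩ ⋂ i ∈ s.eraseNone, f (some i) := by
      conv_lhs => rw [hs]
      rw [Finset.set_biInter_insert]
      congr 1
      ext ω
      simp [Option.forall]
    have h2 : ∏ o ∈ s, P (f o) = P (f none) * ∏ i ∈ s.eraseNone, P (f (some i)) := by
      conv_lhs => rw [hs]
      rw [Finset.prod_insert (by simp), Finset.prod_map]
      rfl
    rw [h1, h2, ← hprod]
    exact (Indep_iff _ _ _).1 h0 _ _ (hf none hn) (key _ hsome)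
  · have hs : s = s.eraseNone.map Function.Embedding.some := by
      rw [Finset.map_some_eraseNone, Finset.erase_eq_of_notMem hn]
    have h1 : (⋂ o ∈ s, f o) = ⋂ i ∈ s.eraseNone, f (some i) := by
      conv_lhs => rw [hs]
      ext ω
      simp [Option.forall]
    have h2 : ∏ o ∈ s, P (f o) = ∏ i ∈ s.eraseNone, P (f (some i)) := by
      conv_lhs => rw [hs]
      rw [Finset.prod_map]
      rfl
    rw [h1, h2, ← hprod]

/-- The joint properties of the starting point and the draws that the analysis uses. -/
structure IsSampling (P : Measure Ω) (w₀ : Ω → β)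
    (I : ∀ k : Fin K, ℕ → ℕ → Ω → Fin (N k)) : Prop where
  measurable_start : Measurable w₀
  measurable : ∀ k n b, Measurable (I k n b)
  uniform : ∀ k n b i, P.real {ω | I k n b ω = i} = (N k : ℝ)⁻¹
  indep : iIndepFun (fun (t : Σ _ : Fin K, ℕ × ℕ) => I t.1 t.2.1 t.2.2) P
  indep_start : IndepFun w₀ (fun ω k n b => I k n b ω) P

namespace IsSampling

lemma exceptDraw_le (hS : IsSampling P w₀ I) (t : Σ _ : Fin K, ℕ × ℕ) :
    exceptDraw w₀ I t ≤ mΩ := by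
  refine sup_le hS.measurable_start.comap_le (iSup₂_le fun s _ => ?_)
  exact (hS.measurable s.1 s.2.1 s.2.2).comap_le

lemma _root_.IsPast.measurable (hS : IsSampling P w₀ I) {n : ℕ} {F : Type*} [MeasurableSpace F]
    {f : Ω → F} (hf : IsPast w₀ I n f) (k : Fin K) : Measurable f :=
  (hf ⟨k, n, 0⟩ le_rfl).mono (hS.exceptDraw_le _) le_rfl

/-- The starting point joins the draws as the index `none` of one independent family; the single
draw `t` is then disjoint from all other indices. -/
lemma indep_exceptDraw (hS : IsSampling P w₀ I) (t : Σ _ : Fin K, ℕ × ℕ) :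
    Indep (exceptDraw w₀ I t) (MeasurableSpace.comap (I t.1 t.2.1 t.2.2) inferInstance) P := by
  set m : (Σ _ : Fin K, ℕ × ℕ) → MeasurableSpace Ω :=
    fun s => MeasurableSpace.comap (I s.1 s.2.1 s.2.2) inferInstance with hm
  have hsup : (⨆ i, m i) ≤ MeasurableSpace.comap (fun ω k n b => I k n b ω) inferInstance := by
    refine iSup_le fun s => ?_
    have h1 : Measurable fun J : (∀ k : Fin K, ℕ → ℕ → Fin (N k)) => J s.1 s.2.1 s.2.2 := by
      fun_prop
    have h2 : I s.1 s.2.1 s.2.2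
        = (fun J : (∀ k : Fin K, ℕ → ℕ → Fin (N k)) => J s.1 s.2.1 s.2.2)
          ∘ (fun ω k n b => I k n b ω) := rfl
    simp only [hm]
    rw [h2, ← MeasurableSpace.comap_comp]
    exact MeasurableSpace.comap_mono h1.comap_le
  have h0 : Indep (MeasurableSpace.comap w₀ inferInstance) (⨆ i, m i) P :=
    indep_of_indep_of_le_right ((IndepFun_iff_Indep _ _ _).1 hS.indep_start) hsup
  have hind : iIndep m P := (iIndepFun_iff_iIndep _ _ _).1 hS.indep
  have h := indep_iSup_of_disjoint (S := {some t}ᶜ) (T := {some t}) (by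
    rintro (_ | s)
    · exact hS.measurable_start.comap_le
    · exact (hS.measurable s.1 s.2.1 s.2.2).comap_le) (iIndep_option hind h0)
    disjoint_compl_left
  refine indep_of_indep_of_le_left (indep_of_indep_of_le_right h ?_) ?_
  · exact le_iSup₂_of_le (f := fun (i : Option (Σ _ : Fin K, ℕ × ℕ)) (_ : i ∈ {some t}) =>
      i.elim (MeasurableSpace.comap w₀ inferInstance) m) (some t) rfl le_rfl
  · refine sup_le ?_ (iSup₂_le fun s hs => ?_)
    · exact le_iSup₂_of_le (f := fun (i : Option (Σ _ : Fin K, ℕ × ℕ)) (_ : i ∈ {some t}ᶜ) =>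
        i.elim (MeasurableSpace.comap w₀ inferInstance) m) none (by simp) le_rfl
    · exact le_iSup₂_of_le (f := fun (i : Option (Σ _ : Fin K, ℕ × ℕ)) (_ : i ∈ {some t}ᶜ) =>
        i.elim (MeasurableSpace.comap w₀ inferInstance) m) (some s) (by simpa using hs) le_rfl

variable {F : Type*} [NormedAddCommGroup F] [InnerProductSpace ℝ F] [MeasurableSpace F]
  [BorelSpace F] [SecondCountableTopology F]

/-- Conditioning on everything but one draw, done by hand: the event that the draw is `i` is
independent of `f` and `g i` and has probability 1/N. The integral becomes the average over `i` of
the inner products with `g i`, and these fields sum to zero. -/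
lemma integral_inner_draw_eq_zero (hS : IsSampling P w₀ I) (t : Σ _ : Fin K, ℕ × ℕ) {f : Ω → F}
    {g : Fin (N t.1) → Ω → F} (hf : Measurable[exceptDraw w₀ I t] f)
    (hg : ∀ i, Measurable[exceptDraw w₀ I t] (g i)) (hf2 : MemLp f 2 P)
    (hg2 : ∀ i, MemLp (g i) 2 P) (hsum : ∀ ω, ∑ i, g i ω = 0) :
    ∫ ω, inner ℝ (f ω) (g (I t.1 t.2.1 t.2.2 ω) ω) ∂P = 0 := by
  set J := I t.1 t.2.1 t.2.2 with hJ
  have hJm : Measurable J := hS.measurable _ _ _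
  have hterm : ∀ i, ∫ ω, (Set.indicator {i} (fun _ => (1 : ℝ)) (J ω)) * inner ℝ (f ω) (g i ω) ∂P
      = (N t.1 : ℝ)⁻¹ * ∫ ω, inner ℝ (f ω) (g i ω) ∂P := by
    intro i
    have hind : IndepFun (fun ω => Set.indicator {i} (fun _ => (1 : ℝ)) (J ω))
        (fun ω => (inner ℝ (f ω) (g i ω) : ℝ)) P := by
      rw [IndepFun_iff_Indep]
      refine indep_of_indep_of_le_left (indep_of_indep_of_le_right
        (hS.indep_exceptDraw t).symm ?_) ?_
      · exact Measurable.comap_le (Measurable.inner hf (hg i))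
      · have h2 : (fun ω => Set.indicator {i} (fun _ => (1 : ℝ)) (J ω))
            = (Set.indicator {i} fun _ => (1 : ℝ)) ∘ J := rfl
        rw [h2, ← MeasurableSpace.comap_comp]
        exact MeasurableSpace.comap_mono (Measurable.comap_le (measurable_of_finite _))
    rw [hind.integral_fun_mul_eq_mul_integral]
    · congr 1
      rw [← hS.uniform t.1 t.2.1 t.2.2 i]
      exact integral_indicator_one (hJm (measurableSet_singleton i))
    · exact ((measurable_of_finite (Set.indicator {i} fun _ => (1 : ℝ))).comp
        hJm).aestronglyMeasurable
    · exact hf2.1.inner (hg2 i).1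
  have hint : ∀ i, Integrable
      (fun ω => (Set.indicator {i} (fun _ => (1 : ℝ)) (J ω)) * inner ℝ (f ω) (g i ω)) P := by
    intro i
    refine (integrable_inner_of_memLp hf2 (hg2 i)).bdd_mul (c := 1)
      ((measurable_of_finite (Set.indicator {i} fun _ => (1 : ℝ))).comp hJm).aestronglyMeasurable
      (ae_of_all _ fun ω => ?_)
    by_cases h : J ω = i <;> simp [h]
  calc ∫ ω, inner ℝ (f ω) (g (J ω) ω) ∂P
      = ∫ ω, ∑ i, (Set.indicator {i} (fun _ => (1 : ℝ)) (J ω)) * inner ℝ (f ω) (g i ω) ∂P := by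
        refine integral_congr_ae (ae_of_all _ fun ω => ?_)
        simp only
        rw [Finset.sum_eq_single (J ω)]
        · simp
        · intro i _ hi
          simp [Ne.symm hi]
        · simp
    _ = ∑ i, (N t.1 : ℝ)⁻¹ * ∫ ω, inner ℝ (f ω) (g i ω) ∂P := by
        rw [integral_finsetSum _ fun i _ => hint i]
        exact Finset.sum_congr rfl fun i _ => hterm i
    _ = (N t.1 : ℝ)⁻¹ * ∫ ω, inner ℝ (f ω) (∑ i, g i ω) ∂P := by
        rw [← Finset.mul_sum, ← integral_finsetSum _ fun i _ =>
          integrable_inner_of_memLp hf2 (hg2 i)]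
        simp only [inner_sum]
    _ = 0 := by simp [hsum]

end IsSampling

/-- Average of a field over a mini-batch. -/
noncomputable def batchAvg {F : Type*} [NormedAddCommGroup F] [NormedSpace ℝ F]
    (I : ∀ k : Fin K, ℕ → ℕ → Ω → Fin (N k)) (B n : ℕ) (k : Fin K) (g : Fin (N k) → Ω → F)
    (ω : Ω) : F :=
  (B : ℝ)⁻¹ • ∑ b ∈ Finset.range B, g (I k n b ω) ω

namespace IsSampling

variable {F : Type*} [NormedAddCommGroup F] [InnerProductSpace ℝ F] [MeasurableSpace F]
  [BorelSpace F] [SecondCountableTopology F] {B n : ℕ} {k : Fin K} {g : Fin (N k) → Ω → F}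

lemma memLp_draw (hS : IsSampling P w₀ I) (hg : ∀ i, IsPast w₀ I n (g i)) {ρ : Ω → ℝ}
    (hρ : MemLp ρ 2 P) (hgρ : ∀ i ω, ‖g i ω‖ ≤ ρ ω) (b : ℕ) :
    MemLp (fun ω => g (I k n b ω) ω) 2 P :=
  hρ.of_le (measurable_comp_finite (hS.measurable k n b) fun i =>
    (hg i).measurable hS k).aestronglyMeasurable
    (ae_of_all _ fun ω => (hgρ _ ω).trans (Real.le_norm_self _))

lemma memLp_field (hS : IsSampling P w₀ I) (hg : ∀ i, IsPast w₀ I n (g i)) {ρ : Ω → ℝ}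
    (hρ : MemLp ρ 2 P) (hgρ : ∀ i ω, ‖g i ω‖ ≤ ρ ω) (i : Fin (N k)) :
    MemLp (g i) 2 P :=
  hρ.of_le ((hg i).measurable hS k).aestronglyMeasurable
    (ae_of_all _ fun ω => (hgρ i ω).trans (Real.le_norm_self _))

lemma memLp_batchAvg (hS : IsSampling P w₀ I) (hg : ∀ i, IsPast w₀ I n (g i)) {ρ : Ω → ℝ}
    (hρ : MemLp ρ 2 P) (hgρ : ∀ i ω, ‖g i ω‖ ≤ ρ ω) : MemLp (batchAvg I B n k g) 2 P := by
  have h := (memLp_finsetSum (Finset.range B) fun b _ =>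
    hS.memLp_draw hg hρ hgρ b).const_smul (B : ℝ)⁻¹
  exact h

lemma integral_inner_batchAvg_eq_zero (hS : IsSampling P w₀ I) (hg : ∀ i, IsPast w₀ I n (g i))
    {ρ : Ω → ℝ} (hρ : MemLp ρ 2 P) (hgρ : ∀ i ω, ‖g i ω‖ ≤ ρ ω)
    (hsum : ∀ ω, ∑ i, g i ω = 0) {f : Ω → F} (hf : IsPast w₀ I n f) (hf2 : MemLp f 2 P) :
    ∫ ω, inner ℝ (f ω) (batchAvg I B n k g ω) ∂P = 0 := by
  simp only [batchAvg, inner_smul_right, inner_sum]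
  rw [integral_const_mul, integral_finsetSum _ fun b _ =>
    integrable_inner_of_memLp hf2 (hS.memLp_draw hg hρ hgρ b)]
  rw [Finset.sum_eq_zero, mul_zero]
  intro b _
  exact hS.integral_inner_draw_eq_zero ⟨k, n, b⟩ (hf _ le_rfl) (fun i => hg i _ le_rfl) hf2
    (hS.memLp_field hg hρ hgρ) hsum

/-- Among the B² pairs of draws only the B diagonal ones contribute: for b ≠ b' the draw b' is
independent of everything else, including draw b of the same batch. -/
lemma integral_norm_sq_batchAvg_le (hS : IsSampling P w₀ I) (hB : 1 ≤ B)
    (hg : ∀ i, IsPast w₀ I n (g i))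
    {ρ : Ω → ℝ} (hρ : MemLp ρ 2 P) (hgρ : ∀ i ω, ‖g i ω‖ ≤ ρ ω) (hsum : ∀ ω, ∑ i, g i ω = 0) :
    ∫ ω, ‖batchAvg I B n k g ω‖ ^ 2 ∂P ≤ (B : ℝ)⁻¹ * ∫ ω, ρ ω ^ 2 ∂P := by
  have hB0 : (0 : ℝ) < B := by exact_mod_cast hB
  have hL := hS.memLp_draw hg hρ hgρ
  have h1 : ∀ ω, ‖batchAvg I B n k g ω‖ ^ 2 = ((B : ℝ)⁻¹) ^ 2 *
      ∑ b ∈ Finset.range B, ∑ b' ∈ Finset.range B,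
        inner ℝ (g (I k n b ω) ω) (g (I k n b' ω) ω) := by
    intro ω
    rw [batchAvg, norm_smul, mul_pow, ← real_inner_self_eq_norm_sq (∑ b ∈ Finset.range B, _),
      sum_inner]
    simp only [inner_sum, norm_inv, RCLike.norm_natCast]
  have hoff : ∀ b b', b ≠ b' →
      ∫ ω, inner ℝ (g (I k n b ω) ω) (g (I k n b' ω) ω) ∂P = 0 := by
    intro b b' hbb
    refine hS.integral_inner_draw_eq_zero ⟨k, n, b'⟩ (f := fun ω => g (I k n b ω) ω)
      ?_ (fun i => hg i _ le_rfl) (hL b) (hS.memLp_field hg hρ hgρ) hsum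
    refine measurable_comp_finite (measurable_draw_exceptDraw (s := ⟨k, n, b⟩) ?_)
      fun i => hg i _ le_rfl
    intro h
    simp at h
    exact hbb h
  have hdiag : ∀ b, ∫ ω, inner ℝ (g (I k n b ω) ω) (g (I k n b ω) ω) ∂P ≤ ∫ ω, ρ ω ^ 2 ∂P := by
    intro b
    refine integral_mono (integrable_inner_of_memLp (hL b) (hL b)) hρ.integrable_sq fun ω => ?_
    simp only [real_inner_self_eq_norm_sq]
    exact pow_le_pow_left₀ (norm_nonneg _) (hgρ _ ω) 2
  simp_rw [h1]
  rw [integral_const_mul, integral_finsetSum _ fun b _ => integrable_finsetSum _ fun b' _ =>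
    integrable_inner_of_memLp (hL b) (hL b')]
  have h2 : ∀ b ∈ Finset.range B, ∫ ω, ∑ b' ∈ Finset.range B,
      inner ℝ (g (I k n b ω) ω) (g (I k n b' ω) ω) ∂P ≤ ∫ ω, ρ ω ^ 2 ∂P := by
    intro b hb
    rw [integral_finsetSum _ fun b' _ => integrable_inner_of_memLp (hL b) (hL b'),
      Finset.sum_eq_single b (fun b' _ h => hoff b b' h.symm) (fun h => absurd hb h)]
    exact hdiag b
  calc _ ≤ ((B : ℝ)⁻¹) ^ 2 * ∑ b ∈ Finset.range B, ∫ ω, ρ ω ^ 2 ∂P := by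
        exact mul_le_mul_of_nonneg_left (Finset.sum_le_sum h2) (by positivity)
    _ = _ := by
        rw [Finset.sum_const, Finset.card_range, nsmul_eq_mul]
        field_simp

end IsSampling

end Draws

/-! ### Moment estimates for noisy iterations over a network -/

section Iteration

variable {Ω : Type*} [mΩ : MeasurableSpace Ω] {P : Measure Ω} [IsProbabilityMeasure P]
  {K M : ℕ} {N : Fin K → ℕ} {β : Type*} [MeasurableSpace β]
  {w₀ : Ω → β} {I : ∀ k : Fin K, ℕ → ℕ → Ω → Fin (N k)}

namespace IsPast

variable {F : Type*} [NormedAddCommGroup F] [InnerProductSpace ℝ F] [MeasurableSpace F]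
  [BorelSpace F] [SecondCountableTopology F] {n : ℕ}

lemma sqAdd {f g : SqInt P F} (hf : IsPast w₀ I n f.1) (hg : IsPast w₀ I n g.1) :
    IsPast w₀ I n (f + g).1 := fun t ht => (hf t ht).add (hg t ht)

lemma sqSub {f g : SqInt P F} (hf : IsPast w₀ I n f.1) (hg : IsPast w₀ I n g.1) :
    IsPast w₀ I n (f - g).1 := fun t ht => (hf t ht).sub (hg t ht)

lemma sqSmul {f : SqInt P F} (hf : IsPast w₀ I n f.1) (c : ℝ) :
    IsPast w₀ I n (c • f).1 := fun t ht => (hf t ht).const_smul c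

lemma sqMap {f : SqInt P F} (hf : IsPast w₀ I n f.1) (T : F →L[ℝ] F) :
    IsPast w₀ I n (SqInt.map T f).1 := IsPast.comp hf T.continuous.measurable

lemma sqConst (c : F) : IsPast w₀ I n (SqInt.const P c).1 := fun _ _ => measurable_const

end IsPast

namespace SqInt

lemma norm_map_mix_le {A : Matrix (Fin K) (Fin K) ℝ}
    (hA : A ∈ doublyStochastic ℝ (Fin K)) (hs : A.IsSymm) (f : SqInt P (NetState K M)) :
    ‖map (mix A) f‖ ≤ ‖f‖ := by
  simpa using norm_map_le zero_le_one (fun x => by simpa using norm_mix_le hA hs x) f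

lemma norm_map_avgOp_le (f : SqInt P (NetState K M)) : ‖map avgOp f‖ ≤ ‖f‖ := by
  simpa using norm_map_le zero_le_one (fun x => by simpa using norm_avgOp_le x) f

lemma norm_map_mix_le_of_avgOp_eq_zero {A : Matrix (Fin K) (Fin K) ℝ}
    (hA : A ∈ doublyStochastic ℝ (Fin K)) (hs : A.IsSymm) {r : ℝ} (hr0 : 0 ≤ r)
    (hr : ∀ x : Fin K → ℝ, ∑ k, x k = 0 →
      ∑ k, (A.mulVec x k) ^ 2 ≤ r ^ 2 * ∑ l, x l ^ 2) {f : SqInt P (NetState K M)}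
    (hf : map avgOp f = 0) : ‖map (mix A) f‖ ≤ r * ‖f‖ := by
  refine norm_le_mul_norm hr0 fun ω => ?_
  refine norm_mix_le_of_avgOp_eq_zero hA hs hr0 hr ?_
  exact congrArg (fun g : SqInt P (NetState K M) => g.1 ω) hf

lemma norm_map_blockDiag_le {H : Fin K → Vec M →L[ℝ] Vec M} {c : ℝ} (hc : 0 ≤ c)
    (hH : ∀ k, ‖H k‖ ≤ c) (f : SqInt P (NetState K M)) : ‖map (blockDiag H) f‖ ≤ c * ‖f‖ :=
  norm_map_le hc (norm_blockDiag_le hc hH) f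

lemma map_avgOp_mix {A : Matrix (Fin K) (Fin K) ℝ} (hA : A ∈ doublyStochastic ℝ (Fin K))
    (f : SqInt P (NetState K M)) : map avgOp (map (mix A) f) = map avgOp f := by
  ext ω : 1; exact avgOp_mix hA _

lemma map_mix_avgOp {A : Matrix (Fin K) (Fin K) ℝ} (hA : A ∈ doublyStochastic ℝ (Fin K))
    (f : SqInt P (NetState K M)) : map (mix A) (map avgOp f) = map avgOp f := by
  ext ω : 1; exact mix_avgOp hA _

lemma map_avgOp_avgOp (f : SqInt P (NetState K M)) : map avgOp (map avgOp f) = map avgOp f := by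
  ext ω : 1; exact avgOp_avgOp _

end SqInt

open SqInt

/-- The recursion `w' = A w - μ D (b + Z + H w + R + Φ)` in mean square, where `Z` is the gradient
noise at the minimizer, `R` the nonlinear part of the mean gradient, and `Φ` the fluctuation of the
gradient noise. -/
structure IsIteration (w₀ : Ω → β) (I : ∀ k : Fin K, ℕ → ℕ → Ω → Fin (N k))
    (A D : Matrix (Fin K) (Fin K) ℝ) (H : Fin K → Vec M →L[ℝ] Vec M) (b : NetState K M)
    (L C : ℝ) (B : ℕ) (μ : ℝ) (W Z R Φ : ℕ → SqInt P (NetState K M)) : Prop where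
  step : ∀ n, W (n + 1) = map (mix A) (W n)
    - μ • map (mix D) (const P b + Z n + (map (blockDiag H) (W n) + R n + Φ n))
  past : ∀ n, IsPast w₀ I n (W n).1
  past_rem : ∀ n, IsPast w₀ I n (R n).1
  past_noise : ∀ n, IsPast w₀ I (n + 1) (Z n).1
  norm_incr_le : ∀ n, ‖map (blockDiag H) (W n) + R n + Φ n‖ ≤ L * ‖W n‖
  inner_noise : ∀ n (Y : SqInt P (NetState K M)), IsPast w₀ I n Y.1 → inner ℝ Y (Z n) = 0
  inner_fluct : ∀ n (Y : SqInt P (NetState K M)), IsPast w₀ I n Y.1 → inner ℝ Y (Φ n) = 0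
  norm_sq_noise_le : ∀ n, ‖Z n‖ ^ 2 ≤ C / B
  norm_sq_fluct_le : ∀ n, ‖Φ n‖ ^ 2 ≤ 4 * L ^ 2 * ‖W n‖ ^ 2 / B
  bound_noise : ∀ n ω, ‖(Z n).1 ω‖ ^ 2 ≤ C
  weighted_noise : ∀ n (Y : SqInt P (NetState K M)), IsPast w₀ I n Y.1 →
    ∫ ω, ‖Y.1 ω‖ ^ 2 * ‖(Z n).1 ω‖ ^ 2 ∂P ≤ C / B * ‖Y‖ ^ 2

/-- The part of the centroid that the gradient noise at the minimizer drives. -/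
noncomputable def noiseCentroid (H : Fin K → Vec M →L[ℝ] Vec M) (μ : ℝ)
    (Z : ℕ → SqInt P (NetState K M)) : ℕ → SqInt P (NetState K M)
  | 0 => 0
  | n + 1 => noiseCentroid H μ Z n
      - μ • map avgOp (map (blockDiag H) (noiseCentroid H μ Z n) + Z n)

namespace IsIteration

variable {A D : Matrix (Fin K) (Fin K) ℝ} {H : Fin K → Vec M →L[ℝ] Vec M} {b : NetState K M}
  {L C : ℝ} {B : ℕ} {μ : ℝ} {W Z R Φ : ℕ → SqInt P (NetState K M)}

/-- One step of the second moment recursion, in an abstract semi-inner product space. -/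
lemma norm_sq_step_le {E : Type*} [SeminormedAddCommGroup E] [InnerProductSpace ℝ E]
    {x u y : E} {μ : ℝ} (hμ : 0 ≤ μ) (hxu : inner ℝ x u = 0) :
    ‖x - μ • (u + y)‖ ^ 2 ≤ (‖x‖ + μ * ‖y‖) ^ 2 + μ ^ 2 * ‖y‖ ^ 2 + 2 * μ ^ 2 * ‖u‖ ^ 2 := by
  have h1 : x - μ • (u + y) = (x - μ • y) - μ • u := by rw [smul_add]; abel
  have h2 : inner ℝ (x - μ • y) (μ • u) = -(μ ^ 2 * inner ℝ y u) := by
    rw [inner_sub_left, inner_smul_right, inner_smul_right, inner_smul_left, hxu]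
    simp only [conj_trivial]; ring
  have h3 : ‖x - μ • y‖ ≤ ‖x‖ + μ * ‖y‖ := by
    refine (norm_sub_le _ _).trans ?_
    rw [norm_smul, Real.norm_of_nonneg hμ]
  have h4 := real_inner_le_norm y u
  have h5 := two_mul_le_add_sq ‖y‖ ‖u‖
  rw [h1, norm_sub_sq_real, h2, norm_smul, Real.norm_of_nonneg hμ]
  have h6 : ‖x - μ • y‖ ^ 2 ≤ (‖x‖ + μ * ‖y‖) ^ 2 := pow_le_pow_left₀ (norm_nonneg _) h3 2
  have h7 : μ ^ 2 * (2 * inner ℝ y u) ≤ μ ^ 2 * (‖y‖ ^ 2 + ‖u‖ ^ 2) := by gcongr; linarith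
  nlinarith

/-- Young's inequality and μ² ≤ μ bring the second moment step to the form of the discrete Gronwall
inequality; `e` stands for the size of the bias deviation. -/
lemma growth_bound {L μ : ℝ} (hL : 0 ≤ L) (hμ : 0 ≤ μ) (hμ1 : μ ≤ 1) (y e C B : ℝ) :
    (y + μ * (L * (y + e))) ^ 2 + μ ^ 2 * (L * (y + e)) ^ 2 + 2 * μ ^ 2 * (C / B)
      ≤ (1 + μ * (3 * L + 4 * L ^ 2)) * y ^ 2
        + μ * ((L + 4 * L ^ 2) * e ^ 2 + 2 * (C * (μ / B))) := by
  have h6 : μ ^ 2 * (L ^ 2 * (y + e) ^ 2) ≤ μ * (L ^ 2 * (2 * y ^ 2 + 2 * e ^ 2)) := by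
    have : μ ^ 2 ≤ μ := by nlinarith
    gcongr
    nlinarith [sq_nonneg (y - e)]
  have h7 : μ * (L * (2 * y * (y + e))) ≤ μ * (L * (3 * y ^ 2 + e ^ 2)) := by
    gcongr
    nlinarith [sq_nonneg (y - e)]
  calc _ = y ^ 2 + μ * (L * (2 * y * (y + e))) + 2 * (μ ^ 2 * (L ^ 2 * (y + e) ^ 2))
        + 2 * μ ^ 2 * (C / B) := by ring
    _ ≤ y ^ 2 + μ * (L * (3 * y ^ 2 + e ^ 2)) + 2 * (μ * (L ^ 2 * (2 * y ^ 2 + 2 * e ^ 2)))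
        + 2 * μ ^ 2 * (C / B) := by linarith
    _ = _ := by ring

/-- The forcing -μ D b is of order μ in each step, and norm estimates alone would let it add up to
order one over T/μ steps. Subtracting `biasDev` removes it exactly and leaves a second moment
forcing of size μ times O(μ² + μ/B). -/
lemma norm_sq_sub_biasDev_step_le (h : IsIteration w₀ I A D H b L C B μ W Z R Φ)
    (hA : A ∈ doublyStochastic ℝ (Fin K)) (hs : A.IsSymm)
    (hD : D ∈ doublyStochastic ℝ (Fin K)) (hDs : D.IsSymm) (hL : 0 ≤ L) (hμ : 0 ≤ μ)
    (hμ1 : μ ≤ 1) {c : ℝ} (hc : ∀ n, ‖biasDev A D μ b n‖ ≤ c * μ) (n : ℕ) :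
    ‖W (n + 1) - const P (biasDev A D μ b (n + 1))‖ ^ 2
      ≤ (1 + μ * (3 * L + 4 * L ^ 2)) * ‖W n - const P (biasDev A D μ b n)‖ ^ 2
        + μ * ((L + 4 * L ^ 2) * (c * μ) ^ 2 + 2 * (C * (μ / B))) := by
  set Y := W n - const P (biasDev A D μ b n) with hY
  set Nn := map (blockDiag H) (W n) + R n + Φ n with hN
  have h1 : W (n + 1) - const P (biasDev A D μ b (n + 1))
      = map (mix A) Y - μ • (map (mix D) (Z n) + map (mix D) Nn) := by
    rw [h.step n, ← hN, hY, biasDev]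
    simp only [map_sub, map_add, map_smul, SqInt.map_const, smul_add]
    abel
  have hYp : IsPast w₀ I n Y.1 := (h.past n).sqSub (IsPast.sqConst _)
  -- Symmetry of `D` moves it onto the factor determined by the past, so orthogonality of the raw
  -- noise suffices.
  have horth : inner ℝ (map (mix A) Y) (map (mix D) (Z n)) = 0 := by
    rw [real_inner_comm, inner_map_left (inner_mix_left hDs), real_inner_comm]
    exact h.inner_noise n _ ((hYp.sqMap _).sqMap _)
  have h2 := norm_sq_step_le (y := map (mix D) Nn) hμ horth
  rw [← h1] at h2
  have hW : ‖W n‖ ≤ ‖Y‖ + c * μ := by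
    have : W n = Y + const P (biasDev A D μ b n) := by rw [hY]; abel
    rw [this]
    refine (norm_add_le _ _).trans ?_
    rw [norm_const]
    gcongr
    exact hc n
  have hAY := norm_map_mix_le hA hs Y
  have hDN : ‖map (mix D) Nn‖ ≤ L * (‖Y‖ + c * μ) :=
    (norm_map_mix_le hD hDs Nn).trans ((h.norm_incr_le n).trans (by gcongr))
  have hDZ : ‖map (mix D) (Z n)‖ ^ 2 ≤ C / B :=
    (pow_le_pow_left₀ (norm_nonneg _) (norm_map_mix_le hD hDs (Z n)) 2).trans
      (h.norm_sq_noise_le n)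
  have hc0 : 0 ≤ c * μ := (norm_nonneg _).trans (hc 0)
  have hy : 0 ≤ ‖Y‖ := norm_nonneg _
  have h3 : (‖map (mix A) Y‖ + μ * ‖map (mix D) Nn‖) ^ 2
      ≤ (‖Y‖ + μ * (L * (‖Y‖ + c * μ))) ^ 2 := by
    gcongr
  have h4 : μ ^ 2 * ‖map (mix D) Nn‖ ^ 2 ≤ μ ^ 2 * (L * (‖Y‖ + c * μ)) ^ 2 := by gcongr
  have h5 : 2 * μ ^ 2 * ‖map (mix D) (Z n)‖ ^ 2 ≤ 2 * μ ^ 2 * (C / B) := by gcongr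
  exact (h2.trans (add_le_add (add_le_add h3 h4) h5)).trans
    (growth_bound hL hμ hμ1 ‖Y‖ (c * μ) C B)

lemma norm_sq_le (h : IsIteration w₀ I A D H b L C B μ W Z R Φ)
    (hA : A ∈ doublyStochastic ℝ (Fin K)) (hs : A.IsSymm)
    (hD : D ∈ doublyStochastic ℝ (Fin K)) (hDs : D.IsSymm) (hL : 0 ≤ L) (hC : 0 ≤ C) (hμ : 0 ≤ μ)
    (hμ1 : μ ≤ 1) {c T : ℝ} (hc : ∀ n, ‖biasDev A D μ b n‖ ≤ c * μ)
    (hW0 : ‖W 0‖ ^ 2 ≤ μ ^ 2 + μ / B) {n : ℕ} (hn : n * μ ≤ T) :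
    ‖W n‖ ^ 2 ≤ (2 * (Real.exp ((3 * L + 4 * L ^ 2) * T)
        * (1 + T * ((L + 4 * L ^ 2) * c ^ 2 + 2 * C))) + 2 * c ^ 2) * (μ ^ 2 + μ / B) := by
  have hT : 0 ≤ T := le_trans (by positivity) hn
  set θ := μ ^ 2 + μ / B with hθ
  have hθ0 : 0 ≤ θ := by positivity
  have hμθ : μ ^ 2 ≤ θ := by rw [hθ]; have : 0 ≤ μ / B := by positivity
                             linarith
  have hBθ : μ / B ≤ θ := by rw [hθ]; have := sq_nonneg μ; linarith
  have hg := le_exp_mul_of_step_le (x := fun n => ‖W n - const P (biasDev A D μ b n)‖ ^ 2)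
    (a := 3 * L + 4 * L ^ 2) (β := (L + 4 * L ^ 2) * (c * μ) ^ 2 + 2 * (C * (μ / B)))
    (N := n) (by positivity) hμ (by positivity) (sq_nonneg _)
    (fun j _ => h.norm_sq_sub_biasDev_step_le hA hs hD hDs hL hμ hμ1 hc j) n le_rfl
  have h0 : W 0 - const P (biasDev A D μ b 0) = W 0 := by simp [biasDev]
  simp only [h0] at hg
  have h1 : ‖W 0‖ ^ 2 + n * μ * ((L + 4 * L ^ 2) * (c * μ) ^ 2 + 2 * (C * (μ / B)))
      ≤ (1 + T * ((L + 4 * L ^ 2) * c ^ 2 + 2 * C)) * θ := by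
    have : (L + 4 * L ^ 2) * (c * μ) ^ 2 + 2 * (C * (μ / B))
        ≤ ((L + 4 * L ^ 2) * c ^ 2 + 2 * C) * θ := by
      have e1 : (L + 4 * L ^ 2) * (c * μ) ^ 2 ≤ (L + 4 * L ^ 2) * (c ^ 2 * θ) := by
        rw [mul_pow]; gcongr
      have e2 : C * (μ / B) ≤ C * θ := by gcongr
      linarith
    calc _ ≤ θ + T * (((L + 4 * L ^ 2) * c ^ 2 + 2 * C) * θ) := by gcongr
      _ = _ := by ring
  have h2 : Real.exp ((3 * L + 4 * L ^ 2) * (n * μ)) ≤ Real.exp ((3 * L + 4 * L ^ 2) * T) := by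
    gcongr
  have h3 : ‖W n - const P (biasDev A D μ b n)‖ ^ 2 ≤ Real.exp ((3 * L + 4 * L ^ 2) * T)
      * ((1 + T * ((L + 4 * L ^ 2) * c ^ 2 + 2 * C)) * θ) :=
    hg.trans (mul_le_mul h2 h1 (by positivity) (by positivity))
  have h4 : ‖biasDev A D μ b n‖ ^ 2 ≤ c ^ 2 * θ := by
    calc _ ≤ (c * μ) ^ 2 := pow_le_pow_left₀ (norm_nonneg _) (hc n) 2
      _ = c ^ 2 * μ ^ 2 := by ring
      _ ≤ _ := by gcongr
  have h5 : ‖W n‖ ≤ ‖W n - const P (biasDev A D μ b n)‖ + ‖biasDev A D μ b n‖ := by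
    rw [← norm_const (P := P) (biasDev A D μ b n)]
    simpa using norm_add_le (W n - const P (biasDev A D μ b n)) (const P (biasDev A D μ b n))
  have h6 : ‖W n‖ ^ 2 ≤ 2 * ‖W n - const P (biasDev A D μ b n)‖ ^ 2
      + 2 * ‖biasDev A D μ b n‖ ^ 2 := by
    have := pow_le_pow_left₀ (norm_nonneg _) h5 2
    nlinarith [sq_nonneg (‖W n - const P (biasDev A D μ b n)‖ - ‖biasDev A D μ b n‖)]
  calc _ ≤ _ := h6
    _ ≤ 2 * (Real.exp ((3 * L + 4 * L ^ 2) * T)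
      * ((1 + T * ((L + 4 * L ^ 2) * c ^ 2 + 2 * C)) * θ)) + 2 * (c ^ 2 * θ) := by gcongr
    _ = _ := by ring

/-- Deviation from the centroid that the bias does not explain. -/
noncomputable def devErr (A D : Matrix (Fin K) (Fin K) ℝ) (b : NetState K M) (μ : ℝ)
    (W : ℕ → SqInt P (NetState K M)) (n : ℕ) : SqInt P (NetState K M) :=
  W n - map avgOp (W n) - const P (biasDev A D μ b n)

lemma map_avgOp_devErr (hA : A ∈ doublyStochastic ℝ (Fin K))
    (hD : D ∈ doublyStochastic ℝ (Fin K)) (hb : avgOp b = 0) (n : ℕ) :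
    map avgOp (devErr A D b μ W n) = 0 := by
  simp [devErr, map_avgOp_avgOp, SqInt.map_const, avgOp_biasDev hA hD hb]

/-- The error has zero mean, so it is contracted by r at each step against a forcing of order μ. The
forcing sums geometrically instead of accumulating over T/μ steps, which makes this error smaller
than the centroid noise. -/
lemma norm_devErr_le (h : IsIteration w₀ I A D H b L C B μ W Z R Φ)
    (hA : A ∈ doublyStochastic ℝ (Fin K)) (hs : A.IsSymm)
    (hD : D ∈ doublyStochastic ℝ (Fin K)) (hDs : D.IsSymm)
    {r : ℝ} (hr0 : 0 ≤ r) (hr1 : r < 1)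
    (hr : ∀ x : Fin K → ℝ, ∑ k, x k = 0 →
      ∑ k, (A.mulVec x k) ^ 2 ≤ r ^ 2 * ∑ l, x l ^ 2) (hb : avgOp b = 0)
    (hL : 0 ≤ L) (hμ : 0 ≤ μ) {S s : ℝ} {n₁ : ℕ} (hS : ∀ n ≤ n₁, ‖W n‖ ≤ S)
    (hZ : ∀ n, ‖Z n‖ ≤ s) :
    ∀ n ≤ n₁, ‖devErr A D b μ W n‖ ≤ 2 * ‖W 0‖ + 2 * μ * (s + L * S) / (1 - r) := by
  have h1r : 0 < 1 - r := by linarith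
  have hs0 : 0 ≤ s := (norm_nonneg _).trans (hZ 0)
  have hS0 : 0 ≤ S := (norm_nonneg _).trans (hS 0 (Nat.zero_le _))
  intro n hn
  induction n with
  | zero =>
    have h1 : devErr A D b μ W 0 = W 0 - map avgOp (W 0) := by simp [devErr, biasDev]
    rw [h1]
    have h2 := norm_sub_le (W 0) (map avgOp (W 0))
    have h3 := norm_map_avgOp_le (W 0)
    have : 0 ≤ 2 * μ * (s + L * S) / (1 - r) := by positivity
    linarith
  | succ n ih =>
    have ih := ih (by omega)
    set x := map (mix D) (Z n + (map (blockDiag H) (W n) + R n + Φ n)) with hx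
    have h1 : devErr A D b μ W (n + 1)
        = map (mix A) (devErr A D b μ W n) - μ • (x - map avgOp x) := by
      have e1 : W (n + 1) = map (mix A) (W n) - μ • (const P (mix D b) + x) := by
        rw [h.step n, hx]
        simp only [map_add, SqInt.map_const]
        abel_nf
      have e2 : map avgOp (W (n + 1)) = map avgOp (W n) - μ • map avgOp x := by
        rw [e1]
        simp only [map_sub, map_smul, map_add, map_avgOp_mix hA, SqInt.map_const, avgOp_mix hD, hb,
          map_zero, zero_add]
      rw [devErr, e2, e1, devErr, biasDev]
      simp only [map_sub, map_mix_avgOp hA, SqInt.map_const, map_smul, smul_add, smul_sub]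
      abel
    have hxn : ‖x‖ ≤ s + L * S := by
      refine (norm_map_mix_le hD hDs _).trans ((norm_add_le _ _).trans ?_)
      refine add_le_add (hZ n) ((h.norm_incr_le n).trans ?_)
      gcongr
      exact hS n (by omega)
    calc _ ≤ ‖map (mix A) (devErr A D b μ W n)‖ + ‖μ • (x - map avgOp x)‖ := by
          rw [h1]; exact norm_sub_le _ _
      _ ≤ r * ‖devErr A D b μ W n‖ + μ * (2 * (s + L * S)) := by
          rw [norm_smul, Real.norm_of_nonneg hμ]
          gcongr
          · exact norm_map_mix_le_of_avgOp_eq_zero hA hs hr0 hr (map_avgOp_devErr hA hD hb n)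
          · have := norm_sub_le x (map avgOp x)
            have := norm_map_avgOp_le x
            linarith
      _ ≤ r * (2 * ‖W 0‖ + 2 * μ * (s + L * S) / (1 - r)) + μ * (2 * (s + L * S)) := by gcongr
      _ = r * (2 * ‖W 0‖) + 2 * μ * (s + L * S) / (1 - r) := by field_simp; ring
      _ ≤ _ := by
          have : r * (2 * ‖W 0‖) ≤ 1 * (2 * ‖W 0‖) := by gcongr
          linarith

end IsIteration

end Iteration

/-! ### Second and fourth moments of the noise centroid -/

section NoiseCentroid

open SqInt

variable {Ω : Type*} [mΩ : MeasurableSpace Ω] {P : Measure Ω} [IsProbabilityMeasure P]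
  {K M : ℕ} {N : Fin K → ℕ} {β : Type*} [MeasurableSpace β]
  {w₀ : Ω → β} {I : ∀ k : Fin K, ℕ → ℕ → Ω → Fin (N k)}

lemma SqInt.inner_smul_left_real (c : ℝ) (f g : SqInt P (NetState K M)) :
    inner ℝ (c • f) g = c * inner ℝ f g :=
  (InnerProductSpace.smul_left f g c).trans (by rw [conj_trivial])

lemma SqInt.inner_smul_right_real (c : ℝ) (f g : SqInt P (NetState K M)) :
    inner ℝ f (c • g) = c * inner ℝ f g := by
  rw [real_inner_comm, inner_smul_left_real, real_inner_comm]

/-- The fourth power of the norm of a perturbed vector. -/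
lemma norm_sub_smul_pow_four_le {E : Type*} [NormedAddCommGroup E] [InnerProductSpace ℝ E]
    (y ζ : E) {μ : ℝ} (hμ : 0 ≤ μ) :
    ‖y - μ • ζ‖ ^ 4 ≤ ‖y‖ ^ 4 - 4 * μ * (‖y‖ ^ 2 * inner ℝ y ζ) + 8 * μ ^ 2 * (‖y‖ ^ 2 * ‖ζ‖ ^ 2)
      + 3 * μ ^ 4 * ‖ζ‖ ^ 4 := by
  have h1 : ‖y - μ • ζ‖ ^ 2 = ‖y‖ ^ 2 - 2 * μ * inner ℝ y ζ + μ ^ 2 * ‖ζ‖ ^ 2 := by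
    rw [norm_sub_sq_real, inner_smul_right, norm_smul, Real.norm_of_nonneg hμ]; ring
  have h2 : |inner ℝ y ζ| ≤ ‖y‖ * ‖ζ‖ := abs_real_inner_le_norm y ζ
  have h3 : (inner ℝ y ζ) ^ 2 ≤ ‖y‖ ^ 2 * ‖ζ‖ ^ 2 := by
    rw [← mul_pow, ← sq_abs]; exact pow_le_pow_left₀ (abs_nonneg _) h2 2
  have h4 : ‖y - μ • ζ‖ ^ 4 = (‖y‖ ^ 2 - 2 * μ * inner ℝ y ζ + μ ^ 2 * ‖ζ‖ ^ 2) ^ 2 := by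
    rw [← h1]; ring
  rw [h4]
  set a := ‖y‖ ^ 2
  set t := inner ℝ y ζ
  set z := ‖ζ‖ ^ 2
  have hz4 : ‖ζ‖ ^ 4 = z ^ 2 := by simp only [z]; ring
  rw [hz4]
  -- Young's inequality for the cubic term; its two halves complete the coefficients 8 = 6 + 2 and 3
  -- = 1 + 2 of the claim.
  have h5 : -(4 * (μ * t) * (μ ^ 2 * z)) ≤ 2 * (μ * t) ^ 2 + 2 * (μ ^ 2 * z) ^ 2 := by
    nlinarith [sq_nonneg (μ * t + μ ^ 2 * z)]
  have h6 : (μ * t) ^ 2 ≤ μ ^ 2 * (a * z) := by rw [mul_pow]; gcongr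
  nlinarith

namespace IsIteration

variable {A D : Matrix (Fin K) (Fin K) ℝ} {H : Fin K → Vec M →L[ℝ] Vec M} {b : NetState K M}
  {L C : ℝ} {B : ℕ} {μ : ℝ} {W Z R Φ : ℕ → SqInt P (NetState K M)}

lemma isPast_noiseCentroid (h : IsIteration w₀ I A D H b L C B μ W Z R Φ) (n : ℕ) :
    IsPast w₀ I n (noiseCentroid H μ Z n).1 := by
  induction n with
  | zero => exact fun _ _ => measurable_const
  | succ n ih =>
    have ih' := ih.mono (Nat.le_succ n)
    exact ih'.sqSub ((((ih'.sqMap _).sqAdd (h.past_noise n)).sqMap _).sqSmul _)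

/-- The noise centroid has mean zero, written as orthogonality to constants. By symmetry of the
Hessians the step moves onto the constant, which changes it; hence the induction over all constants
at once. -/
lemma inner_noiseCentroid_const (h : IsIteration w₀ I A D H b L C B μ W Z R Φ)
    (hsymm : ∀ k x y, inner ℝ (H k x) y = inner ℝ x (H k y)) (n : ℕ) (c : NetState K M) :
    inner ℝ (noiseCentroid H μ Z n) (const P c) = 0 := by
  have hH : ∀ x y : NetState K M,
      inner ℝ (blockDiag H x) y = inner ℝ x (blockDiag H y) := fun x y => by
    rw [PiLp.inner_apply, PiLp.inner_apply]
    exact Finset.sum_congr rfl fun k _ => hsymm k _ _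
  induction n generalizing c with
  | zero => simp [noiseCentroid]
  | succ n ih =>
    rw [noiseCentroid, inner_sub_left, inner_smul_left_real, inner_map_left inner_avgOp_left,
      inner_add_left, inner_map_left hH, SqInt.map_const, SqInt.map_const, ih, ih,
      real_inner_comm, h.inner_noise n _ (IsPast.sqConst _)]
    simp

/-- Each noise term is orthogonal to the past, so squares add: T/μ increments of size μ² C/B give
order μ/B. -/
lemma norm_sq_noiseCentroid_le (h : IsIteration w₀ I A D H b L C B μ W Z R Φ)
    (hH : ∀ k, ‖H k‖ ≤ L) (hL : 0 ≤ L) (hC : 0 ≤ C) (hμ : 0 ≤ μ) (hμ1 : μ ≤ 1) {T : ℝ} {n : ℕ}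
    (hn : n * μ ≤ T) :
    ‖noiseCentroid H μ Z n‖ ^ 2 ≤ Real.exp ((2 * L + L ^ 2) * T) * (T * (C * (μ / B))) := by
  have hT : 0 ≤ T := le_trans (by positivity) hn
  have hstep : ∀ n, ‖noiseCentroid H μ Z (n + 1)‖ ^ 2
      ≤ (1 + μ * (2 * L + L ^ 2)) * ‖noiseCentroid H μ Z n‖ ^ 2 + μ * (C * (μ / B)) := by
    intro n
    set z := noiseCentroid H μ Z n with hz
    set x := z - μ • map avgOp (map (blockDiag H) z) with hx
    have hzp : IsPast w₀ I n z.1 := h.isPast_noiseCentroid n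
    have hxp : IsPast w₀ I n x.1 := hzp.sqSub (((hzp.sqMap _).sqMap _).sqSmul _)
    have h1 : noiseCentroid H μ Z (n + 1) = x - μ • map avgOp (Z n) := by
      rw [noiseCentroid, ← hz, hx, map_add, smul_add]; abel
    have h2 : inner ℝ x (map avgOp (Z n)) = 0 := by
      rw [← inner_map_left inner_avgOp_left]
      exact h.inner_noise n _ (hxp.sqMap _)
    have h3 : ‖x‖ ≤ (1 + μ * L) * ‖z‖ := by
      calc _ ≤ ‖z‖ + ‖μ • map avgOp (map (blockDiag H) z)‖ := norm_sub_le _ _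
        _ ≤ ‖z‖ + μ * (L * ‖z‖) := by
          rw [norm_smul, Real.norm_of_nonneg hμ]
          gcongr
          exact (norm_map_avgOp_le _).trans (norm_map_blockDiag_le hL hH z)
        _ = _ := by ring
    have h4 : ‖map avgOp (Z n)‖ ^ 2 ≤ C / B :=
      (pow_le_pow_left₀ (norm_nonneg _) (norm_map_avgOp_le (Z n)) 2).trans
        (h.norm_sq_noise_le n)
    rw [h1, norm_sub_sq_real, inner_smul_right_real, h2, norm_smul, Real.norm_of_nonneg hμ, mul_pow]
    have h5 : ‖x‖ ^ 2 ≤ ((1 + μ * L) * ‖z‖) ^ 2 := pow_le_pow_left₀ (norm_nonneg _) h3 2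
    have h6 : (1 + μ * L) ^ 2 ≤ 1 + μ * (2 * L + L ^ 2) := by
      have : μ ^ 2 * L ^ 2 ≤ μ * L ^ 2 := by
        have : μ ^ 2 ≤ μ := by nlinarith
        gcongr
      linarith
    have h7 : μ ^ 2 * ‖map avgOp (Z n)‖ ^ 2 ≤ μ ^ 2 * (C / B) := by gcongr
    have h8 : ((1 + μ * L) * ‖z‖) ^ 2 ≤ (1 + μ * (2 * L + L ^ 2)) * ‖z‖ ^ 2 := by
      rw [mul_pow]; gcongr
    calc _ ≤ (1 + μ * (2 * L + L ^ 2)) * ‖z‖ ^ 2 + μ ^ 2 * (C / B) := by linarith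
      _ = _ := by ring
  have hg := le_exp_mul_of_step_le (x := fun n => ‖noiseCentroid H μ Z n‖ ^ 2)
    (a := 2 * L + L ^ 2) (β := C * (μ / B)) (N := n) (by positivity) hμ (by positivity)
    (sq_nonneg _) (fun j _ => hstep j) n le_rfl
  have h0 : ‖noiseCentroid H μ Z 0‖ ^ 2 = 0 := by simp [noiseCentroid]
  refine hg.trans ?_
  simp only [h0, zero_add]
  gcongr

/-- The bound may grow with `n`; it serves only to make all powers integrable. -/
lemma exists_bound_noiseCentroid (h : IsIteration w₀ I A D H b L C B μ W Z R Φ)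
    (hH : ∀ k, ‖H k‖ ≤ L) (hL : 0 ≤ L) (hμ : 0 ≤ μ) (n : ℕ) :
    ∃ c : ℝ, 0 ≤ c ∧ ∀ ω, ‖(noiseCentroid H μ Z n).1 ω‖ ≤ c := by
  induction n with
  | zero => exact ⟨0, le_rfl, fun ω => by simp [noiseCentroid]⟩
  | succ n ih =>
    obtain ⟨c, hc0, hc⟩ := ih
    refine ⟨c + μ * (L * c + Real.sqrt C), by positivity, fun ω => ?_⟩
    have h1 : (noiseCentroid H μ Z (n + 1)).1 ω = (noiseCentroid H μ Z n).1 ω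
      - μ • avgOp (blockDiag H ((noiseCentroid H μ Z n).1 ω) + (Z n).1 ω) := rfl
    rw [h1]
    refine (norm_sub_le _ _).trans ?_
    rw [norm_smul, Real.norm_of_nonneg hμ]
    gcongr
    · exact hc ω
    · refine (norm_avgOp_le _).trans ((norm_add_le _ _).trans ?_)
      refine add_le_add ((norm_blockDiag_le hL hH _).trans ?_)
        (Real.le_sqrt_of_sq_le (h.bound_noise n ω))
      gcongr
      exact hc ω

lemma integrable_of_bound {f : Ω → ℝ} (hf : Measurable f) {c : ℝ} (hc : ∀ ω, |f ω| ≤ c) :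
    Integrable f P :=
  Integrable.of_bound hf.aestronglyMeasurable c (ae_of_all _ hc)

/-- In the expansion of the fourth power the term linear in the noise vanishes in expectation, the
quadratic one is controlled by the weighted variance bound, and the quartic one by the pointwise
bound on the noise. -/
lemma fourth_moment_step_le (h : IsIteration w₀ I A D H b L C B μ W Z R Φ)
    (hS : IsSampling P w₀ I) (k₀ : Fin K)
    (hH : ∀ k, ‖H k‖ ≤ L) (hL : 0 ≤ L) (hC : 0 ≤ C) (hμ : 0 ≤ μ) (n : ℕ) :
    ∫ ω, ‖(noiseCentroid H μ Z (n + 1)).1 ω‖ ^ 4 ∂P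
      ≤ (1 + μ * L) ^ 4 * ∫ ω, ‖(noiseCentroid H μ Z n).1 ω‖ ^ 4 ∂P
        + 8 * μ ^ 2 * (C / B * ((1 + μ * L) ^ 2 * ‖noiseCentroid H μ Z n‖ ^ 2))
        + 3 * μ ^ 4 * (C * (C / B)) := by
  set z := noiseCentroid H μ Z n with hz
  set x := z - μ • map avgOp (map (blockDiag H) z) with hx
  have hzp : IsPast w₀ I n z.1 := h.isPast_noiseCentroid n
  have hxp : IsPast w₀ I n x.1 := hzp.sqSub (((hzp.sqMap _).sqMap _).sqSmul _)
  have hxm : Measurable x.1 := hxp.measurable hS k₀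
  have hzm : Measurable z.1 := hzp.measurable hS k₀
  have hZm : Measurable (Z n).1 := (h.past_noise n).measurable hS k₀
  obtain ⟨c, hc0, hc⟩ := h.exists_bound_noiseCentroid hH hL hμ n
  have hpt : ∀ ω, (noiseCentroid H μ Z (n + 1)).1 ω = x.1 ω - μ • avgOp ((Z n).1 ω) := by
    intro ω
    have h1 : noiseCentroid H μ Z (n + 1) = x - μ • map avgOp (Z n) := by
      rw [noiseCentroid, ← hz, hx, map_add, smul_add]; abel
    rw [h1]; rfl
  have hxz : ∀ ω, ‖x.1 ω‖ ≤ (1 + μ * L) * ‖z.1 ω‖ := by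
    intro ω
    have h1 : x.1 ω = z.1 ω - μ • avgOp (blockDiag H (z.1 ω)) := rfl
    rw [h1]
    calc _ ≤ ‖z.1 ω‖ + ‖μ • avgOp (blockDiag H (z.1 ω))‖ := norm_sub_le _ _
      _ ≤ ‖z.1 ω‖ + μ * (L * ‖z.1 ω‖) := by
        rw [norm_smul, Real.norm_of_nonneg hμ]
        gcongr
        exact (norm_avgOp_le _).trans (norm_blockDiag_le hL hH _)
      _ = _ := by ring
  set c' := (1 + μ * L) * c with hc'
  have hc'0 : 0 ≤ c' := by positivity
  have hxc : ∀ ω, ‖x.1 ω‖ ≤ c' := fun ω => (hxz ω).trans (by rw [hc']; gcongr; exact hc ω)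
  have hζ : ∀ ω, ‖avgOp ((Z n).1 ω)‖ ≤ ‖(Z n).1 ω‖ := fun ω => norm_avgOp_le _
  have hCs : ∀ ω, ‖(Z n).1 ω‖ ≤ Real.sqrt C := fun ω => Real.le_sqrt_of_sq_le (h.bound_noise n ω)
  -- The vector ‖x‖² x is bounded and determined by the past, hence an admissible test vector
  -- against the noise.
  have hv_meas : Measurable fun ω => ‖x.1 ω‖ ^ 2 • x.1 ω := (hxm.norm.pow_const 2).smul hxm
  have hv_mem : MemLp (fun ω => ‖x.1 ω‖ ^ 2 • x.1 ω) 2 P := by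
    refine MemLp.of_bound hv_meas.aestronglyMeasurable (c' ^ 2 * c') (ae_of_all _ fun ω => ?_)
    rw [norm_smul, norm_pow, norm_norm]
    have := hxc ω
    gcongr
  have hvp : IsPast w₀ I n (fun ω => ‖x.1 ω‖ ^ 2 • x.1 ω) :=
    hxp.comp (φ := fun v : NetState K M => ‖v‖ ^ 2 • v) (by fun_prop)
  have horth : ∫ ω, ‖x.1 ω‖ ^ 2 * inner ℝ (x.1 ω) (avgOp ((Z n).1 ω)) ∂P = 0 := by
    have h1 := h.inner_noise n (map avgOp ⟨_, hv_mem⟩) (IsPast.sqMap (f := ⟨_, hv_mem⟩) hvp _)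
    rw [inner_map_left inner_avgOp_left, inner_def] at h1
    rw [← h1]
    refine integral_congr_ae (ae_of_all _ fun ω => ?_)
    simp [real_inner_smul_left]
  have hw : ∫ ω, ‖x.1 ω‖ ^ 2 * ‖avgOp ((Z n).1 ω)‖ ^ 2 ∂P
      ≤ C / B * ((1 + μ * L) ^ 2 * ‖z‖ ^ 2) := by
    calc _ ≤ ∫ ω, ‖x.1 ω‖ ^ 2 * ‖(Z n).1 ω‖ ^ 2 ∂P := by
          refine integral_mono ?_ ?_ fun ω => ?_
          · refine integrable_of_bound (c := c' ^ 2 * (Real.sqrt C) ^ 2) (by fun_prop) fun ω => ?_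
            rw [abs_of_nonneg (by positivity)]
            have := hxc ω
            have := (hζ ω).trans (hCs ω)
            gcongr
          · refine integrable_of_bound (c := c' ^ 2 * (Real.sqrt C) ^ 2) (by fun_prop) fun ω => ?_
            rw [abs_of_nonneg (by positivity)]
            have := hxc ω
            have := hCs ω
            gcongr
          · have := hζ ω
            simp only
            gcongr
      _ ≤ C / B * ‖x‖ ^ 2 := h.weighted_noise n x hxp
      _ ≤ C / B * ((1 + μ * L) * ‖z‖) ^ 2 := by
          gcongr
          exact norm_le_mul_norm (by positivity) hxz
      _ = _ := by rw [mul_pow]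
  have h4 : ∫ ω, ‖avgOp ((Z n).1 ω)‖ ^ 4 ∂P ≤ C * (C / B) := by
    calc _ ≤ ∫ ω, C * ‖(Z n).1 ω‖ ^ 2 ∂P := by
          refine integral_mono ?_ ((integrable_norm_sq (Z n)).const_mul _) fun ω => ?_
          · refine integrable_of_bound (c := (Real.sqrt C) ^ 4) (by fun_prop) fun ω => ?_
            rw [abs_of_nonneg (by positivity)]
            have := (hζ ω).trans (hCs ω)
            gcongr
          · calc ‖avgOp ((Z n).1 ω)‖ ^ 4 ≤ ‖(Z n).1 ω‖ ^ 4 := by have := hζ ω; gcongr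
              _ = ‖(Z n).1 ω‖ ^ 2 * ‖(Z n).1 ω‖ ^ 2 := by ring
              _ ≤ C * ‖(Z n).1 ω‖ ^ 2 := by gcongr; exact h.bound_noise n ω
      _ = C * ‖Z n‖ ^ 2 := by rw [integral_const_mul, norm_sq]
      _ ≤ _ := by gcongr; exact h.norm_sq_noise_le n
  have hx4 : ∫ ω, ‖x.1 ω‖ ^ 4 ∂P ≤ (1 + μ * L) ^ 4 * ∫ ω, ‖z.1 ω‖ ^ 4 ∂P := by
    rw [← integral_const_mul]
    refine integral_mono ?_ ?_ fun ω => ?_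
    · refine integrable_of_bound (c := c' ^ 4) (by fun_prop) fun ω => ?_
      rw [abs_of_nonneg (by positivity)]
      have := hxc ω
      gcongr
    · refine Integrable.const_mul (integrable_of_bound (c := c ^ 4) (by fun_prop) fun ω => ?_) _
      rw [abs_of_nonneg (by positivity)]
      have := hc ω
      gcongr
    · simp only
      rw [← mul_pow]
      have := hxz ω
      gcongr
  have i1 : Integrable (fun ω => ‖x.1 ω‖ ^ 4) P := by
    refine integrable_of_bound (c := c' ^ 4) (by fun_prop) fun ω => ?_
    rw [abs_of_nonneg (by positivity)]
    have := hxc ω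
    gcongr
  have i2 : Integrable (fun ω => ‖x.1 ω‖ ^ 2 * inner ℝ (x.1 ω) (avgOp ((Z n).1 ω))) P := by
    refine integrable_of_bound (c := c' ^ 2 * (c' * Real.sqrt C)) (by fun_prop) fun ω => ?_
    rw [abs_mul, abs_of_nonneg (sq_nonneg ‖x.1 ω‖)]
    have h1 := hxc ω
    have h2 := abs_real_inner_le_norm (x.1 ω) (avgOp ((Z n).1 ω))
    have h3 := (hζ ω).trans (hCs ω)
    have h5 : |inner ℝ (x.1 ω) (avgOp ((Z n).1 ω))| ≤ c' * Real.sqrt C := h2.trans (by gcongr)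
    gcongr
  have i3 : Integrable (fun ω => ‖x.1 ω‖ ^ 2 * ‖avgOp ((Z n).1 ω)‖ ^ 2) P := by
    refine integrable_of_bound (c := c' ^ 2 * (Real.sqrt C) ^ 2) (by fun_prop) fun ω => ?_
    rw [abs_of_nonneg (by positivity)]
    have := hxc ω
    have := (hζ ω).trans (hCs ω)
    gcongr
  have i4 : Integrable (fun ω => ‖avgOp ((Z n).1 ω)‖ ^ 4) P := by
    refine integrable_of_bound (c := (Real.sqrt C) ^ 4) (by fun_prop) fun ω => ?_
    rw [abs_of_nonneg (by positivity)]
    have := (hζ ω).trans (hCs ω)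
    gcongr
  have hmain : ∫ ω, ‖(noiseCentroid H μ Z (n + 1)).1 ω‖ ^ 4 ∂P
      ≤ ∫ ω, (‖x.1 ω‖ ^ 4 - 4 * μ * (‖x.1 ω‖ ^ 2 * inner ℝ (x.1 ω) (avgOp ((Z n).1 ω)))
        + 8 * μ ^ 2 * (‖x.1 ω‖ ^ 2 * ‖avgOp ((Z n).1 ω)‖ ^ 2)
        + 3 * μ ^ 4 * ‖avgOp ((Z n).1 ω)‖ ^ 4) ∂P := by
    refine integral_mono_of_nonneg (ae_of_all _ fun ω => by positivity)
      (((i1.sub (i2.const_mul _)).add (i3.const_mul _)).add (i4.const_mul _))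
      (ae_of_all _ fun ω => ?_)
    simp only [hpt ω]
    exact norm_sub_smul_pow_four_le _ _ hμ
  have j1 : Integrable (fun ω => ‖x.1 ω‖ ^ 4
      - 4 * μ * (‖x.1 ω‖ ^ 2 * inner ℝ (x.1 ω) (avgOp ((Z n).1 ω)))) P := i1.sub (i2.const_mul _)
  have j2 : Integrable (fun ω => ‖x.1 ω‖ ^ 4
      - 4 * μ * (‖x.1 ω‖ ^ 2 * inner ℝ (x.1 ω) (avgOp ((Z n).1 ω)))
      + 8 * μ ^ 2 * (‖x.1 ω‖ ^ 2 * ‖avgOp ((Z n).1 ω)‖ ^ 2)) P := j1.add (i3.const_mul _)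
  rw [integral_add j2 (i4.const_mul _), integral_add j1 (i3.const_mul _),
    integral_sub i1 (i2.const_mul _), integral_const_mul, integral_const_mul,
    integral_const_mul, horth, mul_zero, sub_zero] at hmain
  have e1 : 8 * μ ^ 2 * ∫ ω, ‖x.1 ω‖ ^ 2 * ‖avgOp ((Z n).1 ω)‖ ^ 2 ∂P
      ≤ 8 * μ ^ 2 * (C / B * ((1 + μ * L) ^ 2 * ‖z‖ ^ 2)) := by gcongr
  have e2 : 3 * μ ^ 4 * ∫ ω, ‖avgOp ((Z n).1 ω)‖ ^ 4 ∂P ≤ 3 * μ ^ 4 * (C * (C / B)) := by gcongr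
  linarith

/-- Factor in the bound on the fourth moment of `noiseCentroid`. -/
noncomputable def fourthConst (L C T : ℝ) : ℝ :=
  Real.exp (((1 + L) ^ 4 - 1) * T) *
    (T * (8 * (C * ((1 + L) ^ 2 * (Real.exp ((2 * L + L ^ 2) * T) * (T * C)))) + 3 * C ^ 2))

/-- The second moment O(μ/B) enters the step with a factor μ²/B, so T/μ steps accumulate to O(μ²/B).
The gain of a factor μ over θ makes the tail negligible. -/
lemma fourth_moment_le (h : IsIteration w₀ I A D H b L C B μ W Z R Φ)
    (hS : IsSampling P w₀ I) (k₀ : Fin K) (hB : 1 ≤ B)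
    (hH : ∀ k, ‖H k‖ ≤ L) (hL : 0 ≤ L) (hC : 0 ≤ C) (hμ : 0 ≤ μ) (hμ1 : μ ≤ 1) {T : ℝ} {n : ℕ}
    (hn : n * μ ≤ T) :
    ∫ ω, ‖(noiseCentroid H μ Z n).1 ω‖ ^ 4 ∂P
      ≤ fourthConst L C T * (μ * (μ ^ 2 + μ / B)) := by
  have hT : 0 ≤ T := le_trans (by positivity) hn
  have hB1 : (1 : ℝ) ≤ B := by exact_mod_cast hB
  set E := Real.exp ((2 * L + L ^ 2) * T) with hE
  set G := 8 * (C * ((1 + L) ^ 2 * (E * (T * C)))) + 3 * C ^ 2 with hG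
  have hG0 : 0 ≤ G := by positivity
  have ha0 : 0 ≤ (1 + L) ^ 4 - 1 := by
    have : (1 : ℝ) ≤ (1 + L) ^ 4 := one_le_pow₀ (by linarith)
    linarith
  have hpow : (1 + μ * L) ^ 4 ≤ 1 + μ * ((1 + L) ^ 4 - 1) := by
    have h2 : μ ^ 2 ≤ μ := by nlinarith
    have h3 : μ ^ 3 ≤ μ := by nlinarith
    have h4 : μ ^ 4 ≤ μ := by nlinarith
    have e2 : μ ^ 2 * L ^ 2 ≤ μ * L ^ 2 := by gcongr
    have e3 : μ ^ 3 * L ^ 3 ≤ μ * L ^ 3 := by gcongr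
    have e4 : μ ^ 4 * L ^ 4 ≤ μ * L ^ 4 := by gcongr
    nlinarith
  -- One of the two factors 1/B is discarded.
  have hBinv : (μ / B) / B ≤ μ / B := div_le_self (by positivity) hB1
  have hstep : ∀ j < n, ∫ ω, ‖(noiseCentroid H μ Z (j + 1)).1 ω‖ ^ 4 ∂P
      ≤ (1 + μ * ((1 + L) ^ 4 - 1)) * ∫ ω, ‖(noiseCentroid H μ Z j).1 ω‖ ^ 4 ∂P
        + μ * (G * (μ * (μ / B))) := by
    intro j hj
    have hjT : j * μ ≤ T := le_trans (by gcongr) hn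
    have h1 := h.fourth_moment_step_le hS k₀ hH hL hC hμ j
    have h2 := h.norm_sq_noiseCentroid_le hH hL hC hμ hμ1 hjT
    have h3 : 0 ≤ ∫ ω, ‖(noiseCentroid H μ Z j).1 ω‖ ^ 4 ∂P :=
      integral_nonneg fun ω => by positivity
    have h4 : 8 * μ ^ 2 * (C / B * ((1 + μ * L) ^ 2 * ‖noiseCentroid H μ Z j‖ ^ 2))
        ≤ μ * (8 * (C * ((1 + L) ^ 2 * (E * (T * C)))) * (μ * (μ / B))) := by
      have h5 : (1 + μ * L) ^ 2 ≤ (1 + L) ^ 2 := by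
        gcongr
        exact mul_le_of_le_one_left hL hμ1
      calc _ ≤ 8 * μ ^ 2 * (C / B * ((1 + L) ^ 2 * (E * (T * (C * (μ / B)))))) := by gcongr
        _ = μ * (8 * (C * ((1 + L) ^ 2 * (E * (T * C)))) * (μ * ((μ / B) / B))) := by ring
        _ ≤ _ := by gcongr
    have h6 : 3 * μ ^ 4 * (C * (C / B)) ≤ μ * (3 * C ^ 2 * (μ * (μ / B))) := by
      have h7 : μ ^ 4 ≤ μ ^ 3 := by
        have : 0 ≤ μ ^ 3 := by positivity
        nlinarith
      calc _ ≤ 3 * μ ^ 3 * (C * (C / B)) := by gcongr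
        _ = _ := by ring
    have h8 := mul_le_mul_of_nonneg_right hpow h3
    calc _ ≤ _ := h1
      _ ≤ (1 + μ * ((1 + L) ^ 4 - 1)) * ∫ ω, ‖(noiseCentroid H μ Z j).1 ω‖ ^ 4 ∂P
        + μ * (8 * (C * ((1 + L) ^ 2 * (E * (T * C)))) * (μ * (μ / B)))
        + μ * (3 * C ^ 2 * (μ * (μ / B))) := add_le_add (add_le_add h8 h4) h6
      _ = _ := by rw [hG]; ring
  have hg := le_exp_mul_of_step_le (x := fun j => ∫ ω, ‖(noiseCentroid H μ Z j).1 ω‖ ^ 4 ∂P)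
    (a := (1 + L) ^ 4 - 1) (β := G * (μ * (μ / B))) (N := n) (by positivity) hμ ha0
    (integral_nonneg fun ω => by positivity) hstep n le_rfl
  have h0 : ∫ ω, ‖(noiseCentroid H μ Z 0).1 ω‖ ^ 4 ∂P = 0 := by simp [noiseCentroid]
  refine hg.trans ?_
  simp only [h0, zero_add]
  have h9 : μ / B ≤ μ ^ 2 + μ / B := by have := sq_nonneg μ; linarith
  have h10 : fourthConst L C T * (μ * (μ ^ 2 + μ / B))
      = Real.exp (((1 + L) ^ 4 - 1) * T) * (T * (G * (μ * (μ ^ 2 + μ / B)))) := by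
    rw [fourthConst, ← hE, ← hG]; ring
  rw [h10]
  gcongr

end IsIteration

end NoiseCentroid

/-! ### Negligibility of the nonlinear remainder and of the errors -/

section RiskExpansion

open SqInt

variable {Ω : Type*} [mΩ : MeasurableSpace Ω] {P : Measure Ω} [IsProbabilityMeasure P]
  {K M : ℕ} {N : Fin K → ℕ} {β : Type*} [MeasurableSpace β]
  {w₀ : Ω → β} {I : ∀ k : Fin K, ℕ → ℕ → Ω → Fin (N k)}

/-- The norm of a vector outside of a ball, and zero inside. -/
noncomputable def tail {E : Type*} [NormedAddCommGroup E] (ρ : ℝ) (w : E) : ℝ :=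
  if ‖w‖ ≤ ρ then 0 else ‖w‖

/-- Outside the ball `c` takes up at most a quarter of ‖w‖. If `y` dominates `z`, then ‖w‖ ≤ 3‖y‖.
Otherwise ‖z‖ ≥ 3ρ/8, and this lower bound trades ‖w‖ ≤ 3‖z‖ for a multiple of ‖z‖², hence its
square for ‖z‖⁴. -/
lemma tail_sq_le {E : Type*} [NormedAddCommGroup E] {ρ : ℝ} (hρ : 0 < ρ) {w z c y : E}
    (hw : w = z + c + y) (hc : ‖c‖ ≤ ρ / 4) :
    tail ρ w ^ 2 ≤ 18 * ‖y‖ ^ 2 + 128 / ρ ^ 2 * ‖z‖ ^ 4 := by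
  unfold tail
  split_ifs with h
  · rw [zero_pow two_ne_zero]; positivity
  push Not at h
  have h1 : ‖w‖ ≤ ‖z‖ + ‖c‖ + ‖y‖ := by rw [hw]; exact norm_add₃_le
  have h2 : ‖w‖ ≤ 3 * ‖y‖ + 8 / ρ * ‖z‖ ^ 2 := by
    rcases le_total ‖z‖ ‖y‖ with hzy | hzy
    · have : 0 ≤ 8 / ρ * ‖z‖ ^ 2 := by positivity
      linarith
    · have h3 : 3 * ρ / 8 ≤ ‖z‖ := by linarith
      have h4 : 3 * ‖z‖ ≤ 8 / ρ * ‖z‖ ^ 2 := by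
        rw [div_mul_eq_mul_div, le_div_iff₀ hρ]
        nlinarith [norm_nonneg z]
      have := norm_nonneg y
      linarith
  calc ‖w‖ ^ 2 ≤ (3 * ‖y‖ + 8 / ρ * ‖z‖ ^ 2) ^ 2 := pow_le_pow_left₀ (norm_nonneg _) h2 2
    _ ≤ 2 * (3 * ‖y‖) ^ 2 + 2 * (8 / ρ * ‖z‖ ^ 2) ^ 2 := by
        nlinarith [sq_nonneg (3 * ‖y‖ - 8 / ρ * ‖z‖ ^ 2)]
    _ = _ := by ring

namespace IsIteration

variable {A D : Matrix (Fin K) (Fin K) ℝ} {H : Fin K → Vec M →L[ℝ] Vec M} {b : NetState K M}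
  {L C : ℝ} {B : ℕ} {μ : ℝ} {W Z R Φ : ℕ → SqInt P (NetState K M)}

/-- Error of the centroid relative to bias and noise. -/
noncomputable def centErr (A D : Matrix (Fin K) (Fin K) ℝ) (H : Fin K → Vec M →L[ℝ] Vec M)
    (b : NetState K M) (μ : ℝ) (W Z : ℕ → SqInt P (NetState K M)) (n : ℕ) :
    SqInt P (NetState K M) :=
  map avgOp (W n) - noiseCentroid H μ Z n - const P (biasCentroid A D H μ b n)

/-- The splitting into noise, bias and errors on which the comparison rests. -/
lemma eq_add_errors (n : ℕ) :
    W n = noiseCentroid H μ Z n + const P (biasCentroid A D H μ b n + biasDev A D μ b n)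
      + (centErr A D H b μ W Z n + devErr A D b μ W n) := by
  rw [centErr, devErr, map_add]; abel

lemma tail_sq_iterate_le {ρ : ℝ} (hρ : 0 < ρ) {n : ℕ}
    (hc : ‖biasCentroid A D H μ b n + biasDev A D μ b n‖ ≤ ρ / 4) (ω : Ω) :
    tail ρ ((W n).1 ω) ^ 2 ≤ 18 * ‖(centErr A D H b μ W Z n + devErr A D b μ W n).1 ω‖ ^ 2
      + 128 / ρ ^ 2 * ‖(noiseCentroid H μ Z n).1 ω‖ ^ 4 := by
  refine tail_sq_le hρ (c := biasCentroid A D H μ b n + biasDev A D μ b n) ?_ hc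
  exact congrArg (fun f : SqInt P (NetState K M) => f.1 ω) (eq_add_errors n)

lemma integrable_noiseCentroid_pow_four (h : IsIteration w₀ I A D H b L C B μ W Z R Φ)
    (hS : IsSampling P w₀ I) (k₀ : Fin K) (hH : ∀ k, ‖H k‖ ≤ L) (hL : 0 ≤ L) (hμ : 0 ≤ μ) (n : ℕ) :
    Integrable (fun ω => ‖(noiseCentroid H μ Z n).1 ω‖ ^ 4) P := by
  obtain ⟨c, hc0, hc⟩ := h.exists_bound_noiseCentroid hH hL hμ n
  have hm : Measurable (noiseCentroid H μ Z n).1 := (h.isPast_noiseCentroid n).measurable hS k₀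
  refine integrable_of_bound (c := c ^ 4) (by fun_prop) fun ω => ?_
  rw [abs_of_nonneg (by positivity)]
  have := hc ω
  gcongr

lemma norm_add_sq_le_two {E : Type*} [SeminormedAddCommGroup E] (x y : E) :
    ‖x + y‖ ^ 2 ≤ 2 * (‖x‖ ^ 2 + ‖y‖ ^ 2) := by
  have h1 := pow_le_pow_left₀ (norm_nonneg _) (norm_add_le x y) 2
  nlinarith [sq_nonneg (‖x‖ - ‖y‖)]

/-- Serves twice: for the remainder of the gradients and for the remainder of the risk. -/
lemma integral_tail_bound_le (h : IsIteration w₀ I A D H b L C B μ W Z R Φ)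
    (hS : IsSampling P w₀ I) (k₀ : Fin K) (hH : ∀ k, ‖H k‖ ≤ L) (hL : 0 ≤ L) (hμ : 0 ≤ μ)
    {ρ : ℝ} (hρ : 0 < ρ) {n : ℕ}
    (hc : ‖biasCentroid A D H μ b n + biasDev A D μ b n‖ ≤ ρ / 4) {φ : Ω → ℝ} {a e : ℝ}
    (he : 0 ≤ e) (hφ0 : ∀ ω, 0 ≤ φ ω)
    (hφ : ∀ ω, φ ω ≤ a * ‖(W n).1 ω‖ ^ 2 + e * tail ρ ((W n).1 ω) ^ 2) :
    ∫ ω, φ ω ∂P ≤ a * ‖W n‖ ^ 2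
      + e * (36 * (‖centErr A D H b μ W Z n‖ ^ 2 + ‖devErr A D b μ W n‖ ^ 2)
      + 128 / ρ ^ 2 * ∫ ω, ‖(noiseCentroid H μ Z n).1 ω‖ ^ 4 ∂P) := by
  set y := centErr A D H b μ W Z n + devErr A D b μ W n with hy
  have i1 := (integrable_norm_sq (W n)).const_mul a
  have i2 := (integrable_norm_sq y).const_mul 18
  have i3 := (h.integrable_noiseCentroid_pow_four hS k₀ hH hL hμ n).const_mul (128 / ρ ^ 2)
  have i4 : Integrable (fun ω => 18 * ‖y.1 ω‖ ^ 2
      + 128 / ρ ^ 2 * ‖(noiseCentroid H μ Z n).1 ω‖ ^ 4) P := i2.add i3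
  have h1 : ∫ ω, φ ω ∂P ≤ ∫ ω, (a * ‖(W n).1 ω‖ ^ 2 + e * (18 * ‖y.1 ω‖ ^ 2
      + 128 / ρ ^ 2 * ‖(noiseCentroid H μ Z n).1 ω‖ ^ 4)) ∂P := by
    refine integral_mono_of_nonneg (ae_of_all _ hφ0) (i1.add (i4.const_mul e))
      (ae_of_all _ fun ω => (hφ ω).trans ?_)
    have := tail_sq_iterate_le (W := W) (Z := Z) hρ hc ω
    simp only
    gcongr
  rw [integral_add i1 (i4.const_mul e), integral_const_mul, integral_const_mul,
    integral_add i2 i3, integral_const_mul, integral_const_mul, ← norm_sq, ← norm_sq] at h1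
  have h2 : ‖y‖ ^ 2 ≤ 2 * (‖centErr A D H b μ W Z n‖ ^ 2 + ‖devErr A D b μ W n‖ ^ 2) :=
    norm_add_sq_le_two _ _
  exact h1.trans (add_le_add le_rfl
    (mul_le_mul_of_nonneg_left (add_le_add (by linarith) le_rfl) he))

/-- The remainder of the mean gradient is of second order near the minimizer. -/
lemma norm_sq_rem_le (h : IsIteration w₀ I A D H b L C B μ W Z R Φ)
    (hS : IsSampling P w₀ I) (k₀ : Fin K) (hH : ∀ k, ‖H k‖ ≤ L) (hL : 0 ≤ L) (hμ : 0 ≤ μ)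
    {ρ δ : ℝ} (hρ : 0 < ρ) {n : ℕ}
    (hc : ‖biasCentroid A D H μ b n + biasDev A D μ b n‖ ≤ ρ / 4)
    (hR : ∀ ω, ‖(R n).1 ω‖ ≤ δ * ‖(W n).1 ω‖ + 2 * L * tail ρ ((W n).1 ω)) :
    ‖R n‖ ^ 2 ≤ 2 * δ ^ 2 * ‖W n‖ ^ 2
      + 8 * L ^ 2 * (36 * (‖centErr A D H b μ W Z n‖ ^ 2 + ‖devErr A D b μ W n‖ ^ 2)
      + 128 / ρ ^ 2 * ∫ ω, ‖(noiseCentroid H μ Z n).1 ω‖ ^ 4 ∂P) := by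
  rw [norm_sq (R n)]
  refine h.integral_tail_bound_le hS k₀ hH hL hμ hρ hc (by positivity)
    (fun ω => by positivity) fun ω => ?_
  have h1 := pow_le_pow_left₀ (norm_nonneg _) (hR ω) 2
  nlinarith [sq_nonneg (δ * ‖(W n).1 ω‖ - 2 * L * tail ρ ((W n).1 ω))]

lemma isPast_devErr (h : IsIteration w₀ I A D H b L C B μ W Z R Φ) (n : ℕ) :
    IsPast w₀ I n (devErr A D b μ W n).1 :=
  ((h.past n).sqSub ((h.past n).sqMap _)).sqSub (IsPast.sqConst _)

lemma isPast_centErr (h : IsIteration w₀ I A D H b L C B μ W Z R Φ) (n : ℕ) :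
    IsPast w₀ I n (centErr A D H b μ W Z n).1 :=
  (((h.past n).sqMap _).sqSub (h.isPast_noiseCentroid n)).sqSub (IsPast.sqConst _)

/-- Averaging erases `A`, `D` and `b`; the linear effects of noise centroid and bias cancel against
their own recursions. What drives the error is the errors themselves, `R` and `Φ`. -/
lemma centErr_succ (h : IsIteration w₀ I A D H b L C B μ W Z R Φ)
    (hA : A ∈ doublyStochastic ℝ (Fin K)) (hD : D ∈ doublyStochastic ℝ (Fin K))
    (hb : avgOp b = 0) (n : ℕ) :
    centErr A D H b μ W Z (n + 1) = centErr A D H b μ W Z n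
      - μ • map avgOp (map (blockDiag H) (centErr A D H b μ W Z n + devErr A D b μ W n) + R n)
      - μ • map avgOp (Φ n) := by
  have e1 : map (blockDiag H) (W n) = map (blockDiag H) (noiseCentroid H μ Z n)
      + const P (blockDiag H (biasCentroid A D H μ b n + biasDev A D μ b n))
      + map (blockDiag H) (centErr A D H b μ W Z n + devErr A D b μ W n) := by
    conv_lhs => rw [eq_add_errors (A := A) (D := D) (H := H) (b := b) (μ := μ) (W := W) (Z := Z) n]
    rw [map_add, map_add, SqInt.map_const]
  have e2 : map avgOp (W (n + 1)) = map avgOp (W n) - μ • (map avgOp (Z n)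
      + (map avgOp (map (blockDiag H) (W n)) + map avgOp (R n) + map avgOp (Φ n))) := by
    rw [h.step n]
    simp only [map_sub, map_smul, map_add, map_avgOp_mix hA, map_avgOp_mix hD, SqInt.map_const,
      avgOp_mix hD, hb, map_zero, zero_add]
  rw [centErr, e2, e1, centErr, noiseCentroid, biasCentroid]
  simp only [map_add, map_sub, map_smul, SqInt.map_const, smul_add]
  abel

/-- The fluctuation is orthogonal to the past and enters only with μ²; the other terms enter with μ
by Young's inequality. -/
lemma norm_sq_centErr_step_le (h : IsIteration w₀ I A D H b L C B μ W Z R Φ)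
    (hA : A ∈ doublyStochastic ℝ (Fin K)) (hD : D ∈ doublyStochastic ℝ (Fin K))
    (hb : avgOp b = 0) (hH : ∀ k, ‖H k‖ ≤ L) (hL : 0 ≤ L) (hμ : 0 ≤ μ) (hμ1 : μ ≤ 1) (n : ℕ) :
    ‖centErr A D H b μ W Z (n + 1)‖ ^ 2 ≤ (1 + μ * (1 + 8 * L ^ 2)) * ‖centErr A D H b μ W Z n‖ ^ 2
      + μ * (8 * L ^ 2 * ‖devErr A D b μ W n‖ ^ 2 + 4 * ‖R n‖ ^ 2
        + 4 * L ^ 2 * (μ / B) * ‖W n‖ ^ 2) := by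
  set q := centErr A D H b μ W Z n with hq
  set v := devErr A D b μ W n with hv
  set x := map avgOp (map (blockDiag H) (q + v) + R n) with hx
  have hqp : IsPast w₀ I n q.1 := h.isPast_centErr n
  have hvp : IsPast w₀ I n v.1 := h.isPast_devErr n
  have hxp : IsPast w₀ I n (q - μ • x).1 := hqp.sqSub
    (((((hqp.sqAdd hvp).sqMap _).sqAdd (h.past_rem n)).sqMap _).sqSmul _)
  have horth : inner ℝ (q - μ • x) (map avgOp (Φ n)) = 0 := by
    rw [← inner_map_left inner_avgOp_left]
    exact h.inner_fluct n _ (hxp.sqMap _)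
  have h1 : ‖map avgOp (Φ n)‖ ^ 2 ≤ 4 * L ^ 2 * ‖W n‖ ^ 2 / B :=
    (pow_le_pow_left₀ (norm_nonneg _) (norm_map_avgOp_le (Φ n)) 2).trans (h.norm_sq_fluct_le n)
  have h2 : ‖x‖ ^ 2 ≤ 4 * L ^ 2 * (‖q‖ ^ 2 + ‖v‖ ^ 2) + 2 * ‖R n‖ ^ 2 := by
    have e1 : ‖x‖ ^ 2 ≤ ‖map (blockDiag H) (q + v) + R n‖ ^ 2 :=
      pow_le_pow_left₀ (norm_nonneg _) (norm_map_avgOp_le _) 2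
    have e2 := norm_add_sq_le_two (map (blockDiag H) (q + v)) (R n)
    have e3 : ‖map (blockDiag H) (q + v)‖ ^ 2 ≤ (L * ‖q + v‖) ^ 2 :=
      pow_le_pow_left₀ (norm_nonneg _) (norm_map_blockDiag_le hL hH _) 2
    have e4 : (L * ‖q + v‖) ^ 2 ≤ L ^ 2 * (2 * (‖q‖ ^ 2 + ‖v‖ ^ 2)) := by
      rw [mul_pow]
      gcongr
      exact norm_add_sq_le_two q v
    linarith
  have h3 : ‖q - μ • x‖ ^ 2 ≤ (1 + μ) * ‖q‖ ^ 2 + 2 * μ * ‖x‖ ^ 2 := by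
    have e1 : ‖q - μ • x‖ ≤ ‖q‖ + μ * ‖x‖ := by
      refine (norm_sub_le _ _).trans ?_
      rw [norm_smul, Real.norm_of_nonneg hμ]
    have e2 := pow_le_pow_left₀ (norm_nonneg _) e1 2
    have e3 : μ ^ 2 * ‖x‖ ^ 2 ≤ μ * ‖x‖ ^ 2 := by
      have : μ ^ 2 ≤ μ := by nlinarith
      gcongr
    have e4 : μ * (2 * (‖q‖ * ‖x‖)) ≤ μ * (‖q‖ ^ 2 + ‖x‖ ^ 2) := by
      gcongr
      have := two_mul_le_add_sq ‖q‖ ‖x‖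
      linarith
    calc _ ≤ _ := e2
      _ = ‖q‖ ^ 2 + μ * (2 * (‖q‖ * ‖x‖)) + μ ^ 2 * ‖x‖ ^ 2 := by ring
      _ ≤ ‖q‖ ^ 2 + μ * (‖q‖ ^ 2 + ‖x‖ ^ 2) + μ * ‖x‖ ^ 2 := by linarith
      _ = _ := by ring
  have h4 : ‖centErr A D H b μ W Z (n + 1)‖ ^ 2
      = ‖q - μ • x‖ ^ 2 + μ ^ 2 * ‖map avgOp (Φ n)‖ ^ 2 := by
    rw [h.centErr_succ hA hD hb, ← hq, ← hv, ← hx, norm_sub_sq_real, inner_smul_right_real, horth,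
      norm_smul, Real.norm_of_nonneg hμ]
    ring
  have h5 : 2 * μ * ‖x‖ ^ 2 ≤ 2 * μ * (4 * L ^ 2 * (‖q‖ ^ 2 + ‖v‖ ^ 2) + 2 * ‖R n‖ ^ 2) := by
    gcongr
  have h6 : μ ^ 2 * ‖map avgOp (Φ n)‖ ^ 2 ≤ μ ^ 2 * (4 * L ^ 2 * ‖W n‖ ^ 2 / B) := by gcongr
  rw [h4]
  calc _ ≤ (1 + μ) * ‖q‖ ^ 2 + 2 * μ * (4 * L ^ 2 * (‖q‖ ^ 2 + ‖v‖ ^ 2) + 2 * ‖R n‖ ^ 2)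
        + μ ^ 2 * (4 * L ^ 2 * ‖W n‖ ^ 2 / B) := by linarith
    _ = _ := by ring

/-- Factor in the bound on the second moment of the iterates. -/
noncomputable def secondConst (L C c T : ℝ) : ℝ :=
  2 * (Real.exp ((3 * L + 4 * L ^ 2) * T) * (1 + T * ((L + 4 * L ^ 2) * c ^ 2 + 2 * C)))
    + 2 * c ^ 2

/-- Factor in the bound on the error of the deviation from the centroid. -/
noncomputable def devConst (L C c r T : ℝ) : ℝ :=
  8 + 16 * (C + L ^ 2 * secondConst L C c T) / (1 - r) ^ 2

/-- Factor in the bound on the driving term of the error of the centroid. -/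
noncomputable def driveConst (L C c r T : ℝ) : ℝ :=
  1160 * L ^ 2 * devConst L C c r T + 8 * secondConst L C c T
    + 4096 * L ^ 2 * fourthConst L C T + 4 * L ^ 2 * secondConst L C c T

/-- Factor in the bound on the errors of centroid and deviation. -/
noncomputable def errConst (L C c r T : ℝ) : ℝ :=
  Real.exp ((1 + 1160 * L ^ 2) * T) * (1 + T * driveConst L C c r T) + devConst L C c r T

lemma secondConst_nonneg {L C c T : ℝ} (hL : 0 ≤ L) (hC : 0 ≤ C) (hT : 0 ≤ T) :
    0 ≤ secondConst L C c T := by unfold secondConst; positivity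

lemma fourthConst_nonneg {L C T : ℝ} (hC : 0 ≤ C) (hT : 0 ≤ T) :
    0 ≤ fourthConst L C T := by unfold fourthConst; positivity

lemma devConst_nonneg {L C c r T : ℝ} (hL : 0 ≤ L) (hC : 0 ≤ C) (hT : 0 ≤ T) :
    0 ≤ devConst L C c r T := by
  have := secondConst_nonneg (c := c) hL hC hT
  unfold devConst; positivity

lemma driveConst_nonneg {L C c r T : ℝ} (hL : 0 ≤ L) (hC : 0 ≤ C) (hT : 0 ≤ T) :
    0 ≤ driveConst L C c r T := by
  have := secondConst_nonneg (c := c) hL hC hT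
  have := devConst_nonneg (c := c) (r := r) hL hC hT
  have := fourthConst_nonneg (L := L) hC hT
  unfold driveConst; positivity

lemma errConst_nonneg {L C c r T : ℝ} (hL : 0 ≤ L) (hC : 0 ≤ C) (hT : 0 ≤ T) :
    0 ≤ errConst L C c r T := by
  have := driveConst_nonneg (c := c) (r := r) hL hC hT
  have := devConst_nonneg (c := c) (r := r) hL hC hT
  unfold errConst; positivity

/-- The geometric bound of `norm_devErr_le`, fed with noise of size √(C/B) and iterates of size
O(√θ). -/
lemma norm_sq_devErr_le (h : IsIteration w₀ I A D H b L C B μ W Z R Φ)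
    (hA : A ∈ doublyStochastic ℝ (Fin K)) (hs : A.IsSymm)
    (hD : D ∈ doublyStochastic ℝ (Fin K)) (hDs : D.IsSymm)
    {r : ℝ} (hr0 : 0 ≤ r) (hr1 : r < 1)
    (hr : ∀ x : Fin K → ℝ, ∑ k, x k = 0 →
      ∑ k, (A.mulVec x k) ^ 2 ≤ r ^ 2 * ∑ l, x l ^ 2) (hb : avgOp b = 0)
    (hL : 0 ≤ L) (hC : 0 ≤ C) (hμ : 0 ≤ μ) (hμ1 : μ ≤ 1)
    {c T : ℝ} (hc : ∀ n, ‖biasDev A D μ b n‖ ≤ c * μ)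
    (hW0 : ‖W 0‖ ^ 2 ≤ μ ^ 2 + μ / B) {n : ℕ} (hn : n * μ ≤ T) :
    ‖devErr A D b μ W n‖ ^ 2
      ≤ devConst L C c r T * (‖W 0‖ ^ 2 + μ * (μ ^ 2 + μ / B)) := by
  have hT : 0 ≤ T := le_trans (by positivity) hn
  have hS0 : 0 ≤ secondConst L C c T := secondConst_nonneg hL hC hT
  have h1r : 0 < 1 - r := by linarith
  set θ := μ ^ 2 + μ / B with hθ
  have hθ0 : 0 ≤ θ := by positivity
  set S := secondConst L C c T with hSdef
  have h1 := h.norm_devErr_le hA hs hD hDs hr0 hr1 hr hb hL hμ (S := Real.sqrt (S * θ))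
    (s := Real.sqrt (C / B)) (n₁ := n)
    (fun j hj => Real.le_sqrt_of_sq_le
      (h.norm_sq_le hA hs hD hDs hL hC hμ hμ1 hc hW0 (le_trans (by gcongr) hn)))
    (fun j => Real.le_sqrt_of_sq_le (h.norm_sq_noise_le j)) n le_rfl
  set s := Real.sqrt (C / B)
  set t := Real.sqrt (S * θ)
  have hs2 : s ^ 2 = C / B := Real.sq_sqrt (by positivity)
  have ht2 : t ^ 2 = S * θ := Real.sq_sqrt (by positivity)
  have h2 := pow_le_pow_left₀ (norm_nonneg _) h1 2
  have h3 : (2 * ‖W 0‖ + 2 * μ * (s + L * t) / (1 - r)) ^ 2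
      ≤ 8 * ‖W 0‖ ^ 2 + 16 * (μ ^ 2 * (s ^ 2 + L ^ 2 * t ^ 2)) / (1 - r) ^ 2 := by
    have e1 : (2 * ‖W 0‖ + 2 * μ * (s + L * t) / (1 - r)) ^ 2
        ≤ 2 * (2 * ‖W 0‖) ^ 2 + 2 * (2 * μ * (s + L * t) / (1 - r)) ^ 2 := by
      nlinarith [sq_nonneg (2 * ‖W 0‖ - 2 * μ * (s + L * t) / (1 - r))]
    have e2 : (2 * μ * (s + L * t) / (1 - r)) ^ 2
        ≤ 8 * (μ ^ 2 * (s ^ 2 + L ^ 2 * t ^ 2)) / (1 - r) ^ 2 := by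
      rw [div_pow]
      gcongr
      nlinarith [mul_nonneg (sq_nonneg μ) (sq_nonneg (s - L * t))]
    have e3 : 16 * (μ ^ 2 * (s ^ 2 + L ^ 2 * t ^ 2)) / (1 - r) ^ 2
        = 2 * (8 * (μ ^ 2 * (s ^ 2 + L ^ 2 * t ^ 2)) / (1 - r) ^ 2) := by ring
    rw [e3]
    linarith
  have h4 : μ ^ 2 * (s ^ 2 + L ^ 2 * t ^ 2) ≤ (C + L ^ 2 * S) * (μ * θ) := by
    rw [hs2, ht2]
    have e1 : μ * (μ / B) ≤ μ * θ := by
      gcongr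
      rw [hθ]; have := sq_nonneg μ; linarith
    have e2 : μ ^ 2 * θ ≤ μ * θ := by
      have : μ ^ 2 ≤ μ := by nlinarith
      gcongr
    calc _ = C * (μ * (μ / B)) + L ^ 2 * S * (μ ^ 2 * θ) := by ring
      _ ≤ C * (μ * θ) + L ^ 2 * S * (μ * θ) := by gcongr
      _ = _ := by ring
  calc _ ≤ 8 * ‖W 0‖ ^ 2 + 16 * (μ ^ 2 * (s ^ 2 + L ^ 2 * t ^ 2)) / (1 - r) ^ 2 := h2.trans h3
    _ ≤ 8 * ‖W 0‖ ^ 2 + 16 * ((C + L ^ 2 * S) * (μ * θ)) / (1 - r) ^ 2 := by gcongr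
    _ = 8 * ‖W 0‖ ^ 2 + 16 * (C + L ^ 2 * S) / (1 - r) ^ 2 * (μ * θ) := by ring
    _ ≤ devConst L C c r T * (‖W 0‖ ^ 2 + μ * θ) := by
        rw [devConst, ← hSdef]
        have e1 : 0 ≤ 8 * (μ * θ) := by positivity
        have e2 : 0 ≤ 16 * (C + L ^ 2 * S) / (1 - r) ^ 2 * ‖W 0‖ ^ 2 := by positivity
        linarith

/-- The bound on ‖R‖² involves the errors themselves, through the tail. This feedback carries the
factor μ in the recursion, so Gronwall absorbs it; all other forcing is bounded by the starting
error, δ²θ, μθ or (μ/ρ²)θ. -/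
lemma errors_le (h : IsIteration w₀ I A D H b L C B μ W Z R Φ)
    (hS : IsSampling P w₀ I) (k₀ : Fin K) (hB : 1 ≤ B)
    (hA : A ∈ doublyStochastic ℝ (Fin K)) (hs : A.IsSymm)
    (hD : D ∈ doublyStochastic ℝ (Fin K)) (hDs : D.IsSymm)
    {r : ℝ} (hr0 : 0 ≤ r) (hr1 : r < 1)
    (hr : ∀ x : Fin K → ℝ, ∑ k, x k = 0 →
      ∑ k, (A.mulVec x k) ^ 2 ≤ r ^ 2 * ∑ l, x l ^ 2) (hb : avgOp b = 0)
    (hH : ∀ k, ‖H k‖ ≤ L) (hL : 0 ≤ L) (hC : 0 ≤ C) (hμ : 0 ≤ μ) (hμ1 : μ ≤ 1)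
    {c T : ℝ} (hc : ∀ n, ‖biasDev A D μ b n‖ ≤ c * μ)
    (hW0 : ‖W 0‖ ^ 2 ≤ μ ^ 2 + μ / B) {ρ δ : ℝ} (hρ : 0 < ρ)
    (hcρ : ∀ n, ‖biasCentroid A D H μ b n + biasDev A D μ b n‖ ≤ ρ / 4)
    (hR : ∀ n ω, ‖(R n).1 ω‖ ≤ δ * ‖(W n).1 ω‖ + 2 * L * tail ρ ((W n).1 ω))
    {n : ℕ} (hn : n * μ ≤ T) :
    ‖centErr A D H b μ W Z n‖ ^ 2 + ‖devErr A D b μ W n‖ ^ 2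
      ≤ errConst L C c r T * (‖W 0‖ ^ 2 + (δ ^ 2 + μ + μ / ρ ^ 2) * (μ ^ 2 + μ / B)) := by
  have hT : 0 ≤ T := le_trans (by positivity) hn
  have hS0 := secondConst_nonneg (c := c) hL hC hT
  have hV0 := devConst_nonneg (c := c) (r := r) hL hC hT
  have hF0 := fourthConst_nonneg (L := L) hC hT
  have hB1 : (1 : ℝ) ≤ B := by exact_mod_cast hB
  set θ := μ ^ 2 + μ / B with hθ
  have hθ0 : 0 ≤ θ := by positivity
  set X := ‖W 0‖ ^ 2 + (δ ^ 2 + μ + μ / ρ ^ 2) * θ with hX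
  have hX0 : 0 ≤ X := by positivity
  have hXW : ‖W 0‖ ^ 2 ≤ X := by
    have : 0 ≤ (δ ^ 2 + μ + μ / ρ ^ 2) * θ := by positivity
    linarith
  have hXμ : ‖W 0‖ ^ 2 + μ * θ ≤ X := by
    have : 0 ≤ (δ ^ 2 + μ / ρ ^ 2) * θ := by positivity
    linarith
  have hXδ : δ ^ 2 * θ ≤ X := by
    have : 0 ≤ ‖W 0‖ ^ 2 + (μ + μ / ρ ^ 2) * θ := by positivity
    linarith
  have hXρ : μ / ρ ^ 2 * θ ≤ X := by
    have : 0 ≤ ‖W 0‖ ^ 2 + (δ ^ 2 + μ) * θ := by positivity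
    linarith
  have hXm : μ * θ ≤ X := by
    have := sq_nonneg ‖W 0‖
    linarith
  set S := secondConst L C c T with hSdef
  set V := devConst L C c r T with hVdef
  set F := fourthConst L C T with hFdef
  have hdev : ∀ j ≤ n, ‖devErr A D b μ W j‖ ^ 2 ≤ V * X := fun j hj =>
    (h.norm_sq_devErr_le hA hs hD hDs hr0 hr1 hr hb hL hC hμ hμ1 hc hW0
      (le_trans (by gcongr) hn)).trans (by gcongr)
  have hstep : ∀ j < n, ‖centErr A D H b μ W Z (j + 1)‖ ^ 2
      ≤ (1 + μ * (1 + 1160 * L ^ 2)) * ‖centErr A D H b μ W Z j‖ ^ 2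
        + μ * (driveConst L C c r T * X) := by
    intro j hj
    have hjT : j * μ ≤ T := le_trans (by gcongr) hn
    have h1 := h.norm_sq_centErr_step_le hA hD hb hH hL hμ hμ1 j
    have h2 := h.norm_sq_rem_le hS k₀ hH hL hμ hρ (hcρ j) (hR j)
    have h3 : ‖W j‖ ^ 2 ≤ S * θ := h.norm_sq_le hA hs hD hDs hL hC hμ hμ1 hc hW0 hjT
    have h4 := h.fourth_moment_le hS k₀ hB hH hL hC hμ hμ1 hjT
    have h5 := hdev j hj.le
    set q2 := ‖centErr A D H b μ W Z j‖ ^ 2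
    set v2 := ‖devErr A D b μ W j‖ ^ 2
    -- The coefficients are 288 = 8 · 36 and 1024 = 8 · 128 from `norm_sq_rem_le`.
    have hRb : ‖R j‖ ^ 2 ≤ 288 * L ^ 2 * q2 + 288 * L ^ 2 * (V * X) + 2 * S * X
        + 1024 * L ^ 2 * (F * X) := by
      have e1 : 2 * δ ^ 2 * ‖W j‖ ^ 2 ≤ 2 * S * X := by
        calc _ ≤ 2 * δ ^ 2 * (S * θ) := by gcongr
          _ = 2 * S * (δ ^ 2 * θ) := by ring
          _ ≤ _ := by gcongr
      have e2 : 8 * L ^ 2 * (128 / ρ ^ 2 * ∫ ω, ‖(noiseCentroid H μ Z j).1 ω‖ ^ 4 ∂P)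
          ≤ 1024 * L ^ 2 * (F * X) := by
        calc _ ≤ 8 * L ^ 2 * (128 / ρ ^ 2 * (F * (μ * θ))) := by gcongr
          _ = 1024 * L ^ 2 * (F * (μ / ρ ^ 2 * θ)) := by ring
          _ ≤ _ := by gcongr
      have e3 : 288 * L ^ 2 * v2 ≤ 288 * L ^ 2 * (V * X) := by gcongr
      calc _ ≤ _ := h2
        _ = 288 * L ^ 2 * q2 + 288 * L ^ 2 * v2 + 2 * δ ^ 2 * ‖W j‖ ^ 2
          + 8 * L ^ 2 * (128 / ρ ^ 2 * ∫ ω, ‖(noiseCentroid H μ Z j).1 ω‖ ^ 4 ∂P) := by ring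
        _ ≤ _ := by linarith
    have hWb : 4 * L ^ 2 * (μ / B) * ‖W j‖ ^ 2 ≤ 4 * L ^ 2 * (S * X) := by
      calc _ ≤ 4 * L ^ 2 * μ * (S * θ) := by
            gcongr
            exact div_le_self hμ hB1
        _ = 4 * L ^ 2 * (S * (μ * θ)) := by ring
        _ ≤ _ := by gcongr
    have h6 : 8 * L ^ 2 * v2 + 4 * ‖R j‖ ^ 2 + 4 * L ^ 2 * (μ / B) * ‖W j‖ ^ 2
        ≤ 1152 * L ^ 2 * q2 + driveConst L C c r T * X := by
      have e1 : 8 * L ^ 2 * v2 ≤ 8 * L ^ 2 * (V * X) := by gcongr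
      have e2 : driveConst L C c r T * X = 1160 * L ^ 2 * (V * X) + 8 * S * X
          + 4096 * L ^ 2 * (F * X) + 4 * L ^ 2 * (S * X) := by rw [driveConst]; ring
      rw [e2]
      linarith
    calc _ ≤ _ := h1
      _ ≤ (1 + μ * (1 + 8 * L ^ 2)) * q2
          + μ * (1152 * L ^ 2 * q2 + driveConst L C c r T * X) := by gcongr
      _ = _ := by ring
  have hQ0 := driveConst_nonneg (c := c) (r := r) hL hC hT
  -- The rate collects 1160 = 8 + 4 · 288: the direct linear term plus the feedback through the
  -- remainder.
  have hg := le_exp_mul_of_step_le (x := fun j => ‖centErr A D H b μ W Z j‖ ^ 2)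
    (a := 1 + 1160 * L ^ 2) (β := driveConst L C c r T * X) (N := n) (by positivity) hμ
    (by positivity) (sq_nonneg _) hstep n le_rfl
  have h0 : ‖centErr A D H b μ W Z 0‖ ^ 2 ≤ X := by
    have e1 : centErr A D H b μ W Z 0 = map avgOp (W 0) := by
      simp [centErr, noiseCentroid, biasCentroid]
    rw [e1]
    exact (pow_le_pow_left₀ (norm_nonneg _) (norm_map_avgOp_le _) 2).trans hXW
  have h1 : ‖centErr A D H b μ W Z n‖ ^ 2 ≤ Real.exp ((1 + 1160 * L ^ 2) * T)
      * (X + T * (driveConst L C c r T * X)) := by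
    refine hg.trans ?_
    gcongr
  calc _ ≤ Real.exp ((1 + 1160 * L ^ 2) * T) * (X + T * (driveConst L C c r T * X)) + V * X :=
        add_le_add h1 (hdev n le_rfl)
    _ = _ := by rw [errConst]; ring

end IsIteration

end RiskExpansion

/-! ### Expansion of the expected risk into noise and bias energy -/

section RiskComparison

open SqInt

variable {Ω : Type*} [mΩ : MeasurableSpace Ω] {P : Measure Ω} [IsProbabilityMeasure P]
  {K M : ℕ} {N : Fin K → ℕ} {β : Type*} [MeasurableSpace β]
  {w₀ : Ω → β} {I : ∀ k : Fin K, ℕ → ℕ → Ω → Fin (N k)}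

/-- Young's inequality with weight δ: the large part is multiplied by the small δ, and the factor
1/δ falls on the negligible part `y`. -/
lemma abs_inner_sub_inner_le {E : Type*} [SeminormedAddCommGroup E] [InnerProductSpace ℝ E]
    (T : E →ₗ[ℝ] E) {L δ : ℝ} (hL : 0 ≤ L) (hδ : 0 < δ) (hT : ∀ x, ‖T x‖ ≤ L * ‖x‖) {w x y : E}
    (hw : w = x + y) :
    |inner ℝ (T w) w - inner ℝ (T x) x| ≤ L * (δ * ‖w‖ ^ 2 + (1 / δ + 1) * ‖y‖ ^ 2) := by
  have hb : ∀ a b : E, |inner ℝ (T a) b| ≤ L * (‖a‖ * ‖b‖) := fun a b => by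
    calc _ ≤ ‖T a‖ * ‖b‖ := abs_real_inner_le_norm _ _
      _ ≤ (L * ‖a‖) * ‖b‖ := by gcongr; exact hT a
      _ = _ := by ring
  have hx : x = w - y := by rw [hw]; abel
  have h1 : inner ℝ (T w) w - inner ℝ (T x) x
      = inner ℝ (T w) y + inner ℝ (T y) w - inner ℝ (T y) y := by
    rw [hx, map_sub, inner_sub_left, inner_sub_right, inner_sub_right]; ring
  have h2 := hb w y
  have h3 := hb y w
  have h4 := hb y y
  have h5 : |inner ℝ (T w) w - inner ℝ (T x) x| ≤ L * (2 * (‖w‖ * ‖y‖) + ‖y‖ ^ 2) := by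
    rw [h1]
    calc _ ≤ |inner ℝ (T w) y| + |inner ℝ (T y) w| + |inner ℝ (T y) y| :=
          (abs_sub _ _).trans (add_le_add (abs_add_le _ _) le_rfl)
      _ ≤ _ := by nlinarith
  have h6 : 2 * (‖w‖ * ‖y‖) ≤ δ * ‖w‖ ^ 2 + 1 / δ * ‖y‖ ^ 2 := by
    have h7 : 0 ≤ (δ * ‖w‖ - ‖y‖) ^ 2 / δ := by positivity
    have h8 : (δ * ‖w‖ - ‖y‖) ^ 2 / δ = δ * ‖w‖ ^ 2 + 1 / δ * ‖y‖ ^ 2 - 2 * (‖w‖ * ‖y‖) := by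
      field_simp; ring
    linarith
  refine h5.trans ?_
  have : L * (2 * (‖w‖ * ‖y‖) + ‖y‖ ^ 2)
      ≤ L * (δ * ‖w‖ ^ 2 + 1 / δ * ‖y‖ ^ 2 + ‖y‖ ^ 2) := by gcongr
  refine this.trans (le_of_eq (by ring))

namespace IsIteration

variable {A D : Matrix (Fin K) (Fin K) ℝ} {H : Fin K → Vec M →L[ℝ] Vec M} {b : NetState K M}
  {Hb : Vec M →L[ℝ] Vec M} {L C : ℝ} {B : ℕ} {μ : ℝ} {W Z R Φ : ℕ → SqInt P (NetState K M)}

/-- Centroid and deviation are orthogonal in the energy of `Hb`, because `Hb` acts alike on all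
agents and so commutes with averaging. -/
lemma inner_blockDiag_bias (hA : A ∈ doublyStochastic ℝ (Fin K))
    (hD : D ∈ doublyStochastic ℝ (Fin K)) (hb : avgOp b = 0)
    (hsymm : ∀ x y, inner ℝ (Hb x) y = inner ℝ x (Hb y)) (n : ℕ) :
    inner ℝ (blockDiag (fun _ => Hb) (biasCentroid A D H μ b n + biasDev A D μ b n))
        (biasCentroid A D H μ b n + biasDev A D μ b n)
      = inner ℝ (blockDiag (fun _ => Hb) (biasCentroid A D H μ b n)) (biasCentroid A D H μ b n)
        + inner ℝ (blockDiag (fun _ => Hb) (biasDev A D μ b n)) (biasDev A D μ b n) := by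
  set m := biasCentroid A D H μ b n with hm
  set d := biasDev A D μ b n with hd
  have h1 : inner ℝ (blockDiag (fun _ => Hb) m) d = 0 := by
    have hmm : m = avgOp m := (avgOp_biasCentroid n).symm
    rw [hmm, avgOp, ← mix_blockDiag_const]
    change inner ℝ (avgOp _) d = 0
    rw [inner_avgOp_left, hd, avgOp_biasDev hA hD hb, inner_zero_right]
  have h2 : inner ℝ (blockDiag (fun _ => Hb) d) m = 0 := by
    rw [inner_blockDiag_const_comm hsymm, real_inner_comm, h1]
  rw [map_add, inner_add_left, inner_add_right, inner_add_right, h1, h2]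
  ring

/-- Noise and bias do not interact: the noise centroid is orthogonal to constants. -/
lemma inner_model (h : IsIteration w₀ I A D H b L C B μ W Z R Φ)
    (hA : A ∈ doublyStochastic ℝ (Fin K)) (hD : D ∈ doublyStochastic ℝ (Fin K))
    (hb : avgOp b = 0) (hHsymm : ∀ k x y, inner ℝ (H k x) y = inner ℝ x (H k y))
    (hsymm : ∀ x y, inner ℝ (Hb x) y = inner ℝ x (Hb y)) (n : ℕ) :
    inner ℝ (map (blockDiag fun _ => Hb) (noiseCentroid H μ Z n
        + const P (biasCentroid A D H μ b n + biasDev A D μ b n)))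
      (noiseCentroid H μ Z n + const P (biasCentroid A D H μ b n + biasDev A D μ b n))
      = inner ℝ (map (blockDiag fun _ => Hb) (noiseCentroid H μ Z n)) (noiseCentroid H μ Z n)
        + (inner ℝ (blockDiag (fun _ => Hb) (biasCentroid A D H μ b n)) (biasCentroid A D H μ b n)
        + inner ℝ (blockDiag (fun _ => Hb) (biasDev A D μ b n)) (biasDev A D μ b n)) := by
  have h1 : ∀ e, inner ℝ (map (blockDiag fun _ => Hb) (noiseCentroid H μ Z n)) (const P e) = 0 :=
    fun e => by
      rw [inner_map_left (inner_blockDiag_const_comm hsymm), SqInt.map_const]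
      exact h.inner_noiseCentroid_const hHsymm n _
  have h2 : ∀ e, inner ℝ (const P e) (noiseCentroid H μ Z n) = 0 := fun e => by
    rw [real_inner_comm]
    exact h.inner_noiseCentroid_const hHsymm n _
  rw [map_add, inner_add_left, inner_add_right, inner_add_right, h1, SqInt.map_const, h2,
    inner_const, inner_blockDiag_bias hA hD hb hsymm]
  ring

/-- Expansion of an expected risk up to lower order terms. -/
lemma abs_integral_risk_sub_le (h : IsIteration w₀ I A D H b L C B μ W Z R Φ)
    (hS : IsSampling P w₀ I) (k₀ : Fin K) (hB : 1 ≤ B)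
    (hA : A ∈ doublyStochastic ℝ (Fin K)) (hs : A.IsSymm)
    (hD : D ∈ doublyStochastic ℝ (Fin K)) (hDs : D.IsSymm)
    {r : ℝ} (hr0 : 0 ≤ r) (hr1 : r < 1)
    (hr : ∀ x : Fin K → ℝ, ∑ k, x k = 0 →
      ∑ k, (A.mulVec x k) ^ 2 ≤ r ^ 2 * ∑ l, x l ^ 2) (hb : avgOp b = 0)
    (hH : ∀ k, ‖H k‖ ≤ L) (hHsymm : ∀ k x y, inner ℝ (H k x) y = inner ℝ x (H k y))
    (hHb : ‖Hb‖ ≤ L) (hsymm : ∀ x y, inner ℝ (Hb x) y = inner ℝ x (Hb y))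
    (hL : 0 ≤ L) (hC : 0 ≤ C) (hμ : 0 ≤ μ) (hμ1 : μ ≤ 1)
    {c T : ℝ} (hc : ∀ n, ‖biasDev A D μ b n‖ ≤ c * μ)
    (hW0 : ‖W 0‖ ^ 2 ≤ μ ^ 2 + μ / B) {ρ δ : ℝ} (hρ : 0 < ρ) (hδ : 0 < δ)
    (hcρ : ∀ n, ‖biasCentroid A D H μ b n + biasDev A D μ b n‖ ≤ ρ / 4)
    (hR : ∀ n ω, ‖(R n).1 ω‖ ≤ δ * ‖(W n).1 ω‖ + 2 * L * tail ρ ((W n).1 ω))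
    {Ψ : NetState K M → ℝ} {n : ℕ} (hΨi : Integrable (fun ω => Ψ ((W n).1 ω)) P)
    (hΨ : ∀ w, |Ψ w - inner ℝ (blockDiag (fun _ => Hb) w) w / 2|
      ≤ δ * ‖w‖ ^ 2 + 2 * L * tail ρ w ^ 2)
    (hn : n * μ ≤ T) :
    |∫ ω, Ψ ((W n).1 ω) ∂P -
      (inner ℝ (map (blockDiag fun _ => Hb) (noiseCentroid H μ Z n)) (noiseCentroid H μ Z n)
        + (inner ℝ (blockDiag (fun _ => Hb) (biasCentroid A D H μ b n)) (biasCentroid A D H μ b n)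
        + inner ℝ (blockDiag (fun _ => Hb) (biasDev A D μ b n)) (biasDev A D μ b n))) / 2|
      ≤ (δ * secondConst L C c T + L * δ * secondConst L C c T
          + 256 * L * fourthConst L C T * (μ / ρ ^ 2)) * (μ ^ 2 + μ / B)
        + (73 * L + L / δ) * (errConst L C c r T *
          (‖W 0‖ ^ 2 + (δ ^ 2 + μ + μ / ρ ^ 2) * (μ ^ 2 + μ / B))) := by
  set x := noiseCentroid H μ Z n + const P (biasCentroid A D H μ b n + biasDev A D μ b n) with hx
  set y := centErr A D H b μ W Z n + devErr A D b μ W n with hy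
  have hWxy : W n = x + y := eq_add_errors n
  have h1 := h.norm_sq_le hA hs hD hDs hL hC hμ hμ1 hc hW0 hn
  have h2 := h.fourth_moment_le hS k₀ hB hH hL hC hμ hμ1 hn
  have h3 := h.errors_le hS k₀ hB hA hs hD hDs hr0 hr1 hr hb hH hL hC hμ hμ1 hc hW0 hρ hcρ hR hn
  rw [← inner_model h hA hD hb hHsymm hsymm, ← hx]
  set θ := μ ^ 2 + μ / B with hθ
  set S := secondConst L C c T with hSdef
  have hSeq : 2 * (Real.exp ((3 * L + 4 * L ^ 2) * T) * (1 + T * ((L + 4 * L ^ 2) * c ^ 2 + 2 * C)))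
    + 2 * c ^ 2 = S := rfl
  rw [hSeq] at h1
  set F := fourthConst L C T
  set E := errConst L C c r T * (‖W 0‖ ^ 2 + (δ ^ 2 + μ + μ / ρ ^ 2) * θ) with hE
  have hy2 : ‖y‖ ^ 2 ≤ 2 * E := (norm_add_sq_le_two _ _).trans (by gcongr)
  have h4 : |inner ℝ (map (blockDiag fun _ => Hb) (W n)) (W n)
      - inner ℝ (map (blockDiag fun _ => Hb) x) x|
      ≤ L * (δ * (S * θ) + (1 / δ + 1) * (2 * E)) :=
    (abs_inner_sub_inner_le _ hL hδ (norm_map_blockDiag_le hL fun _ => hHb) hWxy).trans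
      (by gcongr)
  have hqi : Integrable (fun ω => inner ℝ (blockDiag (fun _ => Hb) ((W n).1 ω)) ((W n).1 ω)) P :=
    integrable_inner (map (blockDiag fun _ => Hb) (W n)) (W n)
  have h5 : |∫ ω, Ψ ((W n).1 ω) ∂P - inner ℝ (map (blockDiag fun _ => Hb) (W n)) (W n) / 2|
      ≤ δ * (S * θ) + 2 * L * (36 * E + 128 / ρ ^ 2 * (F * (μ * θ))) := by
    have e1 : ∫ ω, Ψ ((W n).1 ω) ∂P - inner ℝ (map (blockDiag fun _ => Hb) (W n)) (W n) / 2
        = ∫ ω, (Ψ ((W n).1 ω)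
          - inner ℝ (blockDiag (fun _ => Hb) ((W n).1 ω)) ((W n).1 ω) / 2) ∂P := by
      rw [integral_sub hΨi (hqi.div_const 2), integral_div]
      rfl
    rw [e1]
    refine abs_integral_le_integral_abs.trans ?_
    refine (h.integral_tail_bound_le hS k₀ hH hL hμ hρ (hcρ n) (a := δ) (e := 2 * L)
      (by positivity) (fun ω => abs_nonneg _) fun ω => hΨ _).trans ?_
    gcongr
  have h6 : ∫ ω, Ψ ((W n).1 ω) ∂P - inner ℝ (map (blockDiag fun _ => Hb) x) x / 2
      = (∫ ω, Ψ ((W n).1 ω) ∂P - inner ℝ (map (blockDiag fun _ => Hb) (W n)) (W n) / 2)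
        + (inner ℝ (map (blockDiag fun _ => Hb) (W n)) (W n)
          - inner ℝ (map (blockDiag fun _ => Hb) x) x) / 2 := by ring
  rw [h6]
  have hSθ : 0 ≤ S * θ := (sq_nonneg _).trans h1
  calc _ ≤ _ := abs_add_le _ _
    _ ≤ (δ * (S * θ) + 2 * L * (36 * E + 128 / ρ ^ 2 * (F * (μ * θ))))
        + L * (δ * (S * θ) + (1 / δ + 1) * (2 * E)) / 2 := by
          rw [abs_div, abs_two]
          gcongr
    _ = (δ * S + L * δ * S / 2 + 256 * L * F * (μ / ρ ^ 2)) * θ + (73 * L + L / δ) * E := by ring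
    _ ≤ _ := by
          have : 0 ≤ L * δ * (S * θ) := by positivity
          linarith

end IsIteration

/-- The error terms of the expansion are negligible for a suitable choice of the parameters. -/
lemma exists_parameters {S F G L ε : ℝ} (hS : 0 ≤ S) (hF : 0 ≤ F) (hG : 0 ≤ G) (hL : 0 ≤ L)
    (hε : 0 < ε) :
    ∃ δ : ℝ, 0 < δ ∧ ∀ ρ : ℝ, 0 < ρ → ∃ t : ℝ, 0 < t ∧ t ≤ 1 ∧ ∀ μ θ w : ℝ, 0 ≤ μ → μ ≤ t →
      0 ≤ θ → w ≤ t * θ →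
      (δ * S + L * δ * S + 256 * L * F * (μ / ρ ^ 2)) * θ
        + (73 * L + L / δ) * (G * (w + (δ ^ 2 + μ + μ / ρ ^ 2) * θ)) ≤ ε * θ := by
  -- `Q₁` collects what is proportional to δ, which is fixed before ρ; `Q₂` below may depend on δ
  -- and ρ and is beaten by a small step size.
  set Q₁ := S + L * S + 74 * L * G with hQ₁
  have hQ₁0 : 0 ≤ Q₁ := by positivity
  set δ := min 1 (ε / (2 * (Q₁ + 1))) with hδ
  have hδ0 : 0 < δ := lt_min one_pos (by positivity)
  have hδ1 : δ ≤ 1 := min_le_left _ _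
  have hδQ : δ * Q₁ ≤ ε / 2 := by
    have h1 : δ ≤ ε / (2 * (Q₁ + 1)) := min_le_right _ _
    calc δ * Q₁ ≤ ε / (2 * (Q₁ + 1)) * (Q₁ + 1) := by gcongr; linarith
      _ = ε / 2 := by field_simp
  refine ⟨δ, hδ0, fun ρ hρ => ?_⟩
  set Q₂ := 256 * L * F / ρ ^ 2 + (73 * L + L / δ) * G * (2 + 1 / ρ ^ 2) with hQ₂
  have hQ₂0 : 0 ≤ Q₂ := by positivity
  refine ⟨min 1 (ε / (2 * (Q₂ + 1))), lt_min one_pos (by positivity), min_le_left _ _,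
    fun μ θ w hμ hμt hθ hw => ?_⟩
  set t := min 1 (ε / (2 * (Q₂ + 1))) with ht
  have ht0 : 0 < t := lt_min one_pos (by positivity)
  have htQ : t * Q₂ ≤ ε / 2 := by
    have h1 : t ≤ ε / (2 * (Q₂ + 1)) := min_le_right _ _
    calc t * Q₂ ≤ ε / (2 * (Q₂ + 1)) * (Q₂ + 1) := by gcongr; linarith
      _ = ε / 2 := by field_simp
  -- The loss 1/δ meets an error of order δ², so one factor δ survives.
  have h2 : (73 * L + L / δ) * δ ^ 2 ≤ 74 * L * δ := by
    have e1 : (73 * L + L / δ) * δ ^ 2 = 73 * L * (δ * δ) + L * δ := by field_simp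
    have e2 : 73 * L * (δ * δ) ≤ 73 * L * (1 * δ) := by gcongr
    linarith
  calc _ ≤ (δ * S + L * δ * S + 256 * L * F * (t / ρ ^ 2)) * θ
        + (73 * L + L / δ) * (G * (t * θ + (δ ^ 2 + t + t / ρ ^ 2) * θ)) := by gcongr
    _ = (δ * S + L * δ * S + ((73 * L + L / δ) * δ ^ 2) * G + t * Q₂) * θ := by rw [hQ₂]; ring
    _ ≤ (δ * S + L * δ * S + (74 * L * δ) * G + ε / 2) * θ := by gcongr
    _ = (δ * Q₁ + ε / 2) * θ := by rw [hQ₁]; ring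
    _ ≤ (ε / 2 + ε / 2) * θ := by gcongr
    _ = ε * θ := by ring

end RiskComparison

/-! ### The stochastic gradient iterations -/

section NetworkBatch

variable {Ω : Type*} [mΩ : MeasurableSpace Ω] {P : Measure Ω} [IsProbabilityMeasure P]
  {K M : ℕ} {N : Fin K → ℕ} {β : Type*} [MeasurableSpace β]
  {w₀ : Ω → β} {I : ∀ k : Fin K, ℕ → ℕ → Ω → Fin (N k)} {B n : ℕ}

lemma measurable_netState {m : MeasurableSpace Ω} {f : Fin K → Ω → Vec M}
    (hf : ∀ k, Measurable[m] (f k)) :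
    Measurable[m] fun ω => (WithLp.toLp 2 fun k => f k ω : NetState K M) :=
  (WithLp.measurable_toLp 2 _).comp (measurable_pi_iff.2 hf)

lemma measurable_netState_apply (k : Fin K) : Measurable fun w : NetState K M => w k :=
  (PiLp.continuous_apply 2 _ k).measurable

lemma norm_batchAvg_le {F : Type*} [NormedAddCommGroup F] [NormedSpace ℝ F] {k : Fin K}
    {g : Fin (N k) → Ω → F} {ω : Ω} {c : ℝ} (hc : 0 ≤ c) (hg : ∀ i, ‖g i ω‖ ≤ c) :
    ‖batchAvg I B n k g ω‖ ≤ c := by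
  rw [batchAvg, norm_smul, norm_inv, RCLike.norm_natCast]
  rcases Nat.eq_zero_or_pos B with rfl | hB
  · simpa using hc
  rw [inv_mul_le_iff₀ (by positivity)]
  calc _ ≤ ∑ b ∈ Finset.range B, ‖g (I k n b ω) ω‖ := norm_sum_le _ _
    _ ≤ ∑ _b ∈ Finset.range B, c := Finset.sum_le_sum fun b _ => hg _
    _ = _ := by simp

lemma batchAvg_const (hB : 1 ≤ B) (n : ℕ) (k : Fin K) (c : Ω → Vec M) (ω : Ω) :
    batchAvg I B n k (fun _ => c) ω = c ω := by
  have : (B : ℝ) ≠ 0 := by positivity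
  simp [batchAvg, ← Nat.cast_smul_eq_nsmul ℝ, smul_smul, this]

lemma batchAvg_sub (n : ℕ) (k : Fin K) (f g : Fin (N k) → Ω → Vec M) (ω : Ω) :
    batchAvg I B n k (fun i ω => f i ω - g i ω) ω
      = batchAvg I B n k f ω - batchAvg I B n k g ω := by
  simp [batchAvg, smul_sub]

lemma batchAvg_smul (n : ℕ) (k : Fin K) (c : Ω → ℝ) (g : Fin (N k) → Ω → Vec M) (ω : Ω) :
    batchAvg I B n k (fun i ω => c ω • g i ω) ω = c ω • batchAvg I B n k g ω := by
  simp only [batchAvg, ← Finset.smul_sum]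
  exact smul_comm _ _ _

/-- Batch averages of all agents. -/
noncomputable def netBatch (I : ∀ k : Fin K, ℕ → ℕ → Ω → Fin (N k)) (B n : ℕ)
    (g : ∀ k, Fin (N k) → Ω → Vec M) (ω : Ω) : NetState K M :=
  WithLp.toLp 2 fun k => batchAvg I B n k (g k) ω

@[simp] lemma netBatch_apply (g : ∀ k, Fin (N k) → Ω → Vec M) (ω : Ω) (k : Fin K) :
    netBatch I B n g ω k = batchAvg I B n k (g k) ω := rfl

lemma measurable_batchAvg {m : MeasurableSpace Ω} {k : Fin K} {g : Fin (N k) → Ω → Vec M}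
    (hI : ∀ b, Measurable[m] (I k n b)) (hg : ∀ i, Measurable[m] (g i)) :
    Measurable[m] (batchAvg I B n k g) := by
  have h : Measurable[m] fun ω => ∑ b ∈ Finset.range B, g (I k n b ω) ω :=
    Finset.measurable_fun_sum _ fun b _ => measurable_comp_finite (hI b) hg
  exact h.const_smul (B : ℝ)⁻¹

lemma isPast_succ_netBatch {g : ∀ k, Fin (N k) → Ω → Vec M}
    (hg : ∀ k i, IsPast w₀ I n (g k i)) : IsPast w₀ I (n + 1) (netBatch I B n g) := by
  intro t ht
  refine measurable_netState fun k => measurable_batchAvg (fun b => ?_)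
    fun i => hg k i t (by omega)
  refine measurable_draw_exceptDraw (s := ⟨k, n, b⟩) ?_
  rintro rfl
  simp at ht

namespace IsSampling

variable {g : ∀ k, Fin (N k) → Ω → Vec M} {ρ : Fin K → Ω → ℝ}

lemma memLp_netBatch (hS : IsSampling P w₀ I) (hg : ∀ k i, IsPast w₀ I n (g k i))
    (hρ : ∀ k, MemLp (ρ k) 2 P) (hgρ : ∀ k i ω, ‖g k i ω‖ ≤ ρ k ω) :
    MemLp (netBatch I B n g) 2 P := by
  refine (memLp_piLp_iff (p := 2)).2 fun k => ?_
  exact hS.memLp_batchAvg (hg k) (hρ k) (hgρ k)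

lemma integral_inner_netBatch_eq_zero (hS : IsSampling P w₀ I)
    (hg : ∀ k i, IsPast w₀ I n (g k i)) (hρ : ∀ k, MemLp (ρ k) 2 P)
    (hgρ : ∀ k i ω, ‖g k i ω‖ ≤ ρ k ω) (hsum : ∀ k ω, ∑ i, g k i ω = 0)
    {Y : Ω → NetState K M} (hY : IsPast w₀ I n Y) (hY2 : MemLp Y 2 P) :
    ∫ ω, inner ℝ (Y ω) (netBatch I B n g ω) ∂P = 0 := by
  have h1 : ∀ k, MemLp (fun ω => Y ω k) 2 P := (memLp_piLp_iff (p := 2)).1 hY2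
  have h2 : ∀ ω, inner ℝ (Y ω) (netBatch I B n g ω)
      = ∑ k, inner ℝ (Y ω k) (batchAvg I B n k (g k) ω) := fun ω => PiLp.inner_apply _ _
  rw [integral_congr_ae (ae_of_all _ h2), integral_finsetSum _ fun k _ =>
    integrable_inner_of_memLp (h1 k) (hS.memLp_batchAvg (hg k) (hρ k) (hgρ k))]
  refine Finset.sum_eq_zero fun k _ => ?_
  exact hS.integral_inner_batchAvg_eq_zero (hg k) (hρ k) (hgρ k) (hsum k)
    (hY.comp (measurable_netState_apply k)) (h1 k)

lemma integral_norm_sq_netBatch_le (hS : IsSampling P w₀ I) (hB : 1 ≤ B)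
    (hg : ∀ k i, IsPast w₀ I n (g k i)) (hρ : ∀ k, MemLp (ρ k) 2 P)
    (hgρ : ∀ k i ω, ‖g k i ω‖ ≤ ρ k ω) (hsum : ∀ k ω, ∑ i, g k i ω = 0) :
    ∫ ω, ‖netBatch I B n g ω‖ ^ 2 ∂P ≤ (∫ ω, ∑ k, ρ k ω ^ 2 ∂P) / B := by
  have h2 : ∀ ω, ‖netBatch I B n g ω‖ ^ 2 = ∑ k, ‖batchAvg I B n k (g k) ω‖ ^ 2 :=
    fun ω => PiLp.norm_sq_eq_of_L2 _ _
  rw [integral_congr_ae (ae_of_all _ h2),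
    integral_finsetSum _ fun k _ => (hS.memLp_batchAvg (hg k) (hρ k)
      (hgρ k)).integrable_norm_pow (by norm_num),
    integral_finsetSum _ fun k _ => (hρ k).integrable_sq, Finset.sum_div]
  refine Finset.sum_le_sum fun k _ => ?_
  rw [div_eq_inv_mul]
  exact hS.integral_norm_sq_batchAvg_le hB (hg k) (hρ k) (hgρ k) (hsum k)

end IsSampling

lemma norm_netBatch_sq_le {g : ∀ k, Fin (N k) → Ω → Vec M} {ω : Ω} {c : Fin K → ℝ}
    (hc : ∀ k, 0 ≤ c k) (hg : ∀ k i, ‖g k i ω‖ ≤ c k) :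
    ‖netBatch I B n g ω‖ ^ 2 ≤ ∑ k, c k ^ 2 := by
  rw [PiLp.norm_sq_eq_of_L2]
  exact Finset.sum_le_sum fun k _ =>
    pow_le_pow_left₀ (norm_nonneg _) (norm_batchAvg_le (hc k) (hg k)) 2

end NetworkBatch

/-! ### Gradient noise, remainder and error process of the stochastic methods -/

namespace Problem

variable {K M : ℕ} {X : Type u} (p : Problem K M X) (wstar : Vec M)

/-- Gradients of the individual risks at `wstar`. -/
noncomputable def bias : NetState K M := WithLp.toLp 2 fun k => gradient (p.Jk k) wstar

/-- Deviation of the loss gradient at one sample from the gradient of the individual risk. -/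
noncomputable def noise (k : Fin K) (i : Fin (p.N k)) (w : Vec M) : Vec M :=
  p.gradQ k i w - gradient (p.Jk k) w

/-- Nonlinear part of the gradients of the individual risks around `wstar`. -/
noncomputable def remainder (w : NetState K M) : NetState K M :=
  WithLp.toLp 2 fun k => gradient (p.Jk k) (wstar + w k) - gradient (p.Jk k) wstar
    - p.hess k wstar (w k)

variable {p} {L : ℝ≥0}

lemma IsSmooth.sum_noise (hp : p.IsSmooth L) (k : Fin K) (w : Vec M) :
    ∑ i, p.noise k i w = 0 := by
  simp only [noise, hp.gradient_Jk, Finset.sum_sub_distrib, Finset.sum_const, Finset.card_univ,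
    Fintype.card_fin]
  rcases Nat.eq_zero_or_pos (p.N k) with h | h
  · have : IsEmpty (Fin (p.N k)) := by rw [h]; infer_instance
    simp [h]
  · have : (p.N k : ℝ) ≠ 0 := by positivity
    rw [← Nat.cast_smul_eq_nsmul ℝ, smul_smul, mul_inv_cancel₀ this, one_smul, sub_self]

lemma IsSmooth.norm_noise_sub_le (hp : p.IsSmooth L) (k : Fin K) (i : Fin (p.N k)) (w v : Vec M) :
    ‖p.noise k i (w + v) - p.noise k i w‖ ≤ 2 * L * ‖v‖ := by
  have h1 := (hp.lipschitz k i).norm_sub_le (w + v) w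
  have h2 := (hp.lipschitz_Jk k).norm_sub_le (w + v) w
  rw [add_sub_cancel_left] at h1 h2
  have h3 : p.noise k i (w + v) - p.noise k i w = (p.gradQ k i (w + v) - p.gradQ k i w)
      - (gradient (p.Jk k) (w + v) - gradient (p.Jk k) w) := by simp only [noise]; abel
  rw [h3]
  refine (norm_sub_le _ _).trans ?_
  linarith

lemma IsSmooth.continuous_noise (hp : p.IsSmooth L) (k : Fin K) (i : Fin (p.N k)) :
    Continuous (p.noise k i) :=
  (hp.lipschitz k i).continuous.sub (hp.lipschitz_Jk k).continuous

lemma IsSmooth.continuous_remainder (hp : p.IsSmooth L) : Continuous (p.remainder wstar) := by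
  refine (PiLp.continuous_toLp 2 _).comp (continuous_pi fun k => ?_)
  have h1 : Continuous fun w : NetState K M => w k := PiLp.continuous_apply 2 _ k
  have h2 := (hp.lipschitz_Jk k).continuous
  exact ((h2.comp (continuous_const.add h1)).sub continuous_const).sub
    ((p.hess k wstar).continuous.comp h1)

section Iterates

variable {Ω : Type v} [MeasurableSpace Ω] {P : Measure Ω} [IsProbabilityMeasure P]
  {I : ∀ k : Fin K, ℕ → ℕ → Ω → Fin (p.N k)} {B : ℕ}

/-- The mini-batch gradient increments relative to `wstar`. -/
lemma batchGrad_add (hB : 1 ≤ B) (n : ℕ) (w : Ω → NetState K M) (ω : Ω) :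
    (WithLp.toLp 2 fun k => p.batchGrad I B n k (wstar + w ω k) ω : NetState K M)
      = p.bias wstar + netBatch I B n (fun k i _ => p.noise k i wstar) ω
        + netBatch I B n (fun k i ω => p.gradQ k i (wstar + w ω k) - p.gradQ k i wstar) ω := by
  ext1 k
  have h1 := batchAvg_sub (I := I) (B := B) n k (fun i ω => p.gradQ k i (wstar + w ω k))
    (fun i _ => p.gradQ k i wstar) ω
  have h2 := batchAvg_sub (I := I) (B := B) n k (fun i _ => p.gradQ k i wstar)
    (fun _ _ => gradient (p.Jk k) wstar) ω
  rw [batchAvg_const hB] at h2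
  change batchAvg I B n k (fun i ω => p.gradQ k i (wstar + w ω k)) ω
    = gradient (p.Jk k) wstar + batchAvg I B n k (fun i _ => p.noise k i wstar) ω
      + batchAvg I B n k (fun i ω => p.gradQ k i (wstar + w ω k) - p.gradQ k i wstar) ω
  rw [h1]
  simp only [noise] at h2 ⊢
  rw [h2]
  abel

lemma netBatch_gradQ_sub (hB : 1 ≤ B) (n : ℕ) (w : Ω → NetState K M) (ω : Ω) :
    netBatch I B n (fun k i ω => p.gradQ k i (wstar + w ω k) - p.gradQ k i wstar) ω
      = blockDiag (fun k => p.hess k wstar) (w ω) + p.remainder wstar (w ω)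
        + netBatch I B n (fun k i ω => p.noise k i (wstar + w ω k) - p.noise k i wstar) ω := by
  ext1 k
  have h1 := batchAvg_sub (I := I) (B := B) n k
    (fun i ω => p.gradQ k i (wstar + w ω k) - p.gradQ k i wstar)
    (fun _ ω => gradient (p.Jk k) (wstar + w ω k) - gradient (p.Jk k) wstar) ω
  rw [batchAvg_const hB] at h1
  have h2 : (fun i ω => p.noise k i (wstar + w ω k) - p.noise k i wstar)
      = fun (i : Fin (p.N k)) ω => (p.gradQ k i (wstar + w ω k) - p.gradQ k i wstar)
        - (gradient (p.Jk k) (wstar + w ω k) - gradient (p.Jk k) wstar) := by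
    ext1 i; ext1 ω; simp only [noise]; abel
  simp only [PiLp.add_apply, netBatch_apply, blockDiag_apply, remainder]
  rw [h2, h1]
  abel

variable (p) in
/-- Deviation of the agents from `wstar` under consensus (`D = 1`) or diffusion (`D = A`). -/
noncomputable def errorProc (A D : Matrix (Fin K) (Fin K) ℝ)
    (I : ∀ k : Fin K, ℕ → ℕ → Ω → Fin (p.N k)) (B : ℕ) (μ : ℝ) (w₀ : Fin K → Ω → Vec M) :
    ℕ → Ω → NetState K M
  | 0 => fun ω => WithLp.toLp 2 fun k => w₀ k ω - wstar
  | n + 1 => fun ω => mix A (errorProc A D I B μ w₀ n ω) - μ • mix D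
      (WithLp.toLp 2 fun k => p.batchGrad I B n k (wstar + errorProc A D I B μ w₀ n ω k) ω)

variable {A D : Matrix (Fin K) (Fin K) ℝ} {μ : ℝ} {w₀ : Fin K → Ω → Vec M}

lemma sum_smul_add_of_doublyStochastic (hA : A ∈ doublyStochastic ℝ (Fin K)) (k : Fin K)
    (v : Vec M) (f : Fin K → Vec M) : ∑ l, A l k • (v + f l) = v + ∑ l, A l k • f l := by
  simp only [smul_add, Finset.sum_add_distrib, ← Finset.sum_smul,
    sum_col_of_mem_doublyStochastic hA, one_smul]

lemma consensus_eq (hA : A ∈ doublyStochastic ℝ (Fin K)) (n : ℕ) (k : Fin K) (ω : Ω) :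
    p.consensus A I B μ w₀ n k ω = wstar + p.errorProc wstar A 1 I B μ w₀ n ω k := by
  induction n generalizing k with
  | zero => simp [consensus, errorProc]
  | succ n ih =>
    simp only [consensus, errorProc, ih, mix_one, sum_smul_add_of_doublyStochastic hA,
      PiLp.sub_apply, PiLp.smul_apply, mix_apply]
    abel

lemma diffusion_eq (hA : A ∈ doublyStochastic ℝ (Fin K)) (n : ℕ) (k : Fin K) (ω : Ω) :
    p.diffusion A I B μ w₀ n k ω = wstar + p.errorProc wstar A A I B μ w₀ n ω k := by
  induction n generalizing k with
  | zero => simp [diffusion, errorProc]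
  | succ n ih =>
    simp only [diffusion, errorProc, ih, add_sub_assoc, sum_smul_add_of_doublyStochastic hA,
      PiLp.sub_apply, PiLp.smul_apply, mix_apply, smul_sub, Finset.sum_sub_distrib,
      Finset.smul_sum]
    congr 2
    exact Finset.sum_congr rfl fun l _ => smul_comm _ _ _

lemma isPast_errorProc (hp : p.IsSmooth L) (n : ℕ) :
    IsPast (fun ω k => w₀ k ω) I n (p.errorProc wstar A D I B μ w₀ n) := by
  induction n with
  | zero =>
    intro t _
    have h := measurable_start_exceptDraw (w₀ := fun ω k => w₀ k ω) (I := I) t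
    exact measurable_netState fun k => ((measurable_pi_apply k).comp h).sub_const wstar
  | succ n ih =>
    have h1 : IsPast (fun ω k => w₀ k ω) I (n + 1)
        (netBatch I B n fun k i ω => p.gradQ k i (wstar + p.errorProc wstar A D I B μ w₀ n ω k)) :=
      isPast_succ_netBatch fun k i => ih.comp
        (φ := fun w : NetState K M => p.gradQ k i (wstar + w k))
        ((hp.lipschitz k i).continuous.measurable.comp
          ((measurable_netState_apply k).const_add wstar))
    intro t ht
    exact ((mix A).continuous.measurable.comp (ih.mono n.le_succ t ht)).sub
      (((mix D).continuous.measurable.comp (h1 t ht)).const_smul μ)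

variable (p) in
/-- A bound for the gradient noise at `wstar`. -/
noncomputable def noiseBound : ℝ := ∑ k, ∑ i, ‖p.noise k i wstar‖

lemma noiseBound_nonneg : 0 ≤ p.noiseBound wstar := by unfold noiseBound; positivity

lemma norm_noise_le (k : Fin K) (i : Fin (p.N k)) :
    ‖p.noise k i wstar‖ ≤ p.noiseBound wstar :=
  (Finset.single_le_sum (f := fun i => ‖p.noise k i wstar‖) (fun _ _ => norm_nonneg _)
    (Finset.mem_univ i)).trans
    (Finset.single_le_sum (f := fun k => ∑ i, ‖p.noise k i wstar‖)
      (fun _ _ => by positivity) (Finset.mem_univ k))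

lemma norm_sq_netBatch_noise_le (n : ℕ) (ω : Ω) :
    ‖netBatch I B n (fun k i _ => p.noise k i wstar) ω‖ ^ 2 ≤ K * p.noiseBound wstar ^ 2 := by
  have h := norm_netBatch_sq_le (I := I) (B := B) (n := n) (ω := ω)
    (g := fun k i _ => p.noise k i wstar) (c := fun _ => p.noiseBound wstar)
    (fun _ => noiseBound_nonneg wstar) (fun k i => norm_noise_le wstar k i)
  rwa [Finset.sum_const, Finset.card_univ, Fintype.card_fin, nsmul_eq_mul] at h

lemma memLp_netBatch_noise (hI : ∀ k n b, Measurable (I k n b)) (B n : ℕ) :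
    MemLp (netBatch I B n fun k i _ => p.noise k i wstar) 2 P := by
  have h : Measurable (netBatch I B n fun k i _ => p.noise k i wstar) :=
    measurable_netState fun k => measurable_batchAvg (hI k n) fun _ => measurable_const
  exact MemLp.of_bound h.aestronglyMeasurable (√(K * p.noiseBound wstar ^ 2))
    (ae_of_all _ fun ω => Real.le_sqrt_of_sq_le (norm_sq_netBatch_noise_le wstar n ω))

variable (P) in
/-- The gradient noise of all agents at `wstar`. -/
noncomputable def noiseProc (hI : ∀ k n b, Measurable (I k n b)) (B n : ℕ) :
    SqInt P (NetState K M) :=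
  ⟨netBatch I B n fun k i _ => p.noise k i wstar, memLp_netBatch_noise wstar hI B n⟩

lemma norm_netBatch_gradQ_sub_le (hp : p.IsSmooth L) (n : ℕ) (w : Ω → NetState K M) (ω : Ω) :
    ‖netBatch I B n (fun k i ω => p.gradQ k i (wstar + w ω k) - p.gradQ k i wstar) ω‖
      ≤ L * ‖w ω‖ := by
  refine le_of_sq_le_sq ?_ (by positivity)
  have h := norm_netBatch_sq_le (I := I) (B := B) (n := n) (ω := ω)
    (g := fun k i ω => p.gradQ k i (wstar + w ω k) - p.gradQ k i wstar)
    (c := fun k => L * ‖w ω k‖) (fun k => by positivity) (fun k i => by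
      have := (hp.lipschitz k i).norm_sub_le (wstar + w ω k) wstar
      rwa [add_sub_cancel_left] at this)
  simp only [mul_pow, ← Finset.mul_sum] at h
  rwa [mul_pow, PiLp.norm_sq_eq_of_L2 _ (w ω)]

/-- Lipschitz gradients make each increment at most linear in the error, up to bounded noise and
bias, so square integrability propagates. -/
lemma memLp_errorProc (hp : p.IsSmooth L) (hS : IsSampling P (fun ω k => w₀ k ω) I) (hB : 1 ≤ B)
    (h0 : ∀ k, MemLp (w₀ k) 2 P) (k₀ : Fin K) (n : ℕ) :
    MemLp (p.errorProc wstar A D I B μ w₀ n) 2 P := by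
  induction n with
  | zero => exact (memLp_piLp_iff (p := 2)).2 fun k => (h0 k).sub (memLp_const wstar)
  | succ n ih =>
    have h1 : MemLp (netBatch I B n fun k i ω => p.gradQ k i
        (wstar + p.errorProc wstar A D I B μ w₀ n ω k) - p.gradQ k i wstar) 2 P := by
      refine MemLp.of_le (ih.const_smul (L : ℝ)) ?_ (ae_of_all _ fun ω => ?_)
      · refine (IsPast.measurable (n := n + 1) hS (isPast_succ_netBatch fun k i =>
          IsPast.comp (isPast_errorProc wstar hp n)
          (φ := fun w : NetState K M => p.gradQ k i (wstar + w k) - p.gradQ k i wstar) ?_)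
          k₀).aestronglyMeasurable
        exact ((hp.lipschitz k i).continuous.measurable.comp
          ((measurable_netState_apply k).const_add wstar)).sub_const _
      · refine (norm_netBatch_gradQ_sub_le wstar hp n _ ω).trans_eq ?_
        simp [norm_smul]
    have h2 : MemLp (fun ω => (WithLp.toLp 2 fun k => p.batchGrad I B n k
        (wstar + p.errorProc wstar A D I B μ w₀ n ω k) ω : NetState K M)) 2 P := by
      rw [funext (batchGrad_add wstar hB n _)]
      have h3 : MemLp (fun _ : Ω => p.bias wstar) 2 P := memLp_const _
      have h4 : MemLp (netBatch I B n fun k i _ => p.noise k i wstar) 2 P :=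
        memLp_netBatch_noise wstar hS.measurable B n
      exact (h3.add h4).add h1
    have h5 : MemLp (fun ω => mix A (p.errorProc wstar A D I B μ w₀ n ω)) 2 P :=
      ih.continuousLinearMap_comp (mix A)
    have h6 := (h2.continuousLinearMap_comp (mix D)).const_smul μ
    exact h5.sub h6

end Iterates

end Problem

/-! ### The iterations as abstract noisy recursions -/

namespace Problem

variable {K M : ℕ} {X : Type u} {p : Problem K M X} (wstar : Vec M) {L : ℝ≥0}
  {Ω : Type v} [MeasurableSpace Ω] {P : Measure Ω} [IsProbabilityMeasure P]
  {I : ∀ k : Fin K, ℕ → ℕ → Ω → Fin (p.N k)} {B : ℕ}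
  {A D : Matrix (Fin K) (Fin K) ℝ} {μ : ℝ} {w₀ : Fin K → Ω → Vec M}

lemma norm_toLp_le {f : Fin K → Vec M} {w : NetState K M} {c : ℝ} (hc : 0 ≤ c)
    (h : ∀ k, ‖f k‖ ≤ c * ‖w k‖) : ‖(WithLp.toLp 2 f : NetState K M)‖ ≤ c * ‖w‖ := by
  refine le_of_sq_le_sq ?_ (by positivity)
  rw [mul_pow, PiLp.norm_sq_eq_of_L2 _ w, PiLp.norm_sq_eq_of_L2, Finset.mul_sum]
  refine Finset.sum_le_sum fun k _ => ?_
  rw [← mul_pow]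
  exact pow_le_pow_left₀ (norm_nonneg _) (h k) 2

lemma norm_remainder_le (hp : p.IsSmooth L) (w : NetState K M) :
    ‖p.remainder wstar w‖ ≤ 2 * L * ‖w‖ :=
  norm_toLp_le (by positivity) fun k =>
    norm_gradient_remainder_le (hp.lipschitz_Jk k) wstar (w k)

/-- The networked iterations fit the abstract noisy recursion. -/
lemma exists_isIteration (hp : p.IsSmooth L) (hS : IsSampling P (fun ω k => w₀ k ω) I)
    (hB : 1 ≤ B) (h0 : ∀ k, MemLp (w₀ k) 2 P) (k₀ : Fin K) :
    ∃ W R Φ : ℕ → SqInt P (NetState K M),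
      IsIteration (fun ω k => w₀ k ω) I A D (fun k => p.hess k wstar) (p.bias wstar) L
        (K * p.noiseBound wstar ^ 2) B μ W (noiseProc wstar P hS.measurable B) R Φ ∧
      (∀ n, (W n).1 = p.errorProc wstar A D I B μ w₀ n) ∧
      ∀ n ω, (R n).1 ω = p.remainder wstar ((W n).1 ω) := by
  set e := p.errorProc wstar A D I B μ w₀ with he
  have hpast : ∀ n, IsPast (fun ω k => w₀ k ω) I n (e n) := isPast_errorProc wstar hp
  have hmem : ∀ n, MemLp (e n) 2 P := memLp_errorProc wstar hp hS hB h0 k₀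
  have hmemk : ∀ n k, MemLp (fun ω => e n ω k) 2 P := fun n =>
    (memLp_piLp_iff (p := 2)).1 (hmem n)
  have hRm : Measurable (p.remainder wstar) := (hp.continuous_remainder wstar).measurable
  have hRp : ∀ n, IsPast (fun ω k => w₀ k ω) I n fun ω => p.remainder wstar (e n ω) := fun n =>
    (hpast n).comp hRm
  have hRmem : ∀ n, MemLp (fun ω => p.remainder wstar (e n ω)) 2 P := fun n => by
    refine MemLp.of_le ((hmem n).const_smul (2 * L : ℝ))
      ((hRp n).measurable hS k₀).aestronglyMeasurable (ae_of_all _ fun ω => ?_)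
    refine (norm_remainder_le wstar hp (e n ω)).trans_eq ?_
    simp [norm_smul]
  have hfp : ∀ n k i, IsPast (fun ω k => w₀ k ω) I n
      fun ω => p.noise k i (wstar + e n ω k) - p.noise k i wstar := fun n k i =>
    (hpast n).comp (φ := fun w : NetState K M => p.noise k i (wstar + w k) - p.noise k i wstar)
      (((hp.continuous_noise k i).measurable.comp
        ((measurable_netState_apply k).const_add wstar)).sub_const _)
  have hfρ : ∀ n k, MemLp (fun ω => 2 * L * ‖e n ω k‖) 2 P := fun n k =>
    (hmemk n k).norm.const_mul _
  have hfb : ∀ n k i ω, ‖p.noise k i (wstar + e n ω k) - p.noise k i wstar‖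
      ≤ 2 * L * ‖e n ω k‖ := fun n k i ω => hp.norm_noise_sub_le k i wstar _
  have hfs : ∀ n k ω, ∑ i, (p.noise k i (wstar + e n ω k) - p.noise k i wstar) = 0 :=
    fun n k ω => by rw [Finset.sum_sub_distrib, hp.sum_noise, hp.sum_noise, sub_zero]
  have hΦmem : ∀ n, MemLp (netBatch I B n
      fun k i ω => p.noise k i (wstar + e n ω k) - p.noise k i wstar) 2 P := fun n =>
    hS.memLp_netBatch (hfp n) (hfρ n) (hfb n)
  have hzp : ∀ n k (i : Fin (p.N k)), IsPast (fun ω k => w₀ k ω) I n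
      fun _ : Ω => p.noise k i wstar := fun n k i _ _ => measurable_const
  have hzρ : ∀ k : Fin K, MemLp (fun _ : Ω => p.noiseBound wstar) 2 P := fun k => memLp_const _
  have hzb : ∀ k (i : Fin (p.N k)) (_ : Ω), ‖p.noise k i wstar‖ ≤ p.noiseBound wstar :=
    fun k i _ => norm_noise_le wstar k i
  have hzs : ∀ k (_ : Ω), ∑ i, p.noise k i wstar = 0 := fun k _ => hp.sum_noise k wstar
  have hconst : ∀ c : ℝ, ∑ _k : Fin K, c = K * c := fun c => by simp
  refine ⟨fun n => ⟨e n, hmem n⟩, fun n => ⟨_, hRmem n⟩, fun n => ⟨_, hΦmem n⟩,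
    ⟨?_, hpast, hRp, ?_, ?_, ?_, ?_, ?_, ?_, ?_, ?_⟩, fun _ => rfl, fun _ _ => rfl⟩
  · intro n
    ext ω : 1
    have h1 := batchGrad_add (I := I) wstar hB n (e n) ω
    rw [netBatch_gradQ_sub wstar hB] at h1
    have h2 : e (n + 1) ω = mix A (e n ω) - μ • mix D
      (WithLp.toLp 2 fun k => p.batchGrad I B n k (wstar + e n ω k) ω) := rfl
    rw [h1] at h2
    exact h2
  · intro n
    exact isPast_succ_netBatch (hzp n)
  · intro n
    refine SqInt.norm_le_mul_norm L.2 fun ω => ?_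
    have h1 := norm_netBatch_gradQ_sub_le (I := I) (B := B) wstar hp n (e n) ω
    rw [netBatch_gradQ_sub wstar hB] at h1
    exact h1
  · intro n Y hY
    exact hS.integral_inner_netBatch_eq_zero (hzp n) hzρ hzb hzs hY Y.2
  · intro n Y hY
    exact hS.integral_inner_netBatch_eq_zero (hfp n) (hfρ n) (hfb n) (hfs n) hY Y.2
  · intro n
    rw [SqInt.norm_sq]
    refine (hS.integral_norm_sq_netBatch_le hB (hzp n) hzρ hzb hzs).trans_eq ?_
    simp
  · intro n
    rw [SqInt.norm_sq, SqInt.norm_sq]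
    refine (hS.integral_norm_sq_netBatch_le hB (hfp n) (hfρ n) (hfb n) (hfs n)).trans_eq ?_
    rw [← integral_const_mul]
    congr 1
    refine integral_congr_ae (ae_of_all _ fun ω => ?_)
    simp only
    rw [PiLp.norm_sq_eq_of_L2 _ (e n ω), Finset.mul_sum]
    exact Finset.sum_congr rfl fun k _ => by ring
  · intro n ω
    exact norm_sq_netBatch_noise_le wstar n ω
  -- Scaling the noise fields by ‖Y‖ leaves them determined by the past and with zero sum over
  -- samples, so the unweighted variance bound applies to the scaled fields.
  · intro n Y hY
    have h1 := hS.integral_norm_sq_netBatch_le (n := n)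
      (g := fun k i ω => ‖Y.1 ω‖ • p.noise k i wstar)
      (ρ := fun _ ω => ‖Y.1 ω‖ * p.noiseBound wstar) hB
      (fun k i => hY.comp (φ := fun y : NetState K M => ‖y‖ • p.noise k i wstar)
        (measurable_norm.smul_const _))
      (fun k => (Y.2 : MemLp Y.1 2 P).norm.mul_const _)
      (fun k i ω => by
        rw [norm_smul, norm_norm]
        exact mul_le_mul_of_nonneg_left (norm_noise_le wstar k i) (norm_nonneg _))
      (fun k ω => by rw [← Finset.smul_sum, hp.sum_noise, smul_zero])
    have h2 : ∀ ω, ‖netBatch I B n (fun k i ω => ‖Y.1 ω‖ • p.noise k i wstar) ω‖ ^ 2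
        = ‖Y.1 ω‖ ^ 2 * ‖(noiseProc wstar P hS.measurable B n).1 ω‖ ^ 2 := fun ω => by
      have h3 : netBatch I B n (fun k i ω => ‖Y.1 ω‖ • p.noise k i wstar) ω
          = ‖Y.1 ω‖ • (noiseProc wstar P hS.measurable B n).1 ω := by
        ext1 k
        exact batchAvg_smul n k (fun ω => ‖Y.1 ω‖) (fun i _ => p.noise k i wstar) ω
      rw [h3, norm_smul, norm_norm, mul_pow]
    simp only [h2, hconst] at h1
    refine h1.trans_eq ?_
    rw [integral_const_mul, SqInt.norm_sq]
    simp only [mul_pow]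
    rw [integral_mul_const]
    ring

end Problem

/-! ### Risks, Hessians and starting points -/

namespace Problem

variable {K M : ℕ} {X : Type u} {p : Problem K M X} {wstar : Vec M} {L : ℝ≥0}

lemma IsSmooth.norm_hess_le (hp : p.IsSmooth L) (k : Fin K) : ‖p.hess k wstar‖ ≤ L :=
  norm_fderiv_gradient_le (hp.lipschitz_Jk k) wstar

lemma IsSmooth.norm_avgHess_le (hp : p.IsSmooth L) : ‖p.avgHess wstar‖ ≤ L := by
  rw [← hp.fderiv_gradient_J]
  exact norm_fderiv_gradient_le hp.lipschitz_J wstar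

lemma IsSmooth.inner_hess_comm (hp : p.IsSmooth L) (k : Fin K) (x y : Vec M) :
    inner ℝ (p.hess k wstar x) y = inner ℝ x (p.hess k wstar y) :=
  inner_fderiv_gradient_comm (hp.contDiff_Jk k) wstar x y

lemma IsSmooth.inner_avgHess_comm (hp : p.IsSmooth L) (x y : Vec M) :
    inner ℝ (p.avgHess wstar x) y = inner ℝ x (p.avgHess wstar y) := by
  rw [← hp.fderiv_gradient_J]
  exact inner_fderiv_gradient_comm hp.contDiff_J wstar x y

lemma gradient_eq_zero_of_isLocalMin {f : Vec M → ℝ} {w : Vec M} (h : IsLocalMin f w) :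
    gradient f w = 0 := by
  rw [gradient, h.fderiv_eq_zero, map_zero]

lemma IsSmooth.avgOp_bias (hp : p.IsSmooth L) (hmin : IsLocalMin p.J wstar) :
    avgOp (p.bias wstar) = 0 := by
  ext1 k
  rw [avgOp_apply]
  change (K : ℝ)⁻¹ • ∑ l, gradient (p.Jk l) wstar = 0
  rw [← hp.gradient_J, gradient_eq_zero_of_isLocalMin hmin]

/-- The expansions of all gradients at `wstar` are accurate on a common ball. -/
lemma IsSmooth.exists_radius (hp : p.IsSmooth L) (wstar : Vec M) {δ : ℝ} (hδ : 0 < δ) :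
    ∃ ρ : ℝ, 0 < ρ ∧ (∀ k v, ‖v‖ ≤ ρ → ‖gradient (p.Jk k) (wstar + v) - gradient (p.Jk k) wstar
        - p.hess k wstar v‖ ≤ δ * ‖v‖) ∧
      ∀ v, ‖v‖ ≤ ρ → ‖gradient p.J (wstar + v) - gradient p.J wstar - p.avgHess wstar v‖
        ≤ δ * ‖v‖ := by
  choose r hr h using fun k => exists_radius_gradient_remainder_le (hp.contDiff_Jk k) wstar hδ
  obtain ⟨r', hr', h'⟩ := exists_radius_gradient_remainder_le hp.contDiff_J wstar hδ
  rw [hp.fderiv_gradient_J] at h'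
  have hev : ∀ᶠ ρ in 𝓝[>] (0 : ℝ), 0 < ρ ∧ (∀ k, ρ ≤ r k) ∧ ρ ≤ r' := by
    refine (eventually_mem_nhdsWithin).and (.and ?_ ?_)
    · exact eventually_all.2 fun k =>
        eventually_of_mem (Ioc_mem_nhdsGT (hr k)) fun _ hx => hx.2
    · exact eventually_of_mem (Ioc_mem_nhdsGT hr') fun _ hx => hx.2
  obtain ⟨ρ, h0, h1, h2⟩ := hev.exists
  exact ⟨ρ, h0, fun k v hv => h k v (hv.trans (h1 k)), fun v hv => h' v (hv.trans h2)⟩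

/-- The linearization is used inside the ball and the Lipschitz bound outside. The ball is taken for
the whole network state, which dominates each agent. -/
lemma norm_remainder_le_add_tail (hp : p.IsSmooth L) {δ ρ : ℝ} (hδ : 0 ≤ δ)
    (hρ : ∀ k v, ‖v‖ ≤ ρ → ‖gradient (p.Jk k) (wstar + v) - gradient (p.Jk k) wstar
        - p.hess k wstar v‖ ≤ δ * ‖v‖) (w : NetState K M) :
    ‖p.remainder wstar w‖ ≤ δ * ‖w‖ + 2 * L * tail ρ w := by
  by_cases hw : ‖w‖ ≤ ρ
  · rw [tail, if_pos hw, mul_zero, add_zero]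
    exact norm_toLp_le hδ fun k => hρ k _ ((PiLp.norm_apply_le w k).trans hw)
  · rw [tail, if_neg hw]
    have := norm_remainder_le wstar hp w
    have : 0 ≤ δ * ‖w‖ := by positivity
    linarith

variable (p wstar) in
/-- Sum over the agents of the excess of the aggregate risk. -/
noncomputable def riskGap (w : NetState K M) : ℝ := ∑ k, (p.J (wstar + w k) - p.J wstar)

lemma IsSmooth.abs_J_sub_quadratic_le (hp : p.IsSmooth L) (hmin : IsLocalMin p.J wstar) {c : ℝ}
    {v : Vec M} (h : ∀ u : Vec M, ‖u‖ ≤ ‖v‖ →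
      ‖gradient p.J (wstar + u) - gradient p.J wstar - p.avgHess wstar u‖ ≤ c * ‖u‖) :
    |p.J (wstar + v) - p.J wstar - inner ℝ (p.avgHess wstar v) v / 2| ≤ c * ‖v‖ ^ 2 := by
  refine abs_sub_quadratic_le hp.contDiff_J _ fun u hu => ?_
  have := h u hu
  rwa [gradient_eq_zero_of_isLocalMin hmin, sub_zero] at this

lemma IsSmooth.abs_J_sub_quadratic_le_two (hp : p.IsSmooth L) (hmin : IsLocalMin p.J wstar)
    (v : Vec M) :
    |p.J (wstar + v) - p.J wstar - inner ℝ (p.avgHess wstar v) v / 2| ≤ 2 * L * ‖v‖ ^ 2 := by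
  refine hp.abs_J_sub_quadratic_le hmin fun u _ => ?_
  rw [← hp.fderiv_gradient_J]
  exact norm_gradient_remainder_le hp.lipschitz_J wstar u

lemma IsSmooth.abs_riskGap_sub_le (hp : p.IsSmooth L) (hmin : IsLocalMin p.J wstar) {δ ρ : ℝ}
    (hδ : 0 ≤ δ) (hρ : ∀ v, ‖v‖ ≤ ρ →
      ‖gradient p.J (wstar + v) - gradient p.J wstar - p.avgHess wstar v‖ ≤ δ * ‖v‖)
    (w : NetState K M) :
    |p.riskGap wstar w - inner ℝ (blockDiag (fun _ => p.avgHess wstar) w) w / 2|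
      ≤ δ * ‖w‖ ^ 2 + 2 * L * tail ρ w ^ 2 := by
  have h1 : p.riskGap wstar w - inner ℝ (blockDiag (fun _ => p.avgHess wstar) w) w / 2
      = ∑ k, (p.J (wstar + w k) - p.J wstar - inner ℝ (p.avgHess wstar (w k)) (w k) / 2) := by
    rw [PiLp.inner_apply, Finset.sum_div, riskGap, ← Finset.sum_sub_distrib]
    rfl
  have h2 : ∀ c : ℝ, (∀ k, |p.J (wstar + w k) - p.J wstar
      - inner ℝ (p.avgHess wstar (w k)) (w k) / 2| ≤ c * ‖w k‖ ^ 2) →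
      |p.riskGap wstar w - inner ℝ (blockDiag (fun _ => p.avgHess wstar) w) w / 2|
        ≤ c * ‖w‖ ^ 2 := fun c hc => by
    rw [h1, PiLp.norm_sq_eq_of_L2, Finset.mul_sum]
    exact (Finset.abs_sum_le_sum_abs _ _).trans (Finset.sum_le_sum fun k _ => hc k)
  by_cases hw : ‖w‖ ≤ ρ
  · refine (h2 δ fun k => hp.abs_J_sub_quadratic_le hmin fun u hu => hρ u
      (hu.trans ((PiLp.norm_apply_le w k).trans hw))).trans ?_
    have : 0 ≤ 2 * L * tail ρ w ^ 2 := by positivity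
    linarith
  · refine (h2 (2 * L) fun k => hp.abs_J_sub_quadratic_le_two hmin _).trans ?_
    rw [tail, if_neg hw]
    have : 0 ≤ δ * ‖w‖ ^ 2 := by positivity
    linarith

section Risk

variable {Ω : Type v} [MeasurableSpace Ω] {P : Measure Ω} [IsProbabilityMeasure P]
  {I : ∀ k : Fin K, ℕ → ℕ → Ω → Fin (p.N k)}

/-- A Lipschitz gradient limits the risk to quadratic growth. -/
lemma IsSmooth.integrable_J (hp : p.IsSmooth L) (hmin : IsLocalMin p.J wstar) {f : Ω → Vec M}
    (hf : MemLp f 2 P) : Integrable (fun ω => p.J (wstar + f ω)) P := by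
  have h1 : Integrable (fun ω => ‖f ω‖ ^ 2) P := hf.integrable_norm_pow (by norm_num)
  refine Integrable.mono' ((integrable_const |p.J wstar|).add (h1.const_mul (3 * (L : ℝ))))
    ((hp.contDiff_J.continuous.comp (continuous_const.add
      continuous_id)).comp_aestronglyMeasurable hf.1) (ae_of_all _ fun ω => ?_)
  have h2 := hp.abs_J_sub_quadratic_le_two hmin (f ω)
  have h3 : |inner ℝ (p.avgHess wstar (f ω)) (f ω)| ≤ L * ‖f ω‖ ^ 2 := by
    calc _ ≤ ‖p.avgHess wstar (f ω)‖ * ‖f ω‖ := abs_real_inner_le_norm _ _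
      _ ≤ (L * ‖f ω‖) * ‖f ω‖ := by
          gcongr
          exact (p.avgHess wstar).le_of_opNorm_le hp.norm_avgHess_le _
      _ = _ := by ring
  have h4 : 0 ≤ L * ‖f ω‖ ^ 2 := by positivity
  simp only [Pi.add_apply, Real.norm_eq_abs]
  have h5 := neg_abs_le (p.J wstar)
  have h6 := le_abs_self (p.J wstar)
  rw [abs_le] at h2 h3 ⊢
  constructor <;> linarith [h2.1, h2.2, h3.1, h3.2]

lemma IsSmooth.integral_riskGap (hp : p.IsSmooth L) (hmin : IsLocalMin p.J wstar)
    {w : Ω → NetState K M} (hw : MemLp w 2 P) :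
    Integrable (fun ω => p.riskGap wstar (w ω)) P ∧
      ∫ ω, p.riskGap wstar (w ω) ∂P
        = ∑ k, ∫ ω, p.J (wstar + w ω k) ∂P - K * p.J wstar := by
  have h1 : ∀ k, Integrable (fun ω => p.J (wstar + w ω k) - p.J wstar) P := fun k =>
    (hp.integrable_J hmin ((memLp_piLp_iff (p := 2)).1 hw k)).sub (integrable_const _)
  refine ⟨integrable_finsetSum _ fun k _ => h1 k, ?_⟩
  simp only [riskGap]
  rw [integral_finsetSum _ fun k _ => h1 k]
  have h2 : ∀ k, ∫ ω, (p.J (wstar + w ω k) - p.J wstar) ∂P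
      = ∫ ω, p.J (wstar + w ω k) ∂P - p.J wstar := fun k => by
    rw [integral_sub (hp.integrable_J hmin ((memLp_piLp_iff (p := 2)).1 hw k))
      (integrable_const _)]
    simp
  simp [h2, Finset.sum_sub_distrib]

lemma IsCloseStart.isSampling {B : ℝ → ℕ} {w₀ : ℝ → Fin K → Ω → Vec M}
    (h : p.IsCloseStart P I B wstar w₀) (hI : p.IsUniformSampling P I) {μ : ℝ} (hμ : 0 < μ) :
    IsSampling P (fun ω k => w₀ μ k ω) I :=
  ⟨measurable_pi_iff.2 (h.measurable μ hμ), hI.measurable, hI.uniform, hI.indep, h.indep μ hμ⟩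

lemma IsCloseStart.memLp_two {B : ℝ → ℕ} {w₀ : ℝ → Fin K → Ω → Vec M}
    (h : p.IsCloseStart P I B wstar w₀) {μ : ℝ} (hμ : 0 < μ) (k : Fin K) :
    MemLp (w₀ μ k) 2 P := (h.memLp μ hμ k).mono_exponent (by norm_num)

/-- The second moments of the starting errors are `o(μ / B)`. -/
lemma IsCloseStart.eventually_integral_norm_sq_le {B : ℝ → ℕ} {w₀ : ℝ → Fin K → Ω → Vec M}
    (h : p.IsCloseStart P I B wstar w₀) (hB : ∀ μ, 0 < μ → 1 ≤ B μ) {t : ℝ} (ht : 0 < t) :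
    ∀ᶠ μ in 𝓝[>] (0 : ℝ), ∑ k, ∫ ω, ‖w₀ μ k ω - wstar‖ ^ 2 ∂P ≤ t * (μ / B μ) := by
  -- The allowance `t` is shared among the agents; adding one avoids a division by zero.
  set s := t / (K + 1) with hs
  have hs0 : 0 < s := by positivity
  have h1 : ∀ᶠ μ in 𝓝[>] (0 : ℝ), ∀ k, ‖∫ ω, ‖w₀ μ k ω - wstar‖ ^ 4 ∂P‖
      ≤ s ^ 2 * ‖μ ^ 2 / (B μ : ℝ) ^ 2‖ :=
    eventually_all.2 fun k => (h.close k).def (by positivity)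
  filter_upwards [h1, self_mem_nhdsWithin] with μ h1 hμ
  have hμ : 0 < μ := hμ
  have hB0 : (0 : ℝ) < B μ := by exact_mod_cast hB μ hμ
  set a := s * (μ / B μ) with ha
  have ha0 : 0 < a := by positivity
  have h2 : ∀ k, ∫ ω, ‖w₀ μ k ω - wstar‖ ^ 2 ∂P ≤ a := fun k => by
    have h3 : ∫ ω, ‖w₀ μ k ω - wstar‖ ^ 4 ∂P ≤ a ^ 2 := by
      refine (Real.le_norm_self _).trans ((h1 k).trans_eq ?_)
      rw [Real.norm_of_nonneg (by positivity), ha]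
      ring
    have h4 : MemLp (fun ω => w₀ μ k ω - wstar) 4 P := (h.memLp μ hμ k).sub (memLp_const _)
    have h5 : Integrable (fun ω => ‖w₀ μ k ω - wstar‖ ^ 4) P :=
      h4.integrable_norm_pow (p := 4) (by norm_num)
    have h6 : Integrable (fun ω => ‖w₀ μ k ω - wstar‖ ^ 2) P :=
      (h4.mono_exponent (by norm_num : (2 : ENNReal) ≤ 4)).integrable_norm_pow (p := 2)
        (by norm_num)
    -- The arithmetic-geometric mean inequality at level `a`, the target size of the second moment,
    -- converts the fourth moment bound a².
    calc _ ≤ ∫ ω, (a / 2 + (2 * a)⁻¹ * ‖w₀ μ k ω - wstar‖ ^ 4) ∂P := by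
          refine integral_mono h6 ((integrable_const _).add (h5.const_mul _)) fun ω => ?_
          simp only
          have h7 := sq_nonneg (‖w₀ μ k ω - wstar‖ ^ 2 - a)
          have h8 : (a / 2 + (2 * a)⁻¹ * ‖w₀ μ k ω - wstar‖ ^ 4) - ‖w₀ μ k ω - wstar‖ ^ 2
              = (2 * a)⁻¹ * (‖w₀ μ k ω - wstar‖ ^ 2 - a) ^ 2 := by field_simp; ring
          have h9 : 0 ≤ (2 * a)⁻¹ * (‖w₀ μ k ω - wstar‖ ^ 2 - a) ^ 2 := by positivity
          linarith
      _ = a / 2 + (2 * a)⁻¹ * ∫ ω, ‖w₀ μ k ω - wstar‖ ^ 4 ∂P := by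
          rw [integral_add (integrable_const _) (h5.const_mul _), integral_const_mul]
          simp
      _ ≤ a / 2 + (2 * a)⁻¹ * a ^ 2 := by gcongr
      _ = a := by field_simp; ring
  calc _ ≤ ∑ _k : Fin K, a := Finset.sum_le_sum fun k _ => h2 k
    _ = K * a := by simp
    _ ≤ (K + 1) * a := by gcongr; linarith
    _ = _ := by rw [ha, hs]; field_simp

end Risk

end Problem

/-! ### Comparison of consensus and diffusion -/

lemma eventually_mul_le {a b : ℝ} (ha : 0 ≤ a) (hb : 0 < b) :
    ∀ᶠ μ in 𝓝[>] (0 : ℝ), μ * a ≤ b := by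
  have h : 0 < b / (a + 1) := by positivity
  refine eventually_of_mem (Ioc_mem_nhdsGT h) fun μ hμ => ?_
  have h1 := hμ.2
  rw [le_div_iff₀ (by positivity)] at h1
  have := hμ.1
  linarith

namespace Problem

variable {K M : ℕ} {X : Type u} {p : Problem K M X} {wstar : Vec M} {L : ℝ≥0}
  {A D : Matrix (Fin K) (Fin K) ℝ} {σ : ℝ}

variable (p wstar) in
/-- Contribution of the gradient bias to twice the summed excess risk after `n` steps. -/
noncomputable def biasEnergy (A D : Matrix (Fin K) (Fin K) ℝ) (μ : ℝ) (n : ℕ) : ℝ :=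
  inner ℝ (blockDiag (fun _ => p.avgHess wstar)
      (biasCentroid A D (fun k => p.hess k wstar) μ (p.bias wstar) n))
      (biasCentroid A D (fun k => p.hess k wstar) μ (p.bias wstar) n)
    + inner ℝ (blockDiag (fun _ => p.avgHess wstar) (biasDev A D μ (p.bias wstar) n))
      (biasDev A D μ (p.bias wstar) n)

/-- Contraction for the deviation and positive definiteness for the centroid keep the bias of order
μ at all times, hence within ρ/4 for small μ. -/
lemma norm_bias_path_le (hp : p.IsSmooth L) (hmin : IsLocalMin p.J wstar)
    (hA : A ∈ doublyStochastic ℝ (Fin K)) (hs : A.IsSymm)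
    (hD : D ∈ doublyStochastic ℝ (Fin K)) (hDs : D.IsSymm)
    {r : ℝ} (hr0 : 0 ≤ r) (hr1 : r < 1)
    (hr : ∀ x : Fin K → ℝ, ∑ k, x k = 0 →
      ∑ k, (A.mulVec x k) ^ 2 ≤ r ^ 2 * ∑ l, x l ^ 2) (hσ : 0 < σ)
    (hpos : ∀ v : Vec M, σ * ‖v‖ ^ 2 ≤ inner ℝ (p.avgHess wstar v) v)
    {μ : ℝ} (hμ : 0 ≤ μ) (hμL : μ * L ≤ 1) (hμσ : μ * σ ≤ 1) (n : ℕ) :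
    ‖biasCentroid A D (fun k => p.hess k wstar) μ (p.bias wstar) n
      + biasDev A D μ (p.bias wstar) n‖
      ≤ (L * (‖p.bias wstar‖ / (1 - r)) / σ + ‖p.bias wstar‖ / (1 - r)) * μ := by
  set c := ‖p.bias wstar‖ / (1 - r) with hc
  have h1r : 0 < 1 - r := by linarith
  have hc0 : 0 ≤ c := by positivity
  have hd : ∀ n, ‖biasDev A D μ (p.bias wstar) n‖ ≤ c * μ := fun n =>
    (norm_biasDev_le hA hs hD hDs hr0 hr1 hr (hp.avgOp_bias hmin) hμ n).trans_eq (by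
      rw [hc]; ring)
  have hm := inner_biasCentroid_le (A := A) (D := D) (H := fun k => p.hess k wstar)
    (b := p.bias wstar) (S := L * (c * μ)) rfl hp.inner_avgHess_comm hσ hpos hp.norm_avgHess_le
    hμ hμL hμσ (fun n => (norm_avgOp_le _).trans
      ((norm_blockDiag_le L.2 hp.norm_hess_le _).trans
        (mul_le_mul_of_nonneg_left (hd n) L.2))) n
  set m := biasCentroid A D (fun k => p.hess k wstar) μ (p.bias wstar) n
  have h1 : σ * ‖m‖ ^ 2 ≤ (L * (c * μ)) ^ 2 / σ := by
    refine le_trans ?_ hm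
    rw [PiLp.inner_apply, PiLp.norm_sq_eq_of_L2, Finset.mul_sum]
    exact Finset.sum_le_sum fun k _ => hpos _
  have h2 : ‖m‖ ≤ L * (c * μ) / σ := by
    refine le_of_sq_le_sq ?_ (by positivity)
    rw [le_div_iff₀ hσ] at h1
    rw [div_pow, le_div_iff₀ (by positivity)]
    linarith
  calc _ ≤ ‖m‖ + ‖biasDev A D μ (p.bias wstar) n‖ := norm_add_le _ _
    _ ≤ L * (c * μ) / σ + c * μ := add_le_add h2 (hd n)
    _ = _ := by ring

section Risk

variable {Ω : Type v} [MeasurableSpace Ω] {P : Measure Ω} [IsProbabilityMeasure P]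
  {I : ∀ k : Fin K, ℕ → ℕ → Ω → Fin (p.N k)}

variable (P wstar) in
/-- Contribution of the gradient noise at `wstar` to twice the summed excess risk. -/
noncomputable def noiseEnergy (hI : ∀ k n b, Measurable (I k n b)) (B : ℕ) (μ : ℝ) (n : ℕ) : ℝ :=
  inner ℝ (SqInt.map (blockDiag fun _ => p.avgHess wstar)
      (noiseCentroid (fun k => p.hess k wstar) μ (noiseProc wstar P hI B) n))
    (noiseCentroid (fun k => p.hess k wstar) μ (noiseProc wstar P hI B) n)

/-- The summed excess risk is, up to `o(μ² + μ / B)`, a noise term that is the same for consensus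
and diffusion plus a bias term. -/
lemma eventually_abs_integral_riskGap_sub_le (k₀ : Fin K) (hp : p.IsSmooth L)
    (hmin : IsLocalMin p.J wstar)
    (hA : A ∈ doublyStochastic ℝ (Fin K)) (hs : A.IsSymm)
    (hD : D ∈ doublyStochastic ℝ (Fin K)) (hDs : D.IsSymm)
    {r : ℝ} (hr0 : 0 ≤ r) (hr1 : r < 1)
    (hr : ∀ x : Fin K → ℝ, ∑ k, x k = 0 →
      ∑ k, (A.mulVec x k) ^ 2 ≤ r ^ 2 * ∑ l, x l ^ 2) (hσ : 0 < σ)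
    (hpos : ∀ v : Vec M, σ * ‖v‖ ^ 2 ≤ inner ℝ (p.avgHess wstar v) v)
    (hI : p.IsUniformSampling P I) {B : ℝ → ℕ} (hB : ∀ μ, 0 < μ → 1 ≤ B μ)
    {w₀ : ℝ → Fin K → Ω → Vec M} (h0 : p.IsCloseStart P I B wstar w₀) {T ε : ℝ} (hT : 0 ≤ T)
    (hε : 0 < ε) :
    ∀ᶠ μ in 𝓝[>] (0 : ℝ), ∀ n : ℕ, n * μ ≤ T →
      |∫ ω, p.riskGap wstar (p.errorProc wstar A D I (B μ) μ (w₀ μ) n ω) ∂P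
        - (noiseEnergy wstar P hI.measurable (B μ) μ n + p.biasEnergy wstar A D μ n) / 2|
      ≤ ε * (μ ^ 2 + μ / B μ) := by
  set b := p.bias wstar with hbdef
  set C : ℝ := K * p.noiseBound wstar ^ 2 with hCdef
  have hC : 0 ≤ C := by positivity
  have h1r : 0 < 1 - r := by linarith
  set c := ‖b‖ / (1 - r) with hc
  -- The accuracy δ comes first, then the radius ρ that smoothness grants for it, then the threshold
  -- `t` for the step size.
  obtain ⟨δ, hδ, hδt⟩ := exists_parameters (IsIteration.secondConst_nonneg (c := c) L.2 hC hT)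
    (IsIteration.fourthConst_nonneg (L := (L : ℝ)) hC hT)
    (IsIteration.errConst_nonneg (c := c) (r := r) L.2 hC hT) L.2 hε
  obtain ⟨ρ, hρ, hρk, hρJ⟩ := hp.exists_radius wstar hδ
  obtain ⟨t, ht, ht1, hpar⟩ := hδt ρ hρ
  set c' := L * c / σ + c with hc'
  have hc0 : 0 ≤ c := by positivity
  have hc'0 : 0 ≤ c' := by positivity
  filter_upwards [self_mem_nhdsWithin, eventually_mul_le zero_le_one ht,
    eventually_mul_le L.2 one_pos,
    eventually_mul_le hσ.le one_pos, eventually_mul_le hc'0 (by positivity : 0 < ρ / 4),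
    h0.eventually_integral_norm_sq_le hB ht] with μ hμ hμt hμL hμσ hμρ hμ0 n hn
  have hμ : 0 < μ := hμ
  rw [mul_one] at hμt
  have hS := h0.isSampling hI hμ
  obtain ⟨W, R, Φ, hit, hW, hR⟩ := exists_isIteration (A := A) (D := D) (μ := μ) wstar hp hS
    (hB μ hμ) (h0.memLp_two hμ) k₀
  have hBpos : (0 : ℝ) < B μ := by exact_mod_cast hB μ hμ
  have hBθ : μ / B μ ≤ μ ^ 2 + μ / B μ := by have := sq_nonneg μ; linarith
  have hθ : 0 ≤ μ ^ 2 + μ / B μ := by positivity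
  have hW0 : ‖W 0‖ ^ 2 ≤ t * (μ ^ 2 + μ / B μ) := by
    have e1 : ‖W 0‖ ^ 2 = ∑ k, ∫ ω, ‖w₀ μ k ω - wstar‖ ^ 2 ∂P := by
      have e2 : ∀ k, Integrable (fun ω => ‖w₀ μ k ω - wstar‖ ^ 2) P := fun k =>
        ((h0.memLp_two hμ k).sub (memLp_const wstar)).integrable_norm_pow (p := 2) (by norm_num)
      rw [SqInt.norm_sq, hW 0, ← integral_finsetSum _ fun k _ => e2 k]
      exact integral_congr_ae (ae_of_all _ fun ω => PiLp.norm_sq_eq_of_L2 _ _)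
    rw [e1]
    exact hμ0.trans (by gcongr)
  have hmem : MemLp (p.errorProc wstar A D I (B μ) μ (w₀ μ) n) 2 P :=
    memLp_errorProc wstar hp hS (hB μ hμ) (h0.memLp_two hμ) k₀ n
  have key := hit.abs_integral_risk_sub_le (Hb := p.avgHess wstar) hS k₀ (hB μ hμ) hA hs hD hDs
    hr0 hr1 hr (hp.avgOp_bias hmin) hp.norm_hess_le hp.inner_hess_comm hp.norm_avgHess_le
    hp.inner_avgHess_comm L.2 hC hμ.le (hμt.trans ht1) (c := c) (T := T)
    (fun n => (norm_biasDev_le hA hs hD hDs hr0 hr1 hr (hp.avgOp_bias hmin) hμ.le n).trans_eq (by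
      rw [hc]; ring))
    (hW0.trans (mul_le_of_le_one_left hθ ht1)) hρ hδ
    (fun n => (norm_bias_path_le hp hmin hA hs hD hDs hr0 hr1 hr hσ hpos hμ.le hμL hμσ n).trans
      (by rw [mul_comm]; exact hμρ))
    (fun n ω => by rw [hR n ω]; exact norm_remainder_le_add_tail hp hδ.le hρk _)
    (Ψ := p.riskGap wstar) (n := n) (by rw [hW n]; exact (hp.integral_riskGap hmin hmem).1)
    (hp.abs_riskGap_sub_le hmin hδ.le hρJ) hn
  rw [hW n] at key
  exact key.trans (hpar μ _ _ hμ.le hμt hθ hW0)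

lemma IsSmooth.excessRisk_eq (hp : p.IsSmooth L) (hmin : IsLocalMin p.J wstar) (k₀ : Fin K)
    {w : ℕ → Fin K → Ω → Vec M} {e : ℕ → Ω → NetState K M} {n : ℕ}
    (hw : ∀ k ω, w (n + 1) k ω = wstar + e (n + 1) ω k) (he : MemLp (e (n + 1)) 2 P) :
    p.excessRisk P wstar w n = (K : ℝ)⁻¹ * ∫ ω, p.riskGap wstar (e (n + 1) ω) ∂P := by
  have hK : (K : ℝ) ≠ 0 := by
    have := k₀.pos
    positivity
  rw [(hp.integral_riskGap hmin he).2, excessRisk]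
  simp only [hw]
  field_simp

/-- Comparison of the excess risks, with the gain of diffusion due to heterogeneity. -/
lemma eventually_excessRisk_le (k₀ : Fin K) (hp : p.IsSmooth L) (hmin : IsLocalMin p.J wstar)
    (hA : A ∈ doublyStochastic ℝ (Fin K)) (hs : A.IsSymm)
    {r : ℝ} (hr0 : 0 ≤ r) (hr1 : r < 1)
    (hr : ∀ x : Fin K → ℝ, ∑ k, x k = 0 →
      ∑ k, (A.mulVec x k) ^ 2 ≤ r ^ 2 * ∑ l, x l ^ 2) (hσ : 0 < σ)
    (hpos : ∀ v : Vec M, σ * ‖v‖ ^ 2 ≤ inner ℝ (p.avgHess wstar v) v)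
    {ε₀ : ℝ} (hε₀ : 0 ≤ ε₀) (hε₀' : ε₀ ^ 2 ≤ (1 - r ^ 2) * (1 - r) ^ 4 * σ ^ 2 / 8)
    (hdis : ∀ k, ‖p.hess k wstar - p.avgHess wstar‖ ≤ ε₀)
    (hI : p.IsUniformSampling P I) {B : ℝ → ℕ} (hB : ∀ μ, 0 < μ → 1 ≤ B μ)
    {wcon wdif : ℝ → Fin K → Ω → Vec M} (hcon : p.IsCloseStart P I B wstar wcon)
    (hdif : p.IsCloseStart P I B wstar wdif) {T ε : ℝ} (hT : 0 ≤ T) (hε : 0 < ε) :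
    ∀ᶠ μ in 𝓝[>] (0 : ℝ), ∀ n : ℕ, n ≤ T / μ →
      p.excessRisk P wstar (p.diffusion A I (B μ) μ (wdif μ)) n
          + (K : ℝ)⁻¹ * ((1 - r ^ 2) * (1 - r) ^ 2 * σ / 16 * ‖p.bias wstar‖ ^ 2) * μ ^ 2
        ≤ p.excessRisk P wstar (p.consensus A I (B μ) μ (wcon μ)) n
          + ε * (μ ^ 2 + μ / B μ) := by
  have hK : (0 : ℝ) < K := by exact_mod_cast k₀.pos
  -- `excessRisk` at `n` reads the shifted iterate `n + 1`, whose time (n + 1)μ may exceed T by μ ≤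
  -- 1.
  have hT1 : (0 : ℝ) ≤ T + 1 := by linarith
  -- Two expansions are used, and the excess risk is the sum over agents divided by K.
  have hε2 : 0 < K * ε / 2 := by positivity
  have hcon' := eventually_abs_integral_riskGap_sub_le (D := 1) k₀ hp hmin hA hs
    (one_mem (doublyStochastic ℝ (Fin K))) Matrix.isSymm_one hr0 hr1 hr hσ hpos hI hB hcon hT1 hε2
  have hdif' := eventually_abs_integral_riskGap_sub_le (D := A) k₀ hp hmin hA hs hA hs hr0 hr1 hr
    hσ hpos hI hB hdif hT1 hε2
  filter_upwards [hcon', hdif', self_mem_nhdsWithin, eventually_mul_le zero_le_one one_pos,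
    eventually_mul_le L.2 one_pos, eventually_mul_le hσ.le one_pos]
    with μ hcon' hdif' hμ hμ1 hμL hμσ n hn
  have hμ : 0 < μ := hμ
  have hn' : ((n + 1 : ℕ) : ℝ) * μ ≤ T + 1 := by
    rw [le_div_iff₀ hμ] at hn
    push_cast
    linarith
  -- A lower bound for consensus and an upper bound for diffusion; both contain the same noise
  -- energy, which cancels.
  have h1 := (abs_le.1 (hcon' (n + 1) hn')).1
  have h2 := (abs_le.1 (hdif' (n + 1) hn')).2
  have h3 := bias_diffusion_le (b := p.bias wstar) (H := fun k => p.hess k wstar)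
    (Hb := p.avgHess wstar) hA hs hr0 hr1 hr (hp.avgOp_bias hmin) rfl hp.inner_avgHess_comm hσ hpos
    hp.norm_avgHess_le hε₀ hε₀' hdis hμ.le hμL hμσ n
  change p.biasEnergy wstar A A μ (n + 1) + _ ≤ p.biasEnergy wstar A 1 μ (n + 1) at h3
  have hSc := hcon.isSampling hI hμ
  have hSd := hdif.isSampling hI hμ
  rw [hp.excessRisk_eq hmin k₀ (fun k ω => consensus_eq wstar hA (n + 1) k ω)
      (memLp_errorProc wstar hp hSc (hB μ hμ) (hcon.memLp_two hμ) k₀ (n + 1)),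
    hp.excessRisk_eq hmin k₀ (fun k ω => diffusion_eq wstar hA (n + 1) k ω)
      (memLp_errorProc wstar hp hSd (hB μ hμ) (hdif.memLp_two hμ) k₀ (n + 1))]
  have h4 : ε * (μ ^ 2 + μ / B μ) = (K : ℝ)⁻¹ * (2 * (K * ε / 2 * (μ ^ 2 + μ / B μ))) := by
    field_simp
  rw [h4, mul_assoc, ← mul_add, ← mul_add]
  refine mul_le_mul_of_nonneg_left ?_ (by positivity)
  linarith

end Risk

end Problem

/-! ### The theorem -/

theorem corollary1 {K : ℕ} (A : Matrix (Fin K) (Fin K) ℝ) (hA : IsCombinationMatrix A)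
    (σ : ℝ) (hσ : 0 < σ) :
    ∃ ε₀ : ℝ, 0 < ε₀ ∧
      ∀ (M : ℕ) (X : Type u) (p : Problem K M X) (L : ℝ≥0) (wstar : Vec M)
        (Ω : Type v) [MeasurableSpace Ω] (P : Measure Ω) [IsProbabilityMeasure P]
        (I : ∀ k : Fin K, ℕ → ℕ → Ω → Fin (p.N k))
        (B : ℝ → ℕ) (c η T : ℝ) (wcon wdif : ℝ → Fin K → Ω → Vec M),
        p.IsSmooth L →
        IsLocalMin p.J wstar →
        (∀ v : Vec M, σ * ‖v‖ ^ 2 ≤ inner ℝ (p.avgHess wstar v) v) →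
        (∀ k, ‖p.hess k wstar - p.avgHess wstar‖ ≤ ε₀) →
        p.IsUniformSampling P I →
        0 ≤ η →
        (∀ μ, 0 < μ → 1 ≤ B μ) →
        (∀ᶠ μ in 𝓝[>] (0 : ℝ), 1 / (B μ : ℝ) ≤ c * μ ^ η) →
        0 < T →
        p.IsCloseStart P I B wstar wcon →
        p.IsCloseStart P I B wstar wdif →
        (∀ μ, 0 < μ → ∀ n k,
          Integrable (fun ω => p.J (p.consensus A I (B μ) μ (wcon μ) n k ω)) P ∧
          Integrable (fun ω => p.J (p.diffusion A I (B μ) μ (wdif μ) n k ω)) P) ∧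
        (∀ δ : ℝ, 0 < δ → ∀ᶠ μ in 𝓝[>] (0 : ℝ), ∀ n : ℕ, (n : ℝ) ≤ T / μ →
          p.excessRisk P wstar (p.diffusion A I (B μ) μ (wdif μ)) n ≤
            p.excessRisk P wstar (p.consensus A I (B μ) μ (wcon μ)) n
              + δ * (μ ^ 2 + μ ^ (1 + η))) ∧
        (1 ≤ η → (∃ k, gradient (p.Jk k) wstar ≠ 0) →
          ∀ᶠ μ in 𝓝[>] (0 : ℝ), ∀ n : ℕ, (n : ℝ) ≤ T / μ →
            p.excessRisk P wstar (p.diffusion A I (B μ) μ (wdif μ)) n ≤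
              p.excessRisk P wstar (p.consensus A I (B μ) μ (wcon μ)) n) := by
  obtain ⟨r, hr0, hr1, hr⟩ := exists_contraction_factor hA
  obtain ⟨k₀, _⟩ := hA.selfLoop
  have hK : (0 : ℝ) < K := by exact_mod_cast k₀.pos
  have h1r : 0 < 1 - r := by linarith
  have h1r2 : 0 < 1 - r ^ 2 := by nlinarith
  -- The largest disagreement that `bias_diffusion_le` allows; it involves only the contraction
  -- factor of `A` and σ.
  refine ⟨√((1 - r ^ 2) * (1 - r) ^ 4 * σ ^ 2 / 8), by positivity, ?_⟩
  intro M X p L wstar Ω _ P _ I B c η T wcon wdif hp hmin hpos hdis hI hη hB hBη hT hcon hdif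
  have main : ∀ ε : ℝ, 0 < ε → _ := fun ε hε =>
    Problem.eventually_excessRisk_le k₀ hp hmin hA.stochastic hA.symm hr0 hr1 hr hσ hpos
      (Real.sqrt_nonneg _) (Real.sq_sqrt (by positivity)).le hdis hI hB hcon hdif hT.le hε
  have hθ : ∀ᶠ μ in 𝓝[>] (0 : ℝ), μ ^ 2 + μ / B μ ≤ (1 + |c|) * (μ ^ 2 + μ ^ (1 + η)) := by
    filter_upwards [hBη, self_mem_nhdsWithin] with μ h hμ
    have hμ : 0 < μ := hμ
    have h1 : μ / B μ ≤ |c| * μ ^ (1 + η) := by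
      rw [Real.rpow_add hμ, Real.rpow_one, div_eq_mul_one_div]
      calc μ * (1 / (B μ : ℝ)) ≤ μ * (c * μ ^ η) := by gcongr
        _ ≤ μ * (|c| * μ ^ η) := by gcongr; exact le_abs_self c
        _ = _ := by ring
    have h2 : 0 < μ ^ (1 + η) := Real.rpow_pos_of_pos hμ _
    have h3 : 0 ≤ |c| * μ ^ 2 := by positivity
    linarith
  refine ⟨fun μ hμ n k => ⟨?_, ?_⟩, fun δ hδ => ?_, fun hη1 hne => ?_⟩
  · simp only [Problem.consensus_eq wstar hA.stochastic]
    exact hp.integrable_J hmin ((memLp_piLp_iff (p := 2)).1 (Problem.memLp_errorProc wstar hp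
      (hcon.isSampling hI hμ) (hB μ hμ) (hcon.memLp_two hμ) k₀ n) k)
  · simp only [Problem.diffusion_eq wstar hA.stochastic]
    exact hp.integrable_J hmin ((memLp_piLp_iff (p := 2)).1 (Problem.memLp_errorProc wstar hp
      (hdif.isSampling hI hμ) (hB μ hμ) (hdif.memLp_two hμ) k₀ n) k)
  · filter_upwards [main (δ / (1 + |c|)) (by positivity), hθ] with μ h1 h2 n hn
    have h3 := h1 n hn
    have h4 : δ / (1 + |c|) * (μ ^ 2 + μ / B μ) ≤ δ * (μ ^ 2 + μ ^ (1 + η)) := by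
      calc _ ≤ δ / (1 + |c|) * ((1 + |c|) * (μ ^ 2 + μ ^ (1 + η))) := by gcongr
        _ = _ := by field_simp
    have h5 : 0 ≤ (K : ℝ)⁻¹ *
        ((1 - r ^ 2) * (1 - r) ^ 2 * σ / 16 * ‖p.bias wstar‖ ^ 2) * μ ^ 2 := by
      positivity
    linarith
  · have hb : 0 < ‖p.bias wstar‖ := by
      obtain ⟨k, hk⟩ := hne
      exact (norm_pos_iff.2 hk).trans_le (PiLp.norm_apply_le (p.bias wstar) k)
    set g := (K : ℝ)⁻¹ * ((1 - r ^ 2) * (1 - r) ^ 2 * σ / 16 * ‖p.bias wstar‖ ^ 2) with hg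
    have hg0 : 0 < g := by positivity
    -- With η ≥ 1 and μ ≤ 1 the error scale is at most 2(1 + |c|)μ², so this accuracy makes the
    -- total error at most the gain g μ².
    filter_upwards [main (g / (2 * (1 + |c|))) (by positivity), hθ, self_mem_nhdsWithin,
      Ioc_mem_nhdsGT (zero_lt_one' ℝ)] with μ h1 h2 hμ hμ1 n hn
    have h3 := h1 n hn
    have h6 : μ ^ (1 + η) ≤ μ ^ 2 := by
      rw [← Real.rpow_natCast μ 2]
      exact Real.rpow_le_rpow_of_exponent_ge hμ hμ1.2 (by push_cast; linarith)
    have h4 : g / (2 * (1 + |c|)) * (μ ^ 2 + μ / B μ) ≤ g * μ ^ 2 := by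
      calc _ ≤ g / (2 * (1 + |c|)) * ((1 + |c|) * (μ ^ 2 + μ ^ 2)) := by
            gcongr
            exact h2.trans (by gcongr)
        _ = _ := by field_simp; ring
    linarith
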